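/- Let $\Bbbk$ be an algebraically closed field of characteristic $0$. For an augmented $\Bbbk$-algebra $A$ and a left $A$-module $M$ put $\operatorname{H}(A,M)=\bigoplus_{n\ge 0}\operatorname{Ext}^n_A(\Bbbk,M)$, where $\Bbbk$ is the trivial $A$-module; $\operatorname{H}(A,\Bbbk)$ is a $\Bbbk$-algebra under the Yoneda product and $\operatorname{H}(A,M)$ is a module over it. We say that $A$ has finitely generated cohomology (fgc) if $\operatorname{H}(A,\Bbbk)$ is a finitely generated $\Bbbk$-algebra and $\operatorname{H}(A,M)$ is a finitely generated $\operatorname{H}(A,\Bbbk)$-module for every finitely generated $A$-module $M$. A braided vector space is a vector space $V$ with $c\in GL(V\otimes V)$ satisfying the braid equation $(c\otimes \mathrm{id})(\mathrm{id}\otimes c)(c\otimes \mathrm{id})=(\mathrm{id}\otimes c)(c\otimes \mathrm{id})(\mathrm{id}\otimes c)$. It is of diagonal type if $V$ has a finite basis $x_1,\dots,x_\theta$ with $c(x_i\otimes x_j)=q_{ij}\,x_j\otimes x_i$ for some scalars $q_{ij}\in\Bbbk^\times$. Its Nichols algebra $\mathscr{B}(V)$ is the quotient of the tensor algebra $T(V)$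 by the ideal generated by the kernels of the quantum symmetrizers on $V^{\otimes n}$, $n\ge 0$, augmented by $V\mapsto 0$. A realization of $(V,c)$ over a Hopf algebra $H$ is a structure of left Yetter-Drinfeld module over $H$ on $V$ whose categorical braiding $v\otimes w\mapsto v_{(-1)}\cdot w\otimes v_{(0)}$ equals $c$; $V$ is realizable over $H$ if a realization exists, and realizable over a group $\Gamma$ if it is realizable over the group algebra $\Bbbk\Gamma$. A realization over $H$ makes $\mathscr{B}(V)$ an $H$-module algebra; $\mathscr{B}(V)\# H$ denotes the corresponding smash product, the algebra underlying the bosonization, augmented by the product of the augmentation of $\mathscr{B}(V)$ and the counit of $H$. Theorem. Let $V$ be a braided vector space of diagonal type such that (a) the Nichols algebra $\mathscr{B}(V)$ is finite-dimensional, (b) $V$ is realizable over a finite abelian group, (c) the algebra $\operatorname{H}(\mathscr{B}(V),\Bbbk)$ is finitely generated. Let $K$ be a semisimple Hopf algebra over $\Bbbk$ and assume that $V$ is realizable over $K$. Then, for every realization of $V$ over $K$, the algebra $\mathscr{B}(V)\# K$ has finitely generated cohomology. -/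

import Mathlib

universe u

section ModuleAlgebraSection

open TensorProduct Coalgebra

variable (k H A : Type u) [Field k] [Ring H] [Bialgebra k H] [Ring A] [Algebra k A]

/-- A (left) `H`-module algebra structure on the `k`-algebra `A`: an `H`-module structure with
`h ⬝ 1 = ε(h) 1` and `h ⬝ (a b) = (h₁ ⬝ a) (h₂ ⬝ b)`. -/
structure ModuleAlgebra where
  /-- the action of `H` on `A` -/
  act : H →ₐ[k] Module.End k A
  act_one : ∀ h : H, act h 1 = algebraMap k A (counit h)
  act_mul : ∀ (h : H) (a b : A), act h (a * b) =
    ∑ i ∈ (ℛ k h).index, act ((ℛ k h).left i) a * act ((ℛ k h).right i) b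

variable {k H A}

/-- The smash product algebra `A # H` of an `H`-module algebra `A` with `H`: the vector space
`A ⊗ H` with multiplication `(a # h)(b # g) = a (h₁ ⬝ b) # h₂ g`. -/
def Smash (_α : ModuleAlgebra k H A) : Type u := A ⊗[k] H

namespace Smash

variable (α : ModuleAlgebra k H A)

noncomputable instance : AddCommGroup (Smash α) := inferInstanceAs (AddCommGroup (A ⊗[k] H))
noncomputable instance : Module k (Smash α) := inferInstanceAs (Module k (A ⊗[k] H))

/-- Left multiplication by `A` on `A ⊗ H`: `a (b ⊗ g) = a b ⊗ g`. -/
noncomputable def leftMul : A →ₐ[k] Module.End k (A ⊗[k] H) :=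
  (Module.endTensorEndAlgHom (R := k) (S := k) (A := k) (M := A) (N := H)).comp
    (Algebra.TensorProduct.includeLeft.comp (Algebra.lmul k A))

/-- The diagonal action of `H` on `A ⊗ H`: `h (b ⊗ g) = (h₁ ⬝ b) ⊗ h₂ g`. -/
noncomputable def diag : H →ₐ[k] Module.End k (A ⊗[k] H) :=
  (Module.endTensorEndAlgHom (R := k) (S := k) (A := k) (M := A) (N := H)).comp
    ((Algebra.TensorProduct.map α.act (Algebra.lmul k H)).comp (Bialgebra.comulAlgHom k H))

/-- The multiplication of `A # H`, as a map `A ⊗ H → End (A ⊗ H)`: left multiplication by `a # h`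
is the diagonal action of `h` followed by left multiplication by `a`. -/
noncomputable def mulMap : A ⊗[k] H →ₗ[k] Module.End k (A ⊗[k] H) :=
  TensorProduct.lift ((LinearMap.mul k (Module.End k (A ⊗[k] H))).compl₁₂
    (leftMul (k := k) (H := H) (A := A)).toLinearMap (diag α).toLinearMap)

variable {α}

theorem leftMul_tmul (a b : A) (g : H) :
    leftMul (k := k) (H := H) a (b ⊗ₜ g) = (a * b) ⊗ₜ[k] g := by
  change TensorProduct.map _ _ (b ⊗ₜ g) = _
  simp

theorem diag_tmul (h : H) (b : A) (g : H) : diag α h (b ⊗ₜ g) =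
    ∑ i ∈ (ℛ k h).index, α.act ((ℛ k h).left i) b ⊗ₜ[k] ((ℛ k h).right i * g) := by
  simp only [diag, AlgHom.comp_apply, Bialgebra.comulAlgHom_apply]
  conv_lhs => rw [← (ℛ k h).eq]
  simp only [map_sum, LinearMap.sum_apply, Algebra.TensorProduct.map_tmul]
  rfl

theorem mulMap_tmul (a : A) (h : H) :
    mulMap α (a ⊗ₜ h) = leftMul (k := k) (H := H) a * diag α h := by
  simp [mulMap]

theorem diag_mul_leftMul (h : H) (b : A) : diag α h * leftMul b =
    ∑ i ∈ (ℛ k h).index, leftMul (α.act ((ℛ k h).left i) b) * diag α ((ℛ k h).right i) := by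
  ext b' g
  simp only [TensorProduct.AlgebraTensorModule.curry_apply, TensorProduct.curry_apply,
    LinearMap.coe_restrictScalars, Module.End.mul_apply, LinearMap.sum_apply, leftMul_tmul,
    diag_tmul, map_sum, α.act_mul, TensorProduct.sum_tmul]
  have key := Coalgebra.sum_tmul_tmul_eq (ℛ k h) (fun i => ℛ k ((ℛ k h).left i))
    (fun i => ℛ k ((ℛ k h).right i))
  let F : H ⊗[k] (H ⊗[k] H) →ₗ[k] A ⊗[k] H :=
    ((TensorProduct.map (LinearMap.mul' k A) LinearMap.id) ∘ₗ
      (TensorProduct.assoc k A A H).symm.toLinearMap) ∘ₗ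
    TensorProduct.map (α.act.toLinearMap.flip b)
      (TensorProduct.map (α.act.toLinearMap.flip b') (LinearMap.mulRight k g))
  have := congrArg F key
  simpa [F, map_sum] using this

theorem mulMap_mulMap (x y : A ⊗[k] H) : mulMap α (mulMap α x y) = mulMap α x * mulMap α y := by
  induction x with
  | zero => simp
  | add x x' hx hx' => simp only [map_add, LinearMap.add_apply, hx, hx', add_mul]
  | tmul a h =>
    induction y with
    | zero => simp
    | add y y' hy hy' => simp only [map_add, hy, hy', mul_add]
    | tmul b g =>
      rw [mulMap_tmul, mulMap_tmul, mul_assoc, ← mul_assoc (diag α h), diag_mul_leftMul,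
        Module.End.mul_apply, diag_tmul]
      simp only [map_sum, leftMul_tmul, mulMap_tmul, Finset.sum_mul, Finset.mul_sum, map_mul,
        mul_assoc]

variable (α) in
/-- The element `a # h` of `A # H`. -/
def tmul (a : A) (h : H) : Smash α := a ⊗ₜ[k] h

variable (α) in
/-- The linear isomorphism of `A ⊗ H` with `A # H`. -/
def ofTensor : A ⊗[k] H ≃ₗ[k] Smash α := LinearEquiv.refl k (A ⊗[k] H)

theorem ofTensor_tmul (a : A) (h : H) : ofTensor α (a ⊗ₜ h) = tmul α a h := rfl

noncomputable instance : Mul (Smash α) := ⟨fun x y => mulMap α x y⟩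
noncomputable instance : One (Smash α) := ⟨(1 : A) ⊗ₜ[k] (1 : H)⟩

theorem mul_def (x y : Smash α) : x * y = mulMap α x y := rfl

theorem one_def : (1 : Smash α) = (1 : A) ⊗ₜ[k] (1 : H) := rfl

theorem tmul_mul_tmul (a b : A) (h g : H) :
    tmul α a h * tmul α b g =
      ∑ i ∈ (ℛ k h).index,
        tmul α (a * α.act ((ℛ k h).left i) b) ((ℛ k h).right i * g) := by
  change mulMap α (a ⊗ₜ h) (b ⊗ₜ g) = ∑ i ∈ (ℛ k h).index,
    (a * α.act ((ℛ k h).left i) b) ⊗ₜ[k] ((ℛ k h).right i * g)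
  rw [ mulMap_tmul, Module.End.mul_apply, diag_tmul]
  simp [leftMul_tmul]

noncomputable instance : Ring (Smash α) where
  __ := (inferInstance : AddCommGroup (Smash α))
  mul_assoc x y z := by
    simp only [mul_def]
    exact congrArg (fun f => f z) (mulMap_mulMap x y)
  one_mul x := by
    change mulMap α ((1 : A) ⊗ₜ[k] (1 : H)) x = x
    rw [mulMap_tmul, map_one, map_one]; rfl
  mul_one x := by
    change mulMap α x ((1 : A) ⊗ₜ[k] (1 : H)) = x
    induction x using TensorProduct.induction_on with
    | zero => simp
    | add x y hx hy => rw [map_add, LinearMap.add_apply, hx, hy]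
    | tmul a h =>
      rw [mulMap_tmul, Module.End.mul_apply, diag_tmul]
      simp only [α.act_one, mul_one, Algebra.algebraMap_eq_smul_one, TensorProduct.smul_tmul,
        ← TensorProduct.tmul_sum]
      rw [Coalgebra.sum_counit_smul, leftMul_tmul, mul_one]
  left_distrib x y z := map_add (mulMap α x) y z
  right_distrib x y z := LinearMap.map_add₂ (mulMap α) x y z
  zero_mul x := LinearMap.map_zero₂ (mulMap α) x
  mul_zero x := map_zero (mulMap α x)

noncomputable instance : Algebra k (Smash α) :=
  Algebra.ofModule
    (fun r x y => LinearMap.map_smul₂ (mulMap α) r x y)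
    (fun r x y => map_smul (mulMap α x) r y)

/-- The augmentation `a # h ↦ ε_A(a) ε(h)` of `A # H`, for an augmentation `ε_A` of `A` with
`ε_A (h ⬝ a) = ε(h) ε_A(a)`. -/
noncomputable def aug (ε : A →ₐ[k] k)
    (hε : ∀ (h : H) (a : A), ε (α.act h a) = counit h * ε a) : Smash α →ₐ[k] k :=
  AlgHom.ofLinearMap
    (LinearMap.mul' k k ∘ₗ TensorProduct.map ε.toLinearMap counit ∘ₗ (ofTensor α).symm.toLinearMap)
    (by
      change LinearMap.mul' k k (TensorProduct.map ε.toLinearMap counit ((1 : A) ⊗ₜ[k] (1 : H))) = 1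
      simp)
    (by
      intro x y
      obtain ⟨x, rfl⟩ := (ofTensor α).surjective x
      obtain ⟨y, rfl⟩ := (ofTensor α).surjective y
      induction x using TensorProduct.induction_on with
      | zero => simp only [zero_mul, map_zero]
      | add x x' hx hx' => simp only [add_mul, map_add, hx, hx']
      | tmul a h =>
        induction y using TensorProduct.induction_on with
        | zero => simp only [mul_zero, map_zero]
        | add y y' hy hy' => simp only [mul_add, map_add, hy, hy']
        | tmul b g =>
          have : (counit h : k) = ∑ i ∈ (ℛ k h).index,
              counit ((ℛ k h).left i) * counit ((ℛ k h).right i) := by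
            conv_lhs => rw [← Coalgebra.sum_counit_smul (ℛ k h)]
            simp
          rw [ofTensor_tmul, ofTensor_tmul, tmul_mul_tmul]
          simp only [← ofTensor_tmul, map_sum, LinearMap.comp_apply, TensorProduct.map_tmul,
            LinearMap.mul'_apply, LinearEquiv.coe_coe, LinearEquiv.symm_apply_apply,
            AlgHom.toLinearMap_apply, map_mul, hε, Bialgebra.counit_mul]
          rw [this, Finset.mul_sum, Finset.sum_mul]
          refine Finset.sum_congr rfl fun i _ => by ring)

theorem aug_tmul (ε : A →ₐ[k] k)
    (hε : ∀ (h : H) (a : A), ε (α.act h a) = counit h * ε a) (a : A) (h : H) :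
    aug ε hε (tmul α a h) = ε a * counit h := rfl

end Smash
end ModuleAlgebraSection

section YonedaSection

open CategoryTheory CategoryTheory.Abelian

universe w' v' u' t'

variable {C : Type u'} [Category.{v'} C] [Abelian C] [HasExt.{w'} C] {X Y : C}

/-- Changing the name of the degree of a Yoneda product does not change it. -/
theorem Ext.mk_comp_eq {Z : C} {a b c d : ℕ} (α : Ext X Y a) (β : Ext Y Z b) (h : a + b = c)
    (h' : a + b = d) :
    GradedMonoid.mk (A := Ext X Z) c (α.comp β h) = GradedMonoid.mk d (α.comp β h') := by
  subst h; subst h'; rfl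

/-- The Yoneda product, in the order `Ext X Y a × Ext Y Z b → Ext X Z (a + b)`, makes the groups
`Ext X X n` into a graded ring. -/
noncomputable instance : GradedMonoid.GMul (Ext X X) where
  mul x y := Ext.comp x y rfl

noncomputable instance : GradedMonoid.GOne (Ext X X) where
  one := Ext.mk₀ (𝟙 X)

noncomputable instance : GradedMonoid.GMonoid (Ext X X) where
  one_mul := by
    rintro ⟨n, x⟩
    refine (Ext.mk_comp_eq (Ext.mk₀ (𝟙 X)) x _ (zero_add n)).trans ?_
    rw [Ext.mk₀_id_comp]; rfl
  mul_one := by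
    rintro ⟨n, x⟩
    refine (Ext.mk_comp_eq x (Ext.mk₀ (𝟙 X)) _ (add_zero n)).trans ?_
    rw [Ext.comp_mk₀_id]; rfl
  mul_assoc := by
    rintro ⟨n, x⟩ ⟨m, y⟩ ⟨p, z⟩
    change GradedMonoid.mk _ ((x.comp y rfl).comp z rfl) =
      GradedMonoid.mk _ (x.comp (y.comp z rfl) rfl)
    rw [Ext.comp_assoc x y z rfl rfl rfl]
    exact Ext.mk_comp_eq _ _ _ _

noncomputable instance : DirectSum.GRing (Ext X X) where
  mul_zero _ := Ext.comp_zero _ _ _ _ _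
  zero_mul _ := Ext.zero_comp _ _ _ _ _
  mul_add _ _ _ := Ext.comp_add _ _ _ _
  add_mul _ _ _ := Ext.add_comp _ _ _ _
  natCast n := n • Ext.mk₀ (𝟙 X)
  natCast_zero := zero_smul _ _
  natCast_succ _ := succ_nsmul _ _
  intCast n := n • Ext.mk₀ (𝟙 X)
  intCast_ofNat _ := natCast_zsmul _ _
  intCast_negSucc_ofNat _ := negSucc_zsmul _ _

/-- The Yoneda product makes the groups `Ext X Y n` into a graded module over the graded ring
`Ext X X`. -/
noncomputable instance : DirectSum.Gmodule (Ext X X) (Ext X Y) where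
  smul x y := Ext.comp x y rfl
  one_smul := by
    rintro ⟨n, x⟩
    refine (Ext.mk_comp_eq (Ext.mk₀ (𝟙 X)) x _ (zero_add n)).trans ?_
    rw [Ext.mk₀_id_comp]; rfl
  mul_smul := by
    rintro ⟨n, x⟩ ⟨m, y⟩ ⟨p, z⟩
    change GradedMonoid.mk _ ((x.comp y rfl).comp z rfl) =
      GradedMonoid.mk _ (x.comp (y.comp z rfl) rfl)
    rw [Ext.comp_assoc x y z rfl rfl rfl]
    exact Ext.mk_comp_eq _ _ _ _
  smul_zero _ := Ext.comp_zero _ _ _ _ _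
  zero_smul _ := Ext.zero_comp _ _ _ _ _
  smul_add _ _ _ := Ext.comp_add _ _ _ _
  add_smul _ _ _ := Ext.add_comp _ _ _ _

/-- In an `R`-linear category, the graded ring `Ext X X` is a graded `R`-algebra. -/
noncomputable instance {R : Type t'} [CommRing R] [Linear R C] :
    DirectSum.GAlgebra R (Ext X X) where
  toFun :=
    { toFun r := r • Ext.mk₀ (𝟙 X)
      map_zero' := zero_smul _ _
      map_add' r s := add_smul _ _ _ }
  map_one := one_smul _ _
  map_mul r s := by
    change GradedMonoid.mk 0 ((r * s) • Ext.mk₀ (𝟙 X)) =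
      GradedMonoid.mk 0 (Ext.comp (r • Ext.mk₀ (𝟙 X)) (s • Ext.mk₀ (𝟙 X)) rfl)
    rw [Ext.smul_comp, Ext.comp_smul, Ext.comp_mk₀_id, mul_smul]
  commutes r := by
    rintro ⟨n, x⟩
    change GradedMonoid.mk _ (Ext.comp (r • Ext.mk₀ (𝟙 X)) x rfl) =
      GradedMonoid.mk _ (Ext.comp x (r • Ext.mk₀ (𝟙 X)) rfl)
    rw [Ext.mk_comp_eq _ _ _ (zero_add n), Ext.mk_comp_eq x _ _ (add_zero n), Ext.smul_comp,
      Ext.comp_smul, Ext.comp_mk₀_id, Ext.mk₀_id_comp]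
  smul_def r := by
    rintro ⟨n, x⟩
    change GradedMonoid.mk n (r • x) = GradedMonoid.mk _ (Ext.comp (r • Ext.mk₀ (𝟙 X)) x rfl)
    rw [Ext.mk_comp_eq _ _ _ (zero_add n), Ext.smul_comp, Ext.mk₀_id_comp]

end YonedaSection

section CohomologySection

open CategoryTheory CategoryTheory.Abelian DirectSum

/-- The trivial module `k` of an augmented `k`-algebra `ε : A → k`. -/
noncomputable def trivialModule {k A : Type u} [Field k] [Ring A] [Algebra k A] (ε : A →ₐ[k] k) :
    ModuleCat.{u} A :=
  letI : Module A k := Module.compHom k ε.toRingHom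
  ModuleCat.of A k

variable {k A : Type u} [Field k] [Ring A] [Algebra k A] (ε : A →ₐ[k] k)

/-- The cohomology `H(A, M) = ⨁ₙ Extⁿ_A(k, M)` of an augmented algebra `ε : A → k` with values in
an `A`-module `M`. -/
abbrev Cohomology (M : ModuleCat.{u} A) : Type u :=
  ⨁ n : ℕ, Ext (trivialModule ε) M n

/-- The cohomology ring `H(A, k)` of the augmented algebra `ε : A → k`, a `k`-algebra for the
Yoneda product. -/
abbrev CohomologyRing : Type u := Cohomology ε (trivialModule ε)

/-- The cohomology ring `H(A, k)` is finitely generated (as a `k`-algebra). -/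
def HasFGCohomologyRing : Prop := Algebra.FiniteType k (CohomologyRing ε)

/-- The augmented algebra `ε : A → k` has finitely generated cohomology (fgc): the cohomology ring
`H(A, k)` is a finitely generated algebra, and `H(A, M)` is a finitely generated `H(A, k)`-module
for each finitely generated `A`-module `M`. -/
structure HasFGC : Prop where
  ring_fg : HasFGCohomologyRing ε
  module_finite : ∀ (M : ModuleCat.{u} A), Module.Finite A M →
    Module.Finite (CohomologyRing ε) (Cohomology ε M)

end CohomologySection

section BraidedSection

open TensorProduct Coalgebra

variable {k : Type u} [Field k]

/-- For `c : V ⊗ V → V ⊗ V`, the map `c ⊗ id_W` on `V ⊗ (V ⊗ W)`. -/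
noncomputable def onFirstTwo {V : Type u} [AddCommGroup V] [Module k V]
    (c : V ⊗[k] V →ₗ[k] V ⊗[k] V) (W : Type u) [AddCommGroup W] [Module k W] :
    V ⊗[k] (V ⊗[k] W) →ₗ[k] V ⊗[k] (V ⊗[k] W) :=
  (TensorProduct.assoc k V V W).toLinearMap ∘ₗ c.rTensor W ∘ₗ
    (TensorProduct.assoc k V V W).symm.toLinearMap

variable (k) in
/-- The structure of a braided vector space on `V`: an invertible `c ∈ GL(V ⊗ V)` satisfying the
braid equation `(c ⊗ id)(id ⊗ c)(c ⊗ id) = (id ⊗ c)(c ⊗ id)(id ⊗ c)` on `V ⊗ V ⊗ V`. -/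
structure Braiding (V : Type u) [AddCommGroup V] [Module k V] where
  /-- the braiding -/
  c : V ⊗[k] V ≃ₗ[k] V ⊗[k] V
  braid_eq : onFirstTwo c.toLinearMap V ∘ₗ c.toLinearMap.lTensor V ∘ₗ onFirstTwo c.toLinearMap V =
    c.toLinearMap.lTensor V ∘ₗ onFirstTwo c.toLinearMap V ∘ₗ c.toLinearMap.lTensor V

variable {V : Type u} [AddCommGroup V] [Module k V]

/-- A braided vector space is of diagonal type if it has a finite basis `(x_i)` with
`c (x_i ⊗ x_j) = q_{ij} x_j ⊗ x_i` for non-zero scalars `q_{ij}`. -/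
def Braiding.IsDiagonalType (c : Braiding k V) : Prop :=
  ∃ (θ : ℕ) (x : Module.Basis (Fin θ) k V) (q : Fin θ → Fin θ → kˣ),
    ∀ i j, c.c (x i ⊗ₜ x j) = (q i j : k) • (x j ⊗ₜ[k] x i)

variable (k V) in
/-- The tensor powers `V^{⊗ 0} = k`, `V^{⊗ (n + 1)} = V ⊗ V^{⊗ n}`. -/
noncomputable def TPow : ℕ → ModuleCat.{u} k
  | 0 => ModuleCat.of k k
  | n + 1 => ModuleCat.of k (V ⊗[k] TPow n)

variable (k V) in
/-- The canonical map `V^{⊗ n} → T(V)`. -/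
noncomputable def TPow.toTensorAlgebra : (n : ℕ) → TPow k V n →ₗ[k] TensorAlgebra k V
  | 0 => Algebra.linearMap k (TensorAlgebra k V)
  | n + 1 => LinearMap.mul' k (TensorAlgebra k V) ∘ₗ
      TensorProduct.map (TensorAlgebra.ι k) (TPow.toTensorAlgebra n)

namespace Braiding

variable (c : Braiding k V)

/-- The operator `id + c₁ + c₂ c₁ + ⋯ + cₙ ⋯ c₂ c₁` on `V ⊗ V^{⊗ n} = V^{⊗ (n + 1)}`, where `cᵢ` is
the braiding applied to the tensor factors `i` and `i + 1`. -/
noncomputable def shuffle : (n : ℕ) → V ⊗[k] TPow k V n →ₗ[k] V ⊗[k] TPow k V n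
  | 0 => LinearMap.id
  | n + 1 => (LinearMap.id + (shuffle n).lTensor V ∘ₗ onFirstTwo c.c.toLinearMap (TPow k V n) :
      V ⊗[k] (V ⊗[k] TPow k V n) →ₗ[k] V ⊗[k] (V ⊗[k] TPow k V n))

/-- The quantum symmetrizer `𝔖ₙ` on `V^{⊗ n}`, i.e. the sum over `w` in the symmetric group of the
action of the positive lift of `w` to the braid group, by way of the factorization
`𝔖_{n + 1} = (id + c₁ + c₂ c₁ + ⋯ + cₙ ⋯ c₁) (id ⊗ 𝔖ₙ)`. -/
noncomputable def symmetrizer : (n : ℕ) → TPow k V n →ₗ[k] TPow k V n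
  | 0 => LinearMap.id
  | n + 1 => (c.shuffle n ∘ₗ (symmetrizer n).lTensor V : V ⊗[k] TPow k V n →ₗ[k] V ⊗[k] TPow k V n)

/-- The relations of the Nichols algebra: the kernels of the quantum symmetrizers. -/
inductive NicholsRel : TensorAlgebra k V → TensorAlgebra k V → Prop
  | of (n : ℕ) (x : TPow k V n) (hx : c.symmetrizer n x = 0) :
      NicholsRel (TPow.toTensorAlgebra k V n x) 0

end Braiding

/-- The Nichols algebra `𝔅(V)` of a braided vector space: the quotient of the tensor algebra `T(V)`
by the two-sided ideal generated by the kernels of all quantum symmetrizers. -/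
def NicholsAlgebra (c : Braiding k V) : Type u := RingQuot c.NicholsRel

namespace NicholsAlgebra

variable (c : Braiding k V)

noncomputable instance : Ring (NicholsAlgebra c) := inferInstanceAs (Ring (RingQuot c.NicholsRel))
noncomputable instance : Algebra k (NicholsAlgebra c) :=
  inferInstanceAs (Algebra k (RingQuot c.NicholsRel))

/-- The projection `T(V) → 𝔅(V)`. -/
noncomputable def mk : TensorAlgebra k V →ₐ[k] NicholsAlgebra c := RingQuot.mkAlgHom k c.NicholsRel

theorem mk_surjective : Function.Surjective (mk c) := RingQuot.mkAlgHom_surjective k _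

theorem mk_eq_zero (n : ℕ) (x : TPow k V n) (hx : c.symmetrizer n x = 0) :
    mk c (TPow.toTensorAlgebra k V n x) = 0 :=
  (RingQuot.mkAlgHom_rel k (Braiding.NicholsRel.of n x hx)).trans (map_zero _)

/-- The universal property of the quotient. -/
noncomputable def lift {B : Type u} [Semiring B] [Algebra k B] (f : TensorAlgebra k V →ₐ[k] B)
    (hf : ∀ (n : ℕ) (x : TPow k V n), c.symmetrizer n x = 0 →
      f (TPow.toTensorAlgebra k V n x) = 0) : NicholsAlgebra c →ₐ[k] B :=
  RingQuot.liftAlgHom k ⟨f, by rintro _ _ ⟨n, x, hx⟩; rw [hf n x hx, map_zero]⟩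

theorem lift_mk {B : Type u} [Semiring B] [Algebra k B] (f : TensorAlgebra k V →ₐ[k] B)
    (hf : ∀ (n : ℕ) (x : TPow k V n), c.symmetrizer n x = 0 →
      f (TPow.toTensorAlgebra k V n x) = 0) (t : TensorAlgebra k V) :
    lift c f hf (mk c t) = f t :=
  RingQuot.liftAlgHom_mkAlgHom_apply k _ _ _

theorem algebraMapInv_toTensorAlgebra_succ (n : ℕ) (x : TPow k V (n + 1)) :
    TensorAlgebra.algebraMapInv (TPow.toTensorAlgebra k V (n + 1) x) = 0 := by
  change V ⊗[k] TPow k V n at x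
  change TensorAlgebra.algebraMapInv (LinearMap.mul' k (TensorAlgebra k V)
      (TensorProduct.map (TensorAlgebra.ι k) (TPow.toTensorAlgebra k V n) x)) = 0
  induction x using TensorProduct.induction_on with
  | zero => simp
  | add x y hx hy => simp only [map_add, hx, hy, add_zero]
  | tmul v x => simp [TensorAlgebra.algebraMapInv]

/-- The augmentation `𝔅(V) → k`, zero on `V`. -/
noncomputable def aug : NicholsAlgebra c →ₐ[k] k :=
  lift c TensorAlgebra.algebraMapInv fun n x hx => by
    cases n with
    | zero =>
      have : x = 0 := hx
      rw [this, map_zero, map_zero]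
    | succ n => exact algebraMapInv_toTensorAlgebra_succ n x

theorem aug_mk (t : TensorAlgebra k V) : aug c (mk c t) = TensorAlgebra.algebraMapInv t :=
  lift_mk c _ _ t

end NicholsAlgebra

variable {H : Type u} [Ring H] [HopfAlgebra k H]

/-- A (left-left) Yetter-Drinfeld module structure on `V` over the Hopf algebra `H`: a left module
and left comodule structure `δ(v) = v₋₁ ⊗ v₀` such that
`h₁ v₋₁ ⊗ h₂ ⬝ v₀ = (h₁ ⬝ v)₋₁ h₂ ⊗ (h₁ ⬝ v)₀`. -/
structure YetterDrinfeld (k H V : Type u) [Field k] [Ring H] [HopfAlgebra k H] [AddCommGroup V]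
    [Module k V] where
  /-- the action of `H` on `V` -/
  act : H →ₐ[k] Module.End k V
  /-- the coaction `δ : V → H ⊗ V` -/
  coact : V →ₗ[k] H ⊗[k] V
  coact_coassoc : (TensorProduct.assoc k H H V).toLinearMap ∘ₗ comul.rTensor V ∘ₗ coact =
    coact.lTensor H ∘ₗ coact
  coact_counit : (TensorProduct.lid k V).toLinearMap ∘ₗ counit.rTensor V ∘ₗ coact = LinearMap.id
  compat : ∀ (h : H) (v : V),
    ∑ i ∈ (ℛ k h).index,
      TensorProduct.map (LinearMap.mulLeft k ((ℛ k h).left i)) (act ((ℛ k h).right i)) (coact v) =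
    ∑ i ∈ (ℛ k h).index,
      (LinearMap.mulRight k ((ℛ k h).right i)).rTensor V (coact (act ((ℛ k h).left i) v))

/-- The categorical braiding `v ⊗ w ↦ v₋₁ ⬝ w ⊗ v₀` of a Yetter-Drinfeld module with itself. -/
noncomputable def YetterDrinfeld.braiding (ρ : YetterDrinfeld k H V) :
    V ⊗[k] V →ₗ[k] V ⊗[k] V :=
  (TensorProduct.lift ρ.act.toLinearMap).rTensor V ∘ₗ
    (TensorProduct.assoc k H V V).symm.toLinearMap ∘ₗ
    (TensorProduct.comm k V V).toLinearMap.lTensor H ∘ₗ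
    (TensorProduct.assoc k H V V).toLinearMap ∘ₗ ρ.coact.rTensor V

variable (H) in
/-- A realization of the braided vector space `(V, c)` over the Hopf algebra `H`: a Yetter-Drinfeld
module structure on `V` over `H` whose categorical braiding is `c`. -/
structure Realization (c : Braiding k V) extends YetterDrinfeld k H V where
  braiding_eq : toYetterDrinfeld.braiding = c.c.toLinearMap

/-- The braided vector space `(V, c)` is realizable over `H`. -/
def Braiding.IsRealizableOver (c : Braiding k V) (H : Type u) [Ring H] [HopfAlgebra k H] : Prop :=
  Nonempty (Realization H c)

theorem YetterDrinfeld.braiding_tmul (ρ : YetterDrinfeld k H V) (v w : V) :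
    ρ.braiding (v ⊗ₜ w) =
      TensorProduct.map (ρ.act.toLinearMap.flip w) LinearMap.id (ρ.coact v) := by
  simp only [YetterDrinfeld.braiding, LinearMap.comp_apply, LinearMap.rTensor_tmul]
  induction ρ.coact v using TensorProduct.induction_on with
  | zero => simp
  | add x y hx hy => simp only [TensorProduct.add_tmul, map_add, hx, hy]
  | tmul h x => simp

/-- The diagonal action `h (v ⊗ w) = h₁ v ⊗ h₂ w`. -/
noncomputable def diagAct {V W : Type u} [AddCommGroup V] [Module k V] [AddCommGroup W] [Module k W]
    (a : H →ₗ[k] Module.End k V) (b : H →ₗ[k] Module.End k W) :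
    H →ₗ[k] Module.End k (V ⊗[k] W) :=
  TensorProduct.homTensorHomMap (.id k) V W V W ∘ₗ TensorProduct.map a b ∘ₗ comul

section diagAct

variable {V W X : Type u} [AddCommGroup V] [Module k V] [AddCommGroup W] [Module k W]
  [AddCommGroup X] [Module k X]

theorem diagAct_apply (a : H →ₗ[k] Module.End k V) (b : H →ₗ[k] Module.End k W) (h : H) :
    diagAct a b h = ∑ i ∈ (ℛ k h).index,
      TensorProduct.map (a ((ℛ k h).left i)) (b ((ℛ k h).right i)) := by
  simp only [diagAct, LinearMap.comp_apply]
  conv_lhs => rw [← (ℛ k h).eq]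
  simp

theorem diagAct_assoc (a : H →ₗ[k] Module.End k V) (b : H →ₗ[k] Module.End k W)
    (d : H →ₗ[k] Module.End k X) (h : H) :
    diagAct a (diagAct b d) h ∘ₗ (TensorProduct.assoc k V W X).toLinearMap =
      (TensorProduct.assoc k V W X).toLinearMap ∘ₗ diagAct (diagAct a b) d h := by
  ext v w x
  have key := Coalgebra.sum_tmul_tmul_eq (ℛ k h) (fun i => ℛ k ((ℛ k h).left i))
    (fun i => ℛ k ((ℛ k h).right i))
  let F : H ⊗[k] (H ⊗[k] H) →ₗ[k] V ⊗[k] (W ⊗[k] X) :=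
    TensorProduct.map (a.flip v) (TensorProduct.map (b.flip w) (d.flip x))
  have := congrArg F key
  simp only [diagAct_apply, F, map_sum, TensorProduct.map_tmul, LinearMap.flip_apply,
    TensorProduct.AlgebraTensorModule.curry_apply, TensorProduct.curry_apply,
    LinearMap.coe_restrictScalars, LinearMap.comp_apply, LinearEquiv.coe_coe,
    TensorProduct.assoc_tmul, LinearMap.sum_apply, TensorProduct.sum_tmul,
    TensorProduct.tmul_sum] at this ⊢
  exact this.symm

theorem diagAct_lTensor (a : H →ₗ[k] Module.End k V) (b : H →ₗ[k] Module.End k W)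
    (f : W →ₗ[k] W) (hf : ∀ h, f ∘ₗ b h = b h ∘ₗ f) (h : H) :
    f.lTensor V ∘ₗ diagAct a b h = diagAct a b h ∘ₗ f.lTensor V := by
  ext v w
  have hf' : ∀ h x, f (b h x) = b h (f x) := fun h x => LinearMap.congr_fun (hf h) x
  simp [diagAct_apply, hf']

theorem diagAct_rTensor (a : H →ₗ[k] Module.End k V) (b : H →ₗ[k] Module.End k W)
    (f : V →ₗ[k] V) (hf : ∀ h, f ∘ₗ a h = a h ∘ₗ f) (h : H) :
    f.rTensor W ∘ₗ diagAct a b h = diagAct a b h ∘ₗ f.rTensor W := by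
  ext v w
  have hf' : ∀ h x, f (a h x) = a h (f x) := fun h x => LinearMap.congr_fun (hf h) x
  simp [diagAct_apply, hf']

theorem diagAct_onFirstTwo (a : H →ₗ[k] Module.End k V) (b : H →ₗ[k] Module.End k W)
    (c : V ⊗[k] V →ₗ[k] V ⊗[k] V) (hc : ∀ h, c ∘ₗ diagAct a a h = diagAct a a h ∘ₗ c) (h : H) :
    onFirstTwo c W ∘ₗ diagAct a (diagAct a b) h = diagAct a (diagAct a b) h ∘ₗ onFirstTwo c W := by
  have h1 := diagAct_assoc a a b h
  have h2 := diagAct_rTensor (diagAct a a) b c hc h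
  apply LinearMap.ext
  intro x
  obtain ⟨x, rfl⟩ := (TensorProduct.assoc k V V W).surjective x
  have e1 := LinearMap.congr_fun h1 x
  have e2 := LinearMap.congr_fun h2 x
  have e3 := LinearMap.congr_fun h1 (c.rTensor W x)
  simp only [onFirstTwo, LinearMap.comp_apply, LinearEquiv.coe_coe,
    LinearEquiv.symm_apply_apply] at e1 e2 e3 ⊢
  rw [e1, LinearEquiv.symm_apply_apply, e2, e3]

end diagAct

theorem YetterDrinfeld.braiding_comp_diagAct (ρ : YetterDrinfeld k H V) (h : H) :
    ρ.braiding ∘ₗ diagAct ρ.act.toLinearMap ρ.act.toLinearMap h =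
      diagAct ρ.act.toLinearMap ρ.act.toLinearMap h ∘ₗ ρ.braiding := by
  ext v w
  have key := congrArg (TensorProduct.map (ρ.act.toLinearMap.flip w) (LinearMap.id (R := k) (M := V)))
    (ρ.compat h v)
  have e1 : ∀ (g : H) (t : H ⊗[k] V),
      TensorProduct.map (ρ.act.toLinearMap.flip (ρ.act g w)) (LinearMap.id (R := k) (M := V)) t =
      TensorProduct.map (ρ.act.toLinearMap.flip w) (LinearMap.id (R := k) (M := V))
        ((LinearMap.mulRight k g).rTensor V t) := by
    intro g t
    induction t using TensorProduct.induction_on with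
    | zero => simp
    | add x y hx hy => simp only [map_add, hx, hy]
    | tmul a b => simp
  have e2 : ∀ (g g' : H) (t : H ⊗[k] V),
      TensorProduct.map (ρ.act g) (ρ.act g')
        (TensorProduct.map (ρ.act.toLinearMap.flip w) (LinearMap.id (R := k) (M := V)) t) =
      TensorProduct.map (ρ.act.toLinearMap.flip w) (LinearMap.id (R := k) (M := V))
        (TensorProduct.map (LinearMap.mulLeft k g) (ρ.act g') t) := by
    intro g g' t
    induction t using TensorProduct.induction_on with
    | zero => simp
    | add x y hx hy => simp only [map_add, hx, hy]
    | tmul a b => simp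
  simp only [map_sum] at key
  simp only [TensorProduct.AlgebraTensorModule.curry_apply, TensorProduct.curry_apply,
    LinearMap.coe_restrictScalars, LinearMap.comp_apply, diagAct_apply, LinearMap.sum_apply,
    TensorProduct.map_tmul, map_sum, YetterDrinfeld.braiding_tmul, AlgHom.toLinearMap_apply, e1, e2]
  exact key.symm

namespace YetterDrinfeld

/-- The diagonal action of `H` on `V^{⊗ n}`. -/
noncomputable def actPow (ρ : YetterDrinfeld k H V) :
    (n : ℕ) → H →ₗ[k] Module.End k (TPow k V n)
  | 0 => (LinearMap.toSpanSingleton k (Module.End k (TPow k V 0)) LinearMap.id) ∘ₗ counit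
  | n + 1 => (diagAct ρ.act.toLinearMap (actPow ρ n) : H →ₗ[k] Module.End k (V ⊗[k] TPow k V n))

end YetterDrinfeld

namespace Realization

variable {c : Braiding k V} (ρ : Realization H c)

theorem shuffle_comp (n : ℕ) (h : H) :
    c.shuffle n ∘ₗ diagAct ρ.act.toLinearMap (ρ.actPow n) h =
      diagAct ρ.act.toLinearMap (ρ.actPow n) h ∘ₗ c.shuffle n := by
  induction n generalizing h with
  | zero => rfl
  | succ n ih =>
    have h1 := diagAct_onFirstTwo ρ.act.toLinearMap (ρ.actPow n) c.c.toLinearMap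
      (by rw [← ρ.braiding_eq]; exact ρ.braiding_comp_diagAct) h
    have h2 := diagAct_lTensor ρ.act.toLinearMap (diagAct ρ.act.toLinearMap (ρ.actPow n))
      (c.shuffle n) ih h
    change (LinearMap.id + (c.shuffle n).lTensor V ∘ₗ onFirstTwo c.c.toLinearMap (TPow k V n) :
      V ⊗[k] (V ⊗[k] TPow k V n) →ₗ[k] V ⊗[k] (V ⊗[k] TPow k V n)) ∘ₗ
        diagAct ρ.act.toLinearMap (diagAct ρ.act.toLinearMap (ρ.actPow n)) h =
      diagAct ρ.act.toLinearMap (diagAct ρ.act.toLinearMap (ρ.actPow n)) h ∘ₗ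
      (LinearMap.id + (c.shuffle n).lTensor V ∘ₗ onFirstTwo c.c.toLinearMap (TPow k V n))
    rw [LinearMap.add_comp, LinearMap.comp_add, LinearMap.id_comp, LinearMap.comp_id,
      LinearMap.comp_assoc, h1, ← LinearMap.comp_assoc, h2, LinearMap.comp_assoc]

theorem symmetrizer_comp (n : ℕ) (h : H) :
    c.symmetrizer n ∘ₗ ρ.actPow n h = ρ.actPow n h ∘ₗ c.symmetrizer n := by
  induction n generalizing h with
  | zero => rfl
  | succ n ih =>
    have h2 := diagAct_lTensor ρ.act.toLinearMap (ρ.actPow n) (c.symmetrizer n) ih h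
    change (c.shuffle n ∘ₗ (c.symmetrizer n).lTensor V) ∘ₗ
        diagAct ρ.act.toLinearMap (ρ.actPow n) h =
      diagAct ρ.act.toLinearMap (ρ.actPow n) h ∘ₗ (c.shuffle n ∘ₗ (c.symmetrizer n).lTensor V)
    rw [LinearMap.comp_assoc, h2, ← LinearMap.comp_assoc, shuffle_comp, LinearMap.comp_assoc]

/-- The algebra map from `T(V)` to the convolution algebra `Hom(H, 𝔅(V))` corresponding to the
action of `H` on `T(V)` followed by the projection to `𝔅(V)`. -/
noncomputable def tensorAct :
    TensorAlgebra k V →ₐ[k] WithConv (H →ₗ[k] NicholsAlgebra c) :=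
  TensorAlgebra.lift k
    { toFun v := WithConv.toConv
        ((NicholsAlgebra.mk c).toLinearMap ∘ₗ TensorAlgebra.ι k ∘ₗ ρ.act.toLinearMap.flip v)
      map_add' v w := by ext h; simp
      map_smul' r v := by ext h; simp }

theorem tensorAct_ι (v : V) (h : H) :
    ρ.tensorAct (TensorAlgebra.ι k v) h = NicholsAlgebra.mk c (TensorAlgebra.ι k (ρ.act h v)) := by
  simp [tensorAct]

theorem tensorAct_toTensorAlgebra (n : ℕ) (x : TPow k V n) (h : H) :
    ρ.tensorAct (TPow.toTensorAlgebra k V n x) h =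
      NicholsAlgebra.mk c (TPow.toTensorAlgebra k V n (ρ.actPow n h x)) := by
  induction n generalizing h with
  | zero =>
    change k at x
    change ρ.tensorAct (algebraMap k _ x) h =
      NicholsAlgebra.mk c (algebraMap k _ (counit (R := k) h • x))
    rw [AlgHom.commutes, AlgHom.commutes, LinearMap.convAlgebraMap_apply, smul_eq_mul, map_mul,
      Algebra.smul_def, ← Algebra.commutes]
  | succ n ih =>
    change V ⊗[k] TPow k V n at x
    change ρ.tensorAct (LinearMap.mul' k (TensorAlgebra k V)
      (TensorProduct.map (TensorAlgebra.ι k) (TPow.toTensorAlgebra k V n) x)) h =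
      NicholsAlgebra.mk c (LinearMap.mul' k (TensorAlgebra k V)
      (TensorProduct.map (TensorAlgebra.ι k) (TPow.toTensorAlgebra k V n)
        (diagAct ρ.act.toLinearMap (ρ.actPow n) h x)))
    induction x using TensorProduct.induction_on with
    | zero => simp
    | add x y hx hy => simp only [map_add, ← hx, ← hy]; rfl
    | tmul v x =>
      rw [TensorProduct.map_tmul, LinearMap.mul'_apply, map_mul, (ℛ k h).convMul_apply,
        diagAct_apply]
      simp only [LinearMap.sum_apply, map_sum, TensorProduct.map_tmul, LinearMap.mul'_apply,
        map_mul, ih, tensorAct_ι, AlgHom.toLinearMap_apply]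

/-- The algebra map from `𝔅(V)` to the convolution algebra `Hom(H, 𝔅(V))` corresponding to the
action of `H` on `𝔅(V)`. -/
noncomputable def convAct : NicholsAlgebra c →ₐ[k] WithConv (H →ₗ[k] NicholsAlgebra c) :=
  NicholsAlgebra.lift c ρ.tensorAct fun n x hx => by
    ext h
    rw [tensorAct_toTensorAlgebra]
    refine NicholsAlgebra.mk_eq_zero c n _ ?_
    rw [← LinearMap.comp_apply, symmetrizer_comp, LinearMap.comp_apply, hx, map_zero]

theorem convAct_ι (v : V) (h : H) :
    ρ.convAct (NicholsAlgebra.mk c (TensorAlgebra.ι k v)) h =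
      NicholsAlgebra.mk c (TensorAlgebra.ι k (ρ.act h v)) := by
  rw [convAct, NicholsAlgebra.lift_mk, tensorAct_ι]

theorem convAct_algebraMap (r : k) (h : H) :
    ρ.convAct (algebraMap k _ r) h = counit (R := k) h • algebraMap k _ r := by
  rw [AlgHom.commutes, LinearMap.convAlgebraMap_apply, Algebra.smul_def, Algebra.smul_def,
    Algebra.commutes]

theorem convAct_mul (a b : NicholsAlgebra c) (h : H) : ρ.convAct (a * b) h =
    LinearMap.mul' k _ (TensorProduct.map (ρ.convAct a).ofConv (ρ.convAct b).ofConv (comul h)) := by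
  rw [map_mul, LinearMap.convMul_apply]

/-- Induction principle for `𝔅(V)`. -/
theorem _root_.NicholsAlgebra.induction {P : NicholsAlgebra c → Prop}
    (h1 : ∀ r, P (algebraMap k _ r)) (h2 : ∀ v, P (NicholsAlgebra.mk c (TensorAlgebra.ι k v)))
    (h3 : ∀ a b, P a → P b → P (a * b)) (h4 : ∀ a b, P a → P b → P (a + b))
    (a : NicholsAlgebra c) : P a := by
  obtain ⟨t, rfl⟩ := NicholsAlgebra.mk_surjective c a
  induction t using TensorAlgebra.induction with
  | algebraMap r => rw [AlgHom.commutes]; exact h1 r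
  | ι v => exact h2 v
  | mul a b ha hb => rw [map_mul]; exact h3 _ _ ha hb
  | add a b ha hb => rw [map_add]; exact h4 _ _ ha hb

theorem convAct_one (a : NicholsAlgebra c) : ρ.convAct a (1 : H) = a := by
  induction a using NicholsAlgebra.induction with
  | h1 r => rw [convAct_algebraMap, Bialgebra.counit_one, one_smul]
  | h2 v => rw [convAct_ι, map_one]; rfl
  | h3 a b ha hb =>
    rw [convAct_mul, Bialgebra.comul_one, Algebra.TensorProduct.one_def, TensorProduct.map_tmul,
      LinearMap.mul'_apply]
    exact congrArg₂ (· * ·) ha hb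
  | h4 a b ha hb => rw [map_add]; exact congrArg₂ (· + ·) ha hb

theorem convAct_convAct (a : NicholsAlgebra c) (h g : H) :
    ρ.convAct (ρ.convAct a g) h = ρ.convAct a (h * g) := by
  induction a using NicholsAlgebra.induction generalizing h g with
  | h1 r =>
    rw [convAct_algebraMap, convAct_algebraMap, Bialgebra.counit_mul, map_smul]
    change counit (R := k) g • ρ.convAct (algebraMap k _ r) h = _
    rw [convAct_algebraMap, smul_smul, mul_comm]
  | h2 v => rw [convAct_ι, convAct_ι, convAct_ι, map_mul]; rfl
  | h3 a b ha hb =>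
    have e := congrArg (fun x => ρ.convAct x h) (ρ.convAct_mul a b g)
    refine e.trans ?_
    rw [convAct_mul, Bialgebra.comul_mul]
    rw [← (ℛ k h).eq, ← (ℛ k g).eq]
    simp only [map_sum, TensorProduct.map_tmul, LinearMap.mul'_apply, Finset.sum_mul,
      Finset.mul_sum, Algebra.TensorProduct.tmul_mul_tmul]
    let ev : WithConv (H →ₗ[k] NicholsAlgebra c) →ₗ[k] NicholsAlgebra c :=
      LinearMap.applyₗ h ∘ₗ (WithConv.linearEquiv k (H →ₗ[k] NicholsAlgebra c)).toLinearMap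
    refine (map_sum ev _ _).trans (Finset.sum_congr rfl fun i _ => ?_)
    change ρ.convAct (ρ.convAct a ((ℛ k g).left i) * ρ.convAct b ((ℛ k g).right i)) h = _
    rw [map_mul, (ℛ k h).convMul_apply]
    exact Finset.sum_congr rfl fun j _ => congrArg₂ (· * ·) (ha _ _) (hb _ _)
  | h4 a b ha hb =>
    rw [map_add]
    change ρ.convAct (ρ.convAct a g + ρ.convAct b g) h = ρ.convAct a (h * g) + ρ.convAct b (h * g)
    rw [map_add]
    exact congrArg₂ (· + ·) (ha h g) (hb h g)

/-- The `H`-module algebra structure on `𝔅(V)` of a realization of `V` over `H`: the action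
`h ⬝ (v₁ ⋯ vₙ) = (h₁ ⬝ v₁) ⋯ (hₙ ⬝ vₙ)`. -/
noncomputable def moduleAlgebra : ModuleAlgebra k H (NicholsAlgebra c) where
  act := AlgHom.ofLinearMap
    (LinearMap.flip ((WithConv.linearEquiv k _).toLinearMap ∘ₗ ρ.convAct.toLinearMap))
    (by ext a; exact ρ.convAct_one a)
    (by intro h g; ext a; exact (ρ.convAct_convAct a h g).symm)
  act_one h := by
    change ρ.convAct 1 h = _
    rw [map_one, LinearMap.convOne_apply]
  act_mul h a b := by
    change ρ.convAct (a * b) h = _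
    rw [map_mul, (ℛ k h).convMul_apply]
    rfl

theorem moduleAlgebra_act_ι (h : H) (v : V) :
    ρ.moduleAlgebra.act h (NicholsAlgebra.mk c (TensorAlgebra.ι k v)) =
      NicholsAlgebra.mk c (TensorAlgebra.ι k (ρ.act h v)) := ρ.convAct_ι v h

theorem aug_act (h : H) (a : NicholsAlgebra c) :
    NicholsAlgebra.aug c (ρ.moduleAlgebra.act h a) = counit h * NicholsAlgebra.aug c a := by
  induction a using NicholsAlgebra.induction generalizing h with
  | h1 r =>
    change NicholsAlgebra.aug c (ρ.convAct (algebraMap k _ r) h) = _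
    rw [convAct_algebraMap, map_smul, smul_eq_mul]
  | h2 v =>
    rw [moduleAlgebra_act_ι, NicholsAlgebra.aug_mk, NicholsAlgebra.aug_mk]
    simp [TensorAlgebra.algebraMapInv]
  | h3 a b ha hb =>
    have : (counit h : k) = ∑ i ∈ (ℛ k h).index,
        counit ((ℛ k h).left i) * counit ((ℛ k h).right i) := by
      conv_lhs => rw [← Coalgebra.sum_counit_smul (ℛ k h)]
      simp
    rw [ρ.moduleAlgebra.act_mul, this, map_sum, Finset.sum_mul]
    refine Finset.sum_congr rfl fun i _ => ?_
    rw [map_mul, map_mul, ha, hb]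
    ring
  | h4 a b ha hb => simp only [map_add, ha, hb, mul_add]

end Realization

/-- The bosonization `𝔅(V) # H` of the Nichols algebra of `V` along a realization of `V` over `H`,
as an algebra: the smash product of `𝔅(V)` and `H`. -/
abbrev Bosonization {c : Braiding k V} (ρ : Realization H c) : Type u := Smash ρ.moduleAlgebra

/-- The augmentation of `𝔅(V) # H`, i.e. its counit. -/
noncomputable def Bosonization.aug {c : Braiding k V} (ρ : Realization H c) :
    Bosonization ρ →ₐ[k] k :=
  Smash.aug (NicholsAlgebra.aug c) ρ.aug_act

end BraidedSection

/-! Write `R` for the Nichols algebra. Everything is deduced from the statement that `H(R, k)` is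
left noetherian.

Noetherianity of `H(R, k)`. Finite generation alone does not suffice for a noncommutative ring, but
`H(R, k)` is commutative up to roots of unity. Realizability over a finite group of order `N` forces
`q_ij ^ N = 1` (`Realization.pow_card_eq_one`), so the `N`-torsion scalings of the basis form a
finite group `D` that contains the rows `g_i` of the braiding matrix and acts on `R` by
automorphisms. For a `D`-equivariant module `X` there is an exact functor `X ⊗ -` in which `x_i`
acts by `x_i ⊗ 1 + g_i ⊗ x_i`; that this respects the relations of `R` is the descent of the braided
coproduct (`lift_add_toTensorAlgebra_eq_zero`). Naturality of `X ⊗ Y` in both variables gives an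
Eckmann-Hilton argument: dimension shifting in `X` costs the Koszul sign, and a `D`-eigenclass
contributes a twist by its character. Every class is a sum of such good classes
(`mem_closure_isGood`), and two of them commute up to a scalar `q` with `q ^ (2 * N) = 1`
(`IsGood.comp_eq_smul_comp`). A finitely generated algebra of this kind is finite over a polynomial
ring acting through the central powers of its generators, hence noetherian
(`isNoetherianRing_of_quasi_commute`).

Coefficients. As `R` is graded and finite-dimensional, each nonzero module contains a copy of the
trivial one (`NicholsAlgebra.exists_invariant`). Induction on dimension and the long exact sequence
make `H(R, M)` noetherian for every finite `M`.

Passage to `R # K`. Semisimplicity of `K` gives a normalized integral `t`, and `g ↦ S(t₁) g(t₂)` is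
a natural retraction of `M → Hom_R(R # K, M)`. It yields a transfer from cohomology over `R` to
cohomology over `R # K` with `tr(a · res n) = tr(a) · n` and `tr(res n) = n`. This is enough to
carry noetherian modules across (`isNoetherian_of_transfer`), and a connected graded noetherian
algebra is finitely generated (`finiteType_of_isNoetherianRing`). -/

/-! ### Naturality of the maps that exact functors induce on Ext. -/

section ExtNaturality

open CategoryTheory CategoryTheory.Abelian Limits

universe w₁ w₂ v₁ v₂ u₁ u₂

variable {C : Type u₁} [Category.{v₁} C] [Abelian C] [HasExt.{w₁} C] [EnoughProjectives C]
variable {D : Type u₂} [Category.{v₂} D] [Abelian D] [HasExt.{w₂} D]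

omit [HasExt.{w₁} C] in
/-- Each object is the right term of a short exact sequence with projective middle term. -/
theorem exists_shortExact_projective (X : C) :
    ∃ S : ShortComplex C, S.ShortExact ∧ Projective S.X₂ ∧ S.X₃ = X :=
  ⟨ShortComplex.mk _ _ (kernel.condition (Projective.π X)),
    { exact := ShortComplex.exact_of_f_is_kernel _ (kernelIsKernel _) },
    by dsimp; infer_instance, rfl⟩

omit [EnoughProjectives C] in
/-- Dimension shifting: if the middle term of a short exact sequence is projective, each class in
`Extⁿ⁺¹` from the right term is a multiple of the class of the sequence. -/
theorem exists_extClass_comp {S : ShortComplex C} (hS : S.ShortExact) [Projective S.X₂] {Y : C}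
    {n m : ℕ} (h : 1 + n = m) (α : Ext S.X₃ Y m) : ∃ β : Ext S.X₁ Y n, hS.extClass.comp β h = α := by
  obtain rfl : m = n + 1 := by omega
  exact Ext.contravariant_sequence_exact₃ hS Y α (Ext.eq_zero_of_projective _) h

section
variable (F G : C ⥤ D) [F.Additive] [PreservesFiniteLimits F] [PreservesFiniteColimits F]
  [G.Additive] [PreservesFiniteLimits G] [PreservesFiniteColimits G]

/-- Natural transformations between exact functors commute with the maps on `Ext`. -/
theorem mapExactFunctor_comp_natTrans (τ : F ⟶ G) {n : ℕ} {X Y : C} (α : Ext X Y n) :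
    (α.mapExactFunctor F).comp (Ext.mk₀ (τ.app Y)) (add_zero n) =
      (Ext.mk₀ (τ.app X)).comp (α.mapExactFunctor G) (zero_add n) := by
  induction n generalizing X with
  | zero =>
    obtain ⟨f, rfl⟩ := (Ext.mk₀_bijective X Y).2 α
    simp only [Ext.mapExactFunctor_mk₀, Ext.mk₀_comp_mk₀, τ.naturality]
  | succ n ih =>
    -- A class of positive degree is the class of a projective presentation times a class of lower
    -- degree, so it suffices to check the two factors.
    obtain ⟨S, hS, _, rfl⟩ := exists_shortExact_projective X
    obtain ⟨α, rfl⟩ : ∃ β, hS.extClass.comp β (add_comm 1 n) = α := exists_extClass_comp hS _ _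
    have key : (hS.extClass.mapExactFunctor F).comp (Ext.mk₀ (τ.app S.X₁)) (add_zero 1) =
        (Ext.mk₀ (τ.app S.X₃)).comp (hS.extClass.mapExactFunctor G) (zero_add 1) := by
      rw [Ext.mapExactFunctor_extClass, Ext.mapExactFunctor_extClass]
      exact (hS.map_of_exact F).extClass_naturality (hS.map_of_exact G) (S.mapNatTrans τ)
    rw [Ext.mapExactFunctor_comp, Ext.mapExactFunctor_comp,
      Ext.comp_assoc _ _ _ _ (add_zero n) (by omega), ih,
      ← Ext.comp_assoc _ _ _ (add_zero 1) (zero_add n) (by omega : 1 + 0 + n = n + 1), key,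
      Ext.comp_assoc _ _ _ _ _ (by omega)]
end
end ExtNaturality

universe w₁ v₁ u₁ in
theorem Ext.comp_zsmul {C : Type u₁} [CategoryTheory.Category.{v₁} C] [CategoryTheory.Abelian C]
    [CategoryTheory.HasExt.{w₁} C] {X Y Z : C} {a b c : ℕ} (α : CategoryTheory.Abelian.Ext X Y a)
    (β : CategoryTheory.Abelian.Ext Y Z b) (z : ℤ) (h : a + b = c) :
    α.comp (z • β) h = z • α.comp β h :=
  map_zsmul (α.precomp Z h) z β

/-! ### Anticommutation of connecting classes, and the sign rule for exact sequences of functors. -/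

section Grid

open CategoryTheory CategoryTheory.Abelian Limits

universe v' u'

variable {Q : Type u'} [Ring Q] [Small.{v'} Q]

omit [Small.{v'} Q] in
theorem ModuleCat.shortExact_iff (S : ShortComplex (ModuleCat.{v'} Q)) : S.ShortExact ↔
    Function.Injective S.f ∧ Function.Surjective S.g ∧ ∀ x, S.g x = 0 → ∃ y, S.f y = x := by
  constructor
  · intro h
    exact ⟨(ModuleCat.mono_iff_injective _).1 h.mono_f, (ModuleCat.epi_iff_surjective _).1 h.epi_g,
      (S.moduleCat_exact_iff).1 h.exact⟩
  · rintro ⟨h1, h2, h3⟩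
    exact { exact := (S.moduleCat_exact_iff).2 h3
            mono_f := (ModuleCat.mono_iff_injective _).2 h1
            epi_g := (ModuleCat.epi_iff_surjective _).2 h2 }

/-- In a commutative `3 × 3` diagram with short exact rows and columns, the two ways around of
composing the connecting classes agree up to sign. -/
theorem extClass_comp_extClass_grid {A B E : ShortComplex (ModuleCat.{v'} Q)} (i : A ⟶ B)
    (p : B ⟶ E) (hA : A.ShortExact) (hB : B.ShortExact) (hE : E.ShortExact)
    (w₁ : i.τ₁ ≫ p.τ₁ = 0) (w₂ : i.τ₂ ≫ p.τ₂ = 0) (w₃ : i.τ₃ ≫ p.τ₃ = 0)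
    (h₁ : (ShortComplex.mk _ _ w₁).ShortExact) (h₂ : (ShortComplex.mk _ _ w₂).ShortExact)
    (h₃ : (ShortComplex.mk _ _ w₃).ShortExact) :
    hE.extClass.comp h₁.extClass rfl = - h₃.extClass.comp hA.extClass rfl := by
  have hA' := (ModuleCat.shortExact_iff _).1 hA
  have hB' := (ModuleCat.shortExact_iff _).1 hB
  have hE' := (ModuleCat.shortExact_iff _).1 hE
  have h1' := (ModuleCat.shortExact_iff _).1 h₁
  have h2' := (ModuleCat.shortExact_iff _).1 h₂
  have h3' := (ModuleCat.shortExact_iff _).1 h₃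
  have zA : ∀ x, A.g (A.f x) = 0 := fun x => by
    rw [← ModuleCat.comp_apply, A.zero]; rfl
  have zB : ∀ x, B.g (B.f x) = 0 := fun x => by
    rw [← ModuleCat.comp_apply, B.zero]; rfl
  have zE : ∀ x, E.g (E.f x) = 0 := fun x => by
    rw [← ModuleCat.comp_apply, E.zero]; rfl
  have z1 : ∀ x, p.τ₁ (i.τ₁ x) = 0 := fun x => by
    rw [← ModuleCat.comp_apply, w₁]; rfl
  have z2 : ∀ x, p.τ₂ (i.τ₂ x) = 0 := fun x => by
    rw [← ModuleCat.comp_apply, w₂]; rfl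
  have z3 : ∀ x, p.τ₃ (i.τ₃ x) = 0 := fun x => by
    rw [← ModuleCat.comp_apply, w₃]; rfl
  have ci1 : ∀ x, B.f (i.τ₁ x) = i.τ₂ (A.f x) := fun x => by
    rw [← ModuleCat.comp_apply, i.comm₁₂]; rfl
  have ci2 : ∀ x, B.g (i.τ₂ x) = i.τ₃ (A.g x) := fun x => by
    rw [← ModuleCat.comp_apply, i.comm₂₃]; rfl
  have cp1 : ∀ x, E.f (p.τ₁ x) = p.τ₂ (B.f x) := fun x => by
    rw [← ModuleCat.comp_apply, p.comm₁₂]; rfl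
  have cp2 : ∀ x, E.g (p.τ₂ x) = p.τ₃ (B.g x) := fun x => by
    rw [← ModuleCat.comp_apply, p.comm₂₃]; rfl
  let q : B.X₂ →ₗ[Q] E.X₃ := E.g.hom ∘ₗ p.τ₂.hom
  -- The kernel of the diagonal `B.X₂ → E.X₃`. It contains the images of `A.X₂` and of `B.X₁`, and
  -- its quotient by `A.X₁` is `A.X₃ × E.X₁`.
  let W := LinearMap.ker q
  have hW : ∀ x : W, E.g (p.τ₂ x) = 0 := fun x => x.2
  have hW' : ∀ x : W, p.τ₃ (B.g x) = 0 := fun x => (cp2 x).symm.trans x.2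
  let e₃ : A.X₃ ≃ₗ[Q] LinearMap.ker p.τ₃.hom := LinearEquiv.ofBijective
    (i.τ₃.hom.codRestrict _ z3)
    ⟨fun x y h => h3'.1 (congrArg Subtype.val h), fun x => by
      obtain ⟨y, hy⟩ := h3'.2.2 x.1 x.2
      exact ⟨y, Subtype.ext hy⟩⟩
  let e₁ : E.X₁ ≃ₗ[Q] LinearMap.ker E.g.hom := LinearEquiv.ofBijective
    (E.f.hom.codRestrict _ zE)
    ⟨fun x y h => hE'.1 (congrArg Subtype.val h), fun x => by
      obtain ⟨y, hy⟩ := hE'.2.2 x.1 x.2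
      exact ⟨y, Subtype.ext hy⟩⟩
  have he₃ : ∀ x, i.τ₃ (e₃.symm x) = x.1 := fun x => congrArg Subtype.val (e₃.apply_symm_apply x)
  have he₁ : ∀ x, E.f (e₁.symm x) = x.1 := fun x => congrArg Subtype.val (e₁.apply_symm_apply x)
  let u : W →ₗ[Q] A.X₃ := e₃.symm.toLinearMap ∘ₗ
    (B.g.hom ∘ₗ W.subtype).codRestrict (LinearMap.ker p.τ₃.hom) hW'
  let v : W →ₗ[Q] E.X₁ := e₁.symm.toLinearMap ∘ₗ
    (p.τ₂.hom ∘ₗ W.subtype).codRestrict (LinearMap.ker E.g.hom) hW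
  have hu : ∀ x, i.τ₃ (u x) = B.g x.1 := fun x => he₃ _
  have hv : ∀ x, E.f (v x) = p.τ₂ x.1 := fun x => he₁ _
  let a : A.X₂ →ₗ[Q] W := i.τ₂.hom.codRestrict _ fun x => by
    change E.g (p.τ₂ (i.τ₂ x)) = 0
    rw [z2, map_zero]
  let b : B.X₁ →ₗ[Q] W := B.f.hom.codRestrict _ fun x => by
    change E.g (p.τ₂ (B.f x)) = 0
    rw [cp2, zB, map_zero]
  -- Pulling `T` back along the two summands of its right term gives the row `A` and the first
  -- column; pushing `U` below out along `u` and `v` gives the third column and the row `E`.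
  let T : ShortComplex (ModuleCat.{v'} Q) := ShortComplex.mk
    (X₁ := A.X₁) (X₂ := ModuleCat.of Q W) (X₃ := ModuleCat.of Q (A.X₃ × E.X₁))
    (ModuleCat.ofHom (a ∘ₗ A.f.hom)) (ModuleCat.ofHom (u.prod v)) (by
      ext x : 2
      refine Prod.ext (h3'.1 ?_) (hE'.1 ?_)
      · refine (hu _).trans ?_
        change B.g (i.τ₂ (A.f x)) = i.τ₃ 0
        rw [ci2, zA]
      · refine (hv _).trans ?_
        change p.τ₂ (i.τ₂ (A.f x)) = E.f 0
        rw [z2, map_zero])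
  have hT : T.ShortExact := by
    refine (ModuleCat.shortExact_iff _).2 ⟨?_, ?_, ?_⟩
    · intro x y h
      exact hA'.1 (h2'.1 (congrArg Subtype.val h))
    · rintro ⟨x, y⟩
      obtain ⟨x', rfl⟩ := hA'.2.1 x
      obtain ⟨y', rfl⟩ := h1'.2.1 y
      refine ⟨a x' + b y', Prod.ext (h3'.1 ?_) (hE'.1 ?_)⟩
      · refine (hu _).trans ?_
        change B.g (i.τ₂ x' + B.f y') = i.τ₃ (A.g x')
        rw [map_add, zB, add_zero, ci2]
      · refine (hv _).trans ?_
        change p.τ₂ (i.τ₂ x' + B.f y') = E.f (p.τ₁ y')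
        rw [map_add, z2, zero_add, cp1]
    · intro x hx
      have hx1 : u x = 0 := congrArg Prod.fst hx
      have hx2 : v x = 0 := congrArg Prod.snd hx
      have g1 := hu x
      have g2 := hv x
      rw [hx1, map_zero] at g1
      rw [hx2, map_zero] at g2
      obtain ⟨y, hy⟩ := h2'.2.2 x.1 g2.symm
      change i.τ₂ y = x.1 at hy
      have : A.g y = 0 := h3'.1 (by
        change i.τ₃ (A.g y) = i.τ₃ 0
        rw [← ci2, hy, ← g1, map_zero])
      obtain ⟨z, rfl⟩ := hA'.2.2 y this
      exact ⟨z, Subtype.ext hy⟩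
  let U : ShortComplex (ModuleCat.{v'} Q) := ShortComplex.mk
    (X₁ := ModuleCat.of Q W) (X₂ := B.X₂) (X₃ := E.X₃)
    (ModuleCat.ofHom W.subtype) (ModuleCat.ofHom q) (by ext x; exact x.2)
  have hU : U.ShortExact := by
    refine (ModuleCat.shortExact_iff _).2 ⟨Subtype.val_injective, ?_, fun x hx => ⟨⟨x, hx⟩, rfl⟩⟩
    exact hE'.2.1.comp h2'.2.1
  let φ₁ : U ⟶ ShortComplex.mk _ _ w₃ :=
    { τ₁ := ModuleCat.ofHom u, τ₂ := B.g, τ₃ := 𝟙 _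
      comm₁₂ := by ext x; exact hu x
      comm₂₃ := by ext x; exact (cp2 x).symm }
  let φ₂ : U ⟶ E :=
    { τ₁ := ModuleCat.ofHom v, τ₂ := p.τ₂, τ₃ := 𝟙 _
      comm₁₂ := by ext x; exact hv x
      comm₂₃ := by ext x; rfl }
  let ψ₁ : A ⟶ T :=
    { τ₁ := 𝟙 _, τ₂ := ModuleCat.ofHom a, τ₃ := ModuleCat.ofHom (LinearMap.inl Q A.X₃ E.X₁)
      comm₁₂ := by ext x; rfl
      comm₂₃ := by
        ext x : 2
        refine Prod.ext (h3'.1 ((hu _).trans (ci2 x)).symm).symm (hE'.1 ?_)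
        refine (hv _).trans ?_
        change p.τ₂ (i.τ₂ x) = E.f 0
        rw [z2, map_zero] }
  let ψ₂ : ShortComplex.mk _ _ w₁ ⟶ T :=
    { τ₁ := 𝟙 _, τ₂ := ModuleCat.ofHom b, τ₃ := ModuleCat.ofHom (LinearMap.inr Q A.X₃ E.X₁)
      comm₁₂ := by
        ext x : 2
        exact Subtype.ext (ci1 x).symm
      comm₂₃ := by
        ext x : 2
        refine Prod.ext (h3'.1 ?_) (hE'.1 ((hv _).trans (cp1 x).symm))
        refine (hu _).trans ((zB x).trans (map_zero i.τ₃.hom).symm) }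
  have n₁ := hU.extClass_naturality h₃ φ₁
  have n₂ := hU.extClass_naturality hE φ₂
  have m₁ := hA.extClass_naturality hT ψ₁
  have m₂ := h₁.extClass_naturality hT ψ₂
  dsimp only [φ₁, φ₂, ψ₁, ψ₂] at n₁ n₂ m₁ m₂
  rw [Ext.mk₀_id_comp] at n₁ n₂
  rw [Ext.comp_mk₀_id] at m₁ m₂
  rw [← n₁, ← n₂, m₁, m₂, eq_neg_iff_add_eq_zero,
    Ext.comp_assoc _ _ _ (add_zero 1) (zero_add 1) rfl,
    Ext.comp_assoc _ _ _ (add_zero 1) (zero_add 1) rfl, ← Ext.comp_add,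
    ← Ext.comp_assoc _ _ _ (zero_add 0) (zero_add 1) rfl,
    ← Ext.comp_assoc _ _ _ (zero_add 0) (zero_add 1) rfl, ← Ext.add_comp,
    Ext.mk₀_comp_mk₀, Ext.mk₀_comp_mk₀, ← Ext.mk₀_add]
  -- The sum of the two composites has become the class of `U`, then `T.g`, then the class of `T`;
  -- the last two compose to zero.
  have : ModuleCat.ofHom v ≫ ModuleCat.ofHom (LinearMap.inr Q A.X₃ E.X₁) +
      ModuleCat.ofHom u ≫ ModuleCat.ofHom (LinearMap.inl Q A.X₃ E.X₁) = T.g := by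
    ext x : 2
    refine Prod.ext ?_ ?_
    · change (0 : A.X₃) + u x = u x
      rw [zero_add]
    · change v x + (0 : E.X₁) = v x
      rw [add_zero]
  rw [this]
  have h0 := hT.comp_extClass
  refine (congrArg (fun z => Ext.comp hU.extClass z _) h0).trans ?_
  exact Ext.comp_zero _ _ _ _ _

variable {C : Type*} [Category* C] [Abelian C] [HasExt.{v'} C] [EnoughProjectives C]
/-- A short exact sequence `0 → F → G → K → 0` of exact functors gives classes
`σ X ∈ Ext¹ (K X, F X)` that commute up to sign with the maps of the functors on `Ext`. -/
theorem mapExactFunctor_comp_extClass (F G K : C ⥤ ModuleCat.{v'} Q)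
    [F.Additive] [PreservesFiniteLimits F] [PreservesFiniteColimits F]
    [G.Additive] [PreservesFiniteLimits G] [PreservesFiniteColimits G]
    [K.Additive] [PreservesFiniteLimits K] [PreservesFiniteColimits K]
    (i : F ⟶ G) (p : G ⟶ K) (w : ∀ X, i.app X ≫ p.app X = 0)
    (h : ∀ X, (ShortComplex.mk _ _ (w X)).ShortExact)
    {n m : ℕ} (hm : n + 1 = m) (hm' : 1 + n = m) {X Y : C} (β : Ext X Y n) :
    (β.mapExactFunctor K).comp (h Y).extClass hm =
      (-1 : ℤ) ^ n • (h X).extClass.comp (β.mapExactFunctor F) hm' := by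
  induction n generalizing X m with
  | zero =>
    subst hm
    obtain ⟨f, rfl⟩ := (Ext.mk₀_bijective X Y).2 β
    simp only [Ext.mapExactFunctor_mk₀, pow_zero, one_smul]
    exact ((h X).extClass_naturality (h Y)
      { τ₁ := F.map f, τ₂ := G.map f, τ₃ := K.map f
        comm₁₂ := (i.naturality f)
        comm₂₃ := (p.naturality f) }).symm
  | succ n ih =>
    subst hm
    obtain ⟨S, hS, _, rfl⟩ := exists_shortExact_projective X
    obtain ⟨β, rfl⟩ : ∃ γ, hS.extClass.comp γ (add_comm 1 n) = β := exists_extClass_comp hS _ _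
    -- The three functors applied to `S` form a `3 × 3` diagram, whose anticommutation contributes
    -- one sign per degree.
    have key : (hS.extClass.mapExactFunctor K).comp (h S.X₁).extClass rfl =
        - (h S.X₃).extClass.comp (hS.extClass.mapExactFunctor F) rfl := by
      rw [Ext.mapExactFunctor_extClass, Ext.mapExactFunctor_extClass]
      exact extClass_comp_extClass_grid (S.mapNatTrans i) (S.mapNatTrans p) (hS.map_of_exact F)
        (hS.map_of_exact G) (hS.map_of_exact K) (w _) (w _) (w _) (h _) (h _) (h _)
    rw [Ext.mapExactFunctor_comp, Ext.mapExactFunctor_comp, Ext.comp_assoc _ _ _ _ rfl (by omega),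
      ih rfl (by omega), Ext.comp_zsmul, ← Ext.comp_assoc _ _ _ (a₁₂ := 2) rfl (by omega)
        (by omega : 1 + 1 + n = n + 1 + 1), key, Ext.neg_comp, smul_neg, pow_succ, mul_neg_one,
      neg_smul, Ext.comp_assoc _ _ _ rfl (add_comm 1 n) (by omega)]

end Grid

/-! ### Noetherian modules along a transfer map. -/

section NoetherianTransfer

/-- If `N` is, compatibly with the scalars on the elements of `N`, a direct summand of a noetherian
module, then `N` is noetherian. -/
theorem isNoetherian_of_transfer {A B N N' : Type*} [Ring A] [Ring B] [AddCommGroup N]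
    [Module B N] [AddCommGroup N'] [Module A N'] [IsNoetherian A N'] (res : N → N')
    (π : N' →+ N) (πA : A → B) (h₁ : ∀ a n, π (a • res n) = πA a • n)
    (h₂ : ∀ n, π (res n) = n) : IsNoetherian B N := by
  refine ⟨fun P => ?_⟩
  -- Taking the finitely many generators inside `res '' P` itself ensures that `π` sends them back
  -- into `P`.
  obtain ⟨s, hs, hs'⟩ := (Submodule.fg_span_iff_fg_span_finset_subset (R := A) (res '' P)).1
    (IsNoetherian.noetherian _)
  classical
  refine ⟨s.image π, le_antisymm (Submodule.span_le.2 ?_) fun n hn => ?_⟩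
  · intro x hx
    rw [Finset.coe_image] at hx
    obtain ⟨y, hy, rfl⟩ := hx
    obtain ⟨n, hn, rfl⟩ := hs hy
    rwa [h₂]
  · have hmem : res n ∈ Submodule.span A (s : Set N') :=
      hs' ▸ Submodule.subset_span ⟨n, hn, rfl⟩
    rw [← h₂ n]
    obtain ⟨f, -, hf⟩ := Submodule.mem_span_finset.1 hmem
    rw [← hf, map_sum]
    refine Submodule.sum_mem _ fun y hy => ?_
    obtain ⟨m, -, rfl⟩ := hs hy
    rw [h₁]
    exact Submodule.smul_mem _ _ (Submodule.subset_span
      (Finset.mem_coe.2 (Finset.mem_image.2 ⟨_, hy, h₂ m⟩)))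

end NoetherianTransfer

/-! ### Connected graded noetherian algebras are finitely generated. -/

section ConnectedGraded

open DirectSum

variable {k : Type*} [Field k] (𝒜 : ℕ → Type*) [∀ n, AddCommGroup (𝒜 n)] [∀ n, Module k (𝒜 n)]
  [GRing 𝒜] [GAlgebra k 𝒜]

/-- A connected graded left noetherian algebra is finitely generated. -/
theorem finiteType_of_isNoetherianRing [IsNoetherianRing (⨁ n, 𝒜 n)]
    (h0 : ∀ x : 𝒜 0, ∃ r : k, of 𝒜 0 x = algebraMap k _ r) :
    Algebra.FiniteType k (⨁ n, 𝒜 n) := by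
  let S : Set (⨁ n, 𝒜 n) := {y | ∃ n, 0 < n ∧ ∃ x : 𝒜 n, of 𝒜 n x = y}
  obtain ⟨s, hs, hs'⟩ := (Submodule.fg_span_iff_fg_span_finset_subset (R := ⨁ n, 𝒜 n) S).1
    (IsNoetherian.noetherian _)
  have key : ∀ n, ∀ x : 𝒜 n, of 𝒜 n x ∈ Algebra.adjoin k (s : Set (⨁ n, 𝒜 n)) := by
    intro n
    induction n using Nat.strong_induction_on with
    | _ n ih =>
      intro x
      rcases Nat.eq_zero_or_pos n with rfl | hn
      · obtain ⟨r, hr⟩ := h0 x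
        rw [hr]
        exact Subalgebra.algebraMap_mem _ r
      have hx : of 𝒜 n x ∈ Submodule.span (⨁ n, 𝒜 n) (s : Set (⨁ n, 𝒜 n)) :=
        hs' ▸ Submodule.subset_span ⟨n, hn, x, rfl⟩
      -- Quantifying over all `b` lets the module coefficients be absorbed. On a generator of degree
      -- `d > 0`, the part of `b` that reaches degree `n` has degree `n - d < n`, so the induction
      -- hypothesis applies to it.
      have claim : ∀ y ∈ Submodule.span (⨁ n, 𝒜 n) (s : Set (⨁ n, 𝒜 n)), ∀ b : ⨁ n, 𝒜 n,
          of 𝒜 n ((b * y) n) ∈ Algebra.adjoin k (s : Set (⨁ n, 𝒜 n)) := by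
        intro y hy
        induction hy using Submodule.span_induction with
        | zero => intro b; simp
        | add y z _ _ hy hz =>
          intro b
          rw [mul_add, DirectSum.add_apply, map_add]
          exact add_mem (hy b) (hz b)
        | smul a y _ hy =>
          intro b
          rw [smul_eq_mul, ← mul_assoc]
          exact hy _
        | mem y hy =>
          intro b
          obtain ⟨d, hd, z, rfl⟩ := hs hy
          induction b using DirectSum.induction_on with
          | zero => simp
          | add b b' hb hb' =>
            rw [add_mul, DirectSum.add_apply, map_add]
            exact add_mem hb hb'
          | of m w =>
            rw [of_mul_of]
            by_cases hmd : m + d = n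
            · subst hmd
              have : (of 𝒜 (m + d) (GradedMonoid.GMul.mul w z)) (m + d) =
                GradedMonoid.GMul.mul w z := of_eq_same _ _
              rw [this, ← of_mul_of]
              exact mul_mem (ih m (by omega) w) (Algebra.subset_adjoin hy)
            · have : (of 𝒜 (m + d) (GradedMonoid.GMul.mul w z)) n = 0 :=
                of_eq_of_ne _ _ _ (Ne.symm hmd)
              rw [this, map_zero]
              exact zero_mem _
      have := claim _ hx 1
      rwa [one_mul, of_eq_same] at this
  refine ⟨⟨s, eq_top_iff.2 fun x _ => ?_⟩⟩
  induction x using DirectSum.induction_on with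
  | zero => exact zero_mem _
  | add x y hx hy => exact add_mem (hx trivial) (hy trivial)
  | of n x => exact key n x

end ConnectedGraded

/-! ### Algebras whose generators commute up to roots of unity. -/

section QuantumAffine

variable {k A : Type*} [Field k] [Ring A] [Algebra k A]

theorem mul_pow_of_quasi_commute {x y : A} {q : k} (h : x * y = q • (y * x)) (n : ℕ) :
    x * y ^ n = q ^ n • (y ^ n * x) := by
  induction n with
  | zero => simp
  | succ n ih =>
    rw [pow_succ, ← mul_assoc, ih, smul_mul_assoc, mul_assoc, h, mul_smul_comm, smul_smul,
      ← pow_succ, mul_assoc]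

/-- An algebra with finitely many generators that commute up to roots of unity is noetherian. -/
theorem isNoetherianRing_of_quasi_commute {ι : Type*} [Finite ι] (z : ι → A)
    (hz : Algebra.adjoin k (Set.range z) = ⊤) {M : ℕ} (hM : 0 < M)
    (hq : ∀ i j, ∃ q : k, q ^ M = 1 ∧ z i * z j = q • (z j * z i)) : IsNoetherianRing A := by
  classical
  have := Fintype.ofFinite ι
  -- Moving `z j ^ M` past a generator costs `q ^ M = 1`. Hence a polynomial ring acts centrally on
  -- `A` with its variables going to these powers, and the goal is finiteness over it.
  have hcent : ∀ j, z j ^ M ∈ Subalgebra.center k A := by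
    intro j
    rw [Subalgebra.mem_center_iff]
    intro b
    have hb : b ∈ Algebra.adjoin k (Set.range z) := hz ▸ trivial
    induction hb using Algebra.adjoin_induction with
    | mem x hx =>
      obtain ⟨i, rfl⟩ := hx
      obtain ⟨q, hq1, hq2⟩ := hq i j
      rw [mul_pow_of_quasi_commute hq2, hq1, one_smul]
    | algebraMap r => exact Algebra.commutes r _
    | add x y _ _ hx hy => rw [add_mul, mul_add, hx, hy]
    | mul x y _ _ hx hy => rw [mul_assoc, hy, ← mul_assoc, hx, mul_assoc]
  let φ : MvPolynomial ι k →ₐ[k] Subalgebra.center k A :=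
    MvPolynomial.aeval fun j => ⟨z j ^ M, hcent j⟩
  let inst : Algebra (MvPolynomial ι k) A :=
    (((Subalgebra.center k A).val.comp φ).toRingHom).toAlgebra' fun c x =>
      ((Subalgebra.mem_center_iff (R := k)).1 (φ c).2 x).symm
  have hX : ∀ j, algebraMap (MvPolynomial ι k) A (MvPolynomial.X j) = z j ^ M := by
    intro j
    change ((φ (MvPolynomial.X j) : Subalgebra.center k A) : A) = _
    simp [φ]
  have hC : ∀ (r : k) (a : A), (MvPolynomial.C r : MvPolynomial ι k) • a = r • a := by
    intro r a
    rw [Algebra.smul_def, Algebra.smul_def]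
    change ((φ (algebraMap k _ r) : Subalgebra.center k A) : A) * a = _
    rw [AlgHom.commutes]
    rfl
  let Z := MvPolynomial ι k
  let P : ι → Submodule Z A := fun j => Submodule.span Z ((Finset.range M).image fun a => z j ^ a)
  have hP : ∀ j a, a < M → z j ^ a ∈ P j := fun j a ha =>
    Submodule.subset_span (Finset.mem_coe.2 (Finset.mem_image_of_mem _ (Finset.mem_range.2 ha)))
  have hself : ∀ j, Submodule.span Z {z j} * P j ≤ P j := by
    intro j
    rw [Submodule.span_mul_span, Submodule.span_le]
    rintro _ ⟨_, rfl, y, hy, rfl⟩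
    obtain ⟨a, ha, rfl⟩ := Finset.mem_image.1 (Finset.mem_coe.1 hy)
    rw [Finset.mem_range] at ha
    change z j * z j ^ a ∈ P j
    rw [← pow_succ']
    rcases Nat.lt_or_ge (a + 1) M with h | h
    · exact hP j _ h
    · have h1 := Submodule.smul_mem (P j) (MvPolynomial.X j : Z) (hP j 0 hM)
      rw [pow_zero, Algebra.smul_def, mul_one, hX] at h1
      rwa [show a + 1 = M by omega]
  have hcomm : ∀ i j, Submodule.span Z {z i} * P j ≤ P j * Submodule.span Z {z i} := by
    intro i j
    rw [Submodule.span_mul_span, Submodule.span_le]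
    rintro _ ⟨_, rfl, y, hy, rfl⟩
    obtain ⟨a, ha, rfl⟩ := Finset.mem_image.1 (Finset.mem_coe.1 hy)
    obtain ⟨q, -, hq2⟩ := hq i j
    change z i * z j ^ a ∈ _
    rw [mul_pow_of_quasi_commute hq2, ← hC]
    exact Submodule.smul_mem _ _ (Submodule.mul_mem_mul (Submodule.subset_span hy)
      (Submodule.mem_span_singleton_self _))
  -- The generator `z i` moves past the blocks of other indices at the cost of scalars until it
  -- meets its own block, where an excess power `z i ^ M` is a scalar from `Z`.
  have hlist : ∀ (l : List ι) (i : ι), i ∈ l →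
      Submodule.span Z {z i} * (l.map P).prod ≤ (l.map P).prod := by
    intro l
    induction l with
    | nil => intro i hi; simp at hi
    | cons j l ih =>
      intro i hi
      rw [List.map_cons, List.prod_cons]
      by_cases hij : i = j
      · subst hij
        rw [← mul_assoc]
        exact mul_le_mul' (hself i) le_rfl
      · have hi' : i ∈ l := (List.mem_cons.1 hi).resolve_left hij
        calc _ = Submodule.span Z {z i} * P j * (l.map P).prod := (mul_assoc _ _ _).symm
          _ ≤ P j * Submodule.span Z {z i} * (l.map P).prod := mul_le_mul' (hcomm i j) le_rfl
          _ = P j * (Submodule.span Z {z i} * (l.map P).prod) := mul_assoc _ _ _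
          _ ≤ _ := mul_le_mul' le_rfl (ih i hi')
  have hfg : ∀ l : List ι, (l.map P).prod.FG := by
    intro l
    induction l with
    | nil => exact ⟨{1}, by simp [Submodule.one_eq_span]⟩
    | cons j l ih => exact Submodule.FG.mul ⟨_, rfl⟩ ih
  have hone : ∀ l : List ι, (1 : A) ∈ (l.map P).prod := by
    intro l
    induction l with
    | nil => exact Submodule.one_le.1 le_rfl
    | cons j l ih =>
      have := Submodule.mul_mem_mul (hP j 0 hM) ih
      rwa [pow_zero, one_mul] at this
  let L := (Finset.univ : Finset ι).toList
  have hL : ∀ i, i ∈ L := fun i => Finset.mem_toList.2 (Finset.mem_univ i)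
  -- The product of the blocks contains `1` and is stable under left multiplication by the
  -- generators.
  have htop : (L.map P).prod = ⊤ := by
    rw [eq_top_iff]
    rintro b -
    have hb : b ∈ Algebra.adjoin k (Set.range z) := hz ▸ trivial
    suffices ∀ y ∈ (L.map P).prod, b * y ∈ (L.map P).prod by
      simpa using this 1 (hone L)
    induction hb using Algebra.adjoin_induction with
    | mem x hx =>
      obtain ⟨i, rfl⟩ := hx
      exact fun y hy => hlist L i (hL i)
        (Submodule.mul_mem_mul (Submodule.mem_span_singleton_self _) hy)
    | algebraMap r =>
      intro y hy
      rw [← Algebra.smul_def, ← hC]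
      exact Submodule.smul_mem _ _ hy
    | add x y _ _ hx hy => exact fun w hw => by rw [add_mul]; exact add_mem (hx w hw) (hy w hw)
    | mul x y _ _ hx hy => exact fun w hw => by rw [mul_assoc]; exact hx _ (hy w hw)
  have hfin : Module.Finite Z A := ⟨htop ▸ hfg L⟩
  have : IsNoetherian Z A := isNoetherian_of_isNoetherianRing_of_finite Z A
  exact isNoetherian_of_tower Z this

end QuantumAffine

/-! ### The Ext transfer attached to a natural retraction. -/

section Retract

open CategoryTheory CategoryTheory.Abelian Limits DirectSum

universe w₁ w₂ w₃ v₁ v₂ v₃ u₁ u₂ u₃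

variable {C : Type u₁} [Category.{v₁} C] [Abelian C] [HasExt.{w₁} C] [EnoughProjectives C]
variable {D : Type u₂} [Category.{v₂} D] [Abelian D] [HasExt.{w₂} D]
variable {E : Type u₃} [Category.{v₃} E] [Abelian E] [HasExt.{w₃} E]

theorem mapExactFunctor_id {n : ℕ} {X Y : C} (α : Ext X Y n) : α.mapExactFunctor (𝟭 C) = α := by
  induction n generalizing X with
  | zero =>
    obtain ⟨f, rfl⟩ := (Ext.mk₀_bijective X Y).2 α
    simp only [Ext.mapExactFunctor_mk₀, Functor.id_map]
  | succ n ih =>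
    obtain ⟨S, hS, _, rfl⟩ := exists_shortExact_projective X
    obtain ⟨α, rfl⟩ : ∃ β, hS.extClass.comp β (add_comm 1 n) = α := exists_extClass_comp hS _ _
    rw [Ext.mapExactFunctor_comp, Ext.mapExactFunctor_extClass, ih]
    rfl

section
variable (F : C ⥤ D) (G : D ⥤ E) [F.Additive] [PreservesFiniteLimits F]
  [PreservesFiniteColimits F] [G.Additive] [PreservesFiniteLimits G] [PreservesFiniteColimits G]

theorem mapExactFunctor_mapExactFunctor {n : ℕ} {X Y : C} (α : Ext X Y n) :
    (α.mapExactFunctor F).mapExactFunctor G = α.mapExactFunctor (F ⋙ G) := by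
  induction n generalizing X with
  | zero =>
    obtain ⟨f, rfl⟩ := (Ext.mk₀_bijective X Y).2 α
    simp only [Ext.mapExactFunctor_mk₀, Functor.comp_map]
  | succ n ih =>
    obtain ⟨S, hS, _, rfl⟩ := exists_shortExact_projective X
    obtain ⟨α, rfl⟩ : ∃ β, hS.extClass.comp β (add_comm 1 n) = α := exists_extClass_comp hS _ _
    have key : (hS.extClass.mapExactFunctor F).mapExactFunctor G =
        hS.extClass.mapExactFunctor (F ⋙ G) := by
      rw [Ext.mapExactFunctor_extClass, Ext.mapExactFunctor_extClass]
      exact Ext.mapExactFunctor_extClass G (hS.map_of_exact F)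
    rw [Ext.mapExactFunctor_comp, Ext.mapExactFunctor_comp, Ext.mapExactFunctor_comp, ih, key]
end

variable (F : C ⥤ D) (G : D ⥤ C) [F.Additive] [PreservesFiniteLimits F]
  [PreservesFiniteColimits F] [G.Additive] [PreservesFiniteLimits G] [PreservesFiniteColimits G]
  (η : 𝟭 C ⟶ F ⋙ G) (ρ : F ⋙ G ⟶ 𝟭 C)

/-- The map `Ext (F X) (F Y) → Ext X Y`, `α ↦ η ≫ G α ≫ ρ`, for exact functors `F`, `G` and natural
transformations `η : 𝟭 ⟶ F ⋙ G`, `ρ : F ⋙ G ⟶ 𝟭`. -/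
noncomputable def extTransfer (X Y : C) (n : ℕ) : Ext (F.obj X) (F.obj Y) n →+ Ext X Y n :=
  ((Ext.mk₀ (ρ.app Y)).postcomp X (add_zero n)).comp
    (((Ext.mk₀ (η.app X)).precomp (G.obj (F.obj Y)) (zero_add n)).comp
      (G.mapExtAddHom (F.obj X) (F.obj Y) n))

omit [EnoughProjectives C] [F.Additive] [PreservesFiniteLimits F] [PreservesFiniteColimits F] in
theorem extTransfer_apply (X Y : C) (n : ℕ) (α : Ext (F.obj X) (F.obj Y) n) :
    extTransfer F G η ρ X Y n α = ((Ext.mk₀ (η.app X)).comp (α.mapExactFunctor G)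
      (zero_add n)).comp (Ext.mk₀ (ρ.app Y)) (add_zero n) := rfl

/-- Projection formula: since `ρ` is natural, it slides past `G (F β)` and turns it into `β`. -/
theorem extTransfer_comp {X Y Z : C} {a b c : ℕ} (h : a + b = c) (α : Ext (F.obj X) (F.obj Y) a)
    (β : Ext Y Z b) : extTransfer F G η ρ X Z c (α.comp (β.mapExactFunctor F) h) =
      (extTransfer F G η ρ X Y a α).comp β h := by
  have nat : ((β.mapExactFunctor F).mapExactFunctor G).comp (Ext.mk₀ (ρ.app Z)) (add_zero b) =
      (Ext.mk₀ (ρ.app Y)).comp β (zero_add b) := by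
    have := mapExactFunctor_comp_natTrans (F ⋙ G) (𝟭 C) ρ β
    rw [mapExactFunctor_id, ← mapExactFunctor_mapExactFunctor] at this
    exact this
  rw [extTransfer_apply, extTransfer_apply, Ext.mapExactFunctor_comp,
    Ext.comp_assoc _ _ _ _ (add_zero c) (by omega),
    Ext.comp_assoc _ _ _ h (add_zero b) (by omega), nat,
    Ext.comp_assoc _ _ _ (zero_add a) (add_zero a) (by omega),
    Ext.comp_assoc _ _ _ (zero_add a) h (by omega),
    Ext.comp_assoc _ _ _ (add_zero a) (zero_add b) (by omega)]

/-- By the projection formula applied to `id · F α`, only the transfer of the identity matters, and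
that is `η ≫ ρ`. -/
theorem extTransfer_mapExactFunctor (hηρ : η ≫ ρ = 𝟙 _) {X Y : C} {n : ℕ} (α : Ext X Y n) :
    extTransfer F G η ρ X Y n (α.mapExactFunctor F) = α := by
  have h1 : (Ext.mk₀ (𝟙 (F.obj X))).comp (α.mapExactFunctor F) (zero_add n) =
    α.mapExactFunctor F := Ext.mk₀_id_comp _
  rw [← h1, extTransfer_comp, extTransfer_apply, Ext.mapExactFunctor_mk₀, Ext.mk₀_comp_mk₀,
    Ext.mk₀_comp_mk₀]
  have h2 : (η.app X ≫ G.map (𝟙 (F.obj X))) ≫ ρ.app X = 𝟙 X := by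
    rw [CategoryTheory.Functor.map_id]
    exact (congrArg (· ≫ ρ.app X) (Category.comp_id _)).trans (NatTrans.congr_app hηρ X)
  rw [h2, Ext.mk₀_id_comp]

/-- If an exact functor `F` has, up to an exact functor `G`, a natural retraction, then noetherian
`Ext`-modules over `F X` give noetherian `Ext`-modules over `X`. -/
theorem isNoetherian_ext_of_retract (hηρ : η ≫ ρ = 𝟙 _) (X Y : C)
    [IsNoetherian (⨁ n, Ext (F.obj X) (F.obj X) n) (⨁ n, Ext (F.obj X) (F.obj Y) n)] :
    IsNoetherian (⨁ n, Ext X X n) (⨁ n, Ext X Y n) := by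
  refine isNoetherian_of_transfer (A := ⨁ n, Ext (F.obj X) (F.obj X) n)
    (DirectSum.map fun n => F.mapExtAddHom X Y n)
    (DirectSum.map fun n => extTransfer F G η ρ X Y n)
    (DirectSum.map fun n => extTransfer F G η ρ X X n) ?_ ?_
  · intro a y
    induction a using DirectSum.induction_on with
    | zero => simp only [zero_smul, map_zero]
    | add a b ha hb => simp only [add_smul, map_add, ha, hb]
    | of i a =>
      induction y using DirectSum.induction_on with
      | zero => simp only [smul_zero, map_zero]
      | add a b ha hb => simp only [smul_add, map_add, ha, hb]
      | of j y =>
        rw [DirectSum.map_of, DirectSum.map_of, DirectSum.Gmodule.of_smul_of,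
          DirectSum.Gmodule.of_smul_of, DirectSum.map_of]
        exact congrArg _ (extTransfer_comp F G η ρ rfl a y)
  · intro y
    induction y using DirectSum.induction_on with
    | zero => simp only [map_zero]
    | add a b ha hb => simp only [map_add, ha, hb]
    | of j y =>
      rw [DirectSum.map_of, DirectSum.map_of]
      exact congrArg _ (extTransfer_mapExactFunctor F G η ρ hηρ y)

end Retract

/-! ### Restriction and coextension of scalars as exact functors. -/

section ChangeOfRings

open CategoryTheory CategoryTheory.Abelian Limits DirectSum

theorem exact_of_map_shortExact {C D : Type*} [Category* C] [Category* D] [Abelian C] [Abelian D]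
    (F : C ⥤ D) [F.Additive] (h : ∀ S : ShortComplex C, S.ShortExact → (S.map F).ShortExact) :
    PreservesFiniteLimits F ∧ PreservesFiniteColimits F :=
  (F.exact_tfae.out 0 3).1 h

variable {R S : Type u} [Ring R] [Ring S] (f : R →+* S)

theorem restrictScalars_exact : PreservesFiniteLimits (ModuleCat.restrictScalars.{u} f) ∧
    PreservesFiniteColimits (ModuleCat.restrictScalars.{u} f) := by
  refine exact_of_map_shortExact _ fun T hT => ?_
  rw [ModuleCat.shortExact_iff] at hT ⊢
  exact hT

instance : (ModuleCat.coextendScalars.{u, u, u} f).Additive where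
  map_add := rfl

/-- Coextension is `Hom_R(S, -)`: projectivity of `S` over `R` gives preservation of surjections,
and left exactness is checked directly by factoring through the kernel. -/
theorem coextendScalars_exact (h : Module.Projective R ((ModuleCat.restrictScalars f).obj
      (ModuleCat.of S S))) : PreservesFiniteLimits (ModuleCat.coextendScalars.{u, u, u} f) ∧
    PreservesFiniteColimits (ModuleCat.coextendScalars.{u, u, u} f) := by
  refine exact_of_map_shortExact _ fun T hT => ?_
  rw [ModuleCat.shortExact_iff] at hT ⊢
  obtain ⟨h1, h2, h3⟩ := hT
  refine ⟨fun g g' hg => ?_, fun g => ?_, fun g hg => ?_⟩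
  · refine ModuleCat.CoextendScalars.ext (LinearMap.ext fun s => h1 ?_)
    exact LinearMap.congr_fun hg s
  · obtain ⟨l, hl⟩ := Module.projective_lifting_property T.g.hom
      (ModuleCat.CoextendScalars.equiv f _ g) h2
    exact ⟨(ModuleCat.CoextendScalars.equiv f _).symm l, hl⟩
  · let e : T.X₁ ≃ₗ[R] LinearMap.ker T.g.hom := LinearEquiv.ofBijective
      (T.f.hom.codRestrict _ fun x => by
        change T.g (T.f x) = 0
        rw [← ModuleCat.comp_apply, T.zero]; rfl)
      ⟨fun x y h => h1 (congrArg Subtype.val h), fun x => by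
        obtain ⟨y, hy⟩ := h3 x.1 x.2
        exact ⟨y, Subtype.ext hy⟩⟩
    let l := e.symm.toLinearMap ∘ₗ (ModuleCat.CoextendScalars.equiv f _ g).codRestrict
      (LinearMap.ker T.g.hom) fun x => LinearMap.congr_fun hg x
    refine ⟨(ModuleCat.CoextendScalars.equiv f _).symm l, ?_⟩
    refine ModuleCat.CoextendScalars.ext (LinearMap.ext fun s => ?_)
    exact congrArg Subtype.val (e.apply_symm_apply _)

/-- A natural retraction of the unit of the adjunction between restriction and coextension of
scalars transfers noetherian `Ext`-modules. -/
theorem isNoetherian_ext_of_restrictScalars (h : Module.Projective R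
      ((ModuleCat.restrictScalars f).obj (ModuleCat.of S S)))
    (ρ : ModuleCat.restrictScalars.{u} f ⋙ ModuleCat.coextendScalars.{u, u, u} f ⟶ 𝟭 _)
    (hρ : ∀ (M : ModuleCat.{u} S) (m : M),
      ρ.app M ((ModuleCat.restrictCoextendScalarsAdj f).unit.app M m) = m)
    (X Y : ModuleCat.{u} S)
    (hXY : IsNoetherian (⨁ n, Ext ((ModuleCat.restrictScalars.{u} f).obj X)
      ((ModuleCat.restrictScalars.{u} f).obj X) n)
      (⨁ n, Ext ((ModuleCat.restrictScalars.{u} f).obj X)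
        ((ModuleCat.restrictScalars.{u} f).obj Y) n)) :
    IsNoetherian (⨁ n, Ext X X n) (⨁ n, Ext X Y n) := by
  obtain ⟨_, _⟩ := restrictScalars_exact f
  obtain ⟨_, _⟩ := coextendScalars_exact f h
  refine isNoetherian_ext_of_retract (ModuleCat.restrictScalars.{u} f)
    (ModuleCat.coextendScalars.{u, u, u} f) (ModuleCat.restrictCoextendScalarsAdj f).unit ρ ?_ X Y
  ext M m
  exact hρ M m

end ChangeOfRings

/-! ### Integrals in Hopf algebras and their Casimir identities. -/

section Integral

open TensorProduct Coalgebra HopfAlgebra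

variable {k H : Type*} [Field k] [Ring H]

/-- A semisimple augmented algebra has a normalized right integral. -/
theorem exists_integral [Bialgebra k H] [IsSemisimpleRing H] :
    ∃ t : H, (∀ h, t * h = counit (R := k) h • t) ∧ counit (R := k) t = 1 := by
  -- Submodules over the opposite ring are right ideals; `I` is the augmentation ideal as a right
  -- ideal. The integral is the component of `1` in a complement of `I`.
  let I : Submodule Hᵐᵒᵖ Hᵐᵒᵖ :=
    { carrier := {h | counit (R := k) h.unop = 0}
      add_mem' := fun {a b} ha hb => by
        change counit (R := k) (a.unop + b.unop) = 0
        rw [map_add, ha, hb, add_zero]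
      zero_mem' := map_zero _
      smul_mem' := fun c x hx => by
        change counit (R := k) (x.unop * c.unop) = 0
        rw [Bialgebra.counit_mul, hx, zero_mul] }
  obtain ⟨J, hIJ⟩ := exists_isCompl I
  obtain ⟨i, c, hi, hc, h1⟩ := Submodule.codisjoint_iff_exists_add_eq.1 hIJ.codisjoint 1
  have hcc : counit (R := k) c.unop = 1 := by
    have := congrArg (fun x => counit (R := k) x.unop) h1
    simp only [MulOpposite.unop_add, map_add, MulOpposite.unop_one, Bialgebra.counit_one] at this
    rwa [show counit (R := k) i.unop = 0 from hi, zero_add] at this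
  refine ⟨c.unop, fun h => ?_, hcc⟩
  -- The element `c (h - ε(h))` lies in `J` because `J` is a right ideal, and in `I` because `ε`
  -- kills the second factor.
  have hJ : (MulOpposite.op h - MulOpposite.op (algebraMap k H (counit (R := k) h))) • c ∈ J :=
    J.smul_mem _ hc
  have hI : (MulOpposite.op h - MulOpposite.op (algebraMap k H (counit (R := k) h))) • c ∈ I := by
    change counit (R := k) (c.unop * (h - algebraMap k H (counit (R := k) h))) = 0
    rw [Bialgebra.counit_mul, map_sub, Bialgebra.counit_algebraMap, sub_self, mul_zero]
  have h0 := Submodule.disjoint_def.1 hIJ.disjoint _ hI hJ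
  have h0' : c.unop * (h - algebraMap k H (counit (R := k) h)) = 0 :=
    congrArg MulOpposite.unop h0
  rw [mul_sub, sub_eq_zero] at h0'
  rw [h0', Algebra.smul_def, Algebra.commutes]

theorem sum_counit_smul_left {H : Type*} [AddCommGroup H] [Module k H] [Coalgebra k H] (h : H) :
    ∑ i ∈ (ℛ k h).index, counit (R := k) ((ℛ k h).right i) • (ℛ k h).left i = h := by
  have := congrArg (TensorProduct.rid k H) (sum_tmul_counit_eq (ℛ k h))
  simpa only [map_sum, TensorProduct.rid_tmul, one_smul] using this

variable [HopfAlgebra k H]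

/-- In Sweedler notation `h₁ ⊗ h₂ S(h₃) = h ⊗ 1`: coassociativity, then the antipode axiom on the
last two legs. It expresses `h ⊗ 1` through coproducts, which an integral can absorb. -/
theorem sum_comul_mul_antipode (h : H) :
    ∑ i ∈ (ℛ k h).index, comul (R := k) ((ℛ k h).left i) *
      ((1 : H) ⊗ₜ[k] antipode k ((ℛ k h).right i)) = h ⊗ₜ[k] (1 : H) := by
  let F : H ⊗[k] (H ⊗[k] H) →ₗ[k] H ⊗[k] H :=
    (LinearMap.mul' k H ∘ₗ (antipode k).lTensor H).lTensor H
  have e : ∀ (x : H ⊗[k] H) (b : H), F (TensorProduct.assoc k H H H (x ⊗ₜ b)) =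
      x * ((1 : H) ⊗ₜ[k] antipode k b) := by
    intro x b
    induction x with
    | zero => simp
    | add x y hx hy => rw [TensorProduct.add_tmul, map_add, map_add, hx, hy, add_mul]
    | tmul a c => simp [F]
  have key := congrArg F (coassoc_apply (R := k) h)
  rw [← (ℛ k h).eq, map_sum, map_sum, map_sum, map_sum, map_sum] at key
  simp only [LinearMap.rTensor_tmul, LinearMap.lTensor_tmul, e] at key
  rw [key]
  have : ∀ a b : H, F (a ⊗ₜ comul b) = a ⊗ₜ (counit (R := k) b • (1 : H)) := by
    intro a b
    simp only [F, LinearMap.lTensor_tmul, LinearMap.comp_apply, mul_antipode_lTensor_comul_apply]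
    rw [Algebra.algebraMap_eq_smul_one]
  simp only [this, ← TensorProduct.smul_tmul, ← TensorProduct.sum_tmul]
  rw [sum_counit_smul_left]

variable {t : H} (ht : ∀ h, t * h = counit (R := k) h • t)
include ht

/-- Substitute `h ⊗ 1 = Δ(h₁)(1 ⊗ S(h₂))` and use `Δ(t) Δ(h₁) = Δ(t h₁) = ε(h₁) Δ(t)`. -/
theorem comul_integral_mul_left (h : H) : comul (R := k) t * (h ⊗ₜ[k] 1) =
    comul t * ((1 : H) ⊗ₜ[k] antipode k h) := by
  rw [← sum_comul_mul_antipode, Finset.mul_sum]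
  simp only [← mul_assoc, ← Bialgebra.comul_mul, ht, map_smul, smul_mul_assoc]
  simp only [← mul_smul_comm, ← Finset.mul_sum, ← TensorProduct.tmul_smul, ← TensorProduct.tmul_sum,
    ← map_smul, ← map_sum]
  rw [sum_counit_smul]

/-- The tensor `S(t₁) ⊗ t₂` is a Casimir element; this is what makes averaging against it linear
over `H`. -/
theorem comul_integral_mul_right (h : H) :
    (antipode k).rTensor H (comul (R := k) t) * ((1 : H) ⊗ₜ[k] h) =
      (h ⊗ₜ[k] (1 : H)) * (antipode k).rTensor H (comul t) := by
  let P : H ⊗[k] H →ₗ[k] H ⊗[k] H := (antipode k).rTensor H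
  -- For `x = a ⊗ b` the left side is `h₁ S(h₂) S(a) ⊗ b h₃`, and the first two legs cancel. For `x
  -- = Δ(t)` the factor `Δ(h₂)` is absorbed instead, which leaves the right side of the goal.
  have claim : ∀ x : H ⊗[k] H, ∑ i ∈ (ℛ k h).index,
      ((ℛ k h).left i ⊗ₜ[k] (1 : H)) * P (x * comul ((ℛ k h).right i)) =
      P x * ((1 : H) ⊗ₜ[k] h) := by
    intro x
    induction x with
    | zero => simp
    | add x y hx hy => simp only [add_mul, map_add, mul_add, Finset.sum_add_distrib, hx, hy]
    | tmul a b =>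
      let G : H ⊗[k] (H ⊗[k] H) →ₗ[k] H ⊗[k] H :=
        TensorProduct.map (LinearMap.mulRight k (antipode k a) ∘ₗ LinearMap.mul' k H ∘ₗ
          (antipode k).lTensor H) (LinearMap.mulLeft k b) ∘ₗ
          (TensorProduct.assoc k H H H).symm.toLinearMap
      have e : ∀ (c : H) (y : H ⊗[k] H), G (c ⊗ₜ y) =
          (c ⊗ₜ[k] (1 : H)) * P ((a ⊗ₜ b) * y) := by
        intro c y
        induction y with
        | zero => simp
        | add x y hx hy => rw [TensorProduct.tmul_add, map_add, hx, hy, mul_add, map_add, mul_add]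
        | tmul d e => simp [G, P, antipode_mul_antidistrib, mul_assoc]
      have key := congrArg G (coassoc_apply (R := k) h)
      rw [← (ℛ k h).eq, map_sum, map_sum, map_sum, map_sum, map_sum] at key
      simp only [LinearMap.rTensor_tmul, LinearMap.lTensor_tmul, e] at key
      rw [← key]
      have : ∀ c d : H, G (TensorProduct.assoc k H H H (comul c ⊗ₜ d)) =
          antipode k a ⊗ₜ (b * counit (R := k) c • d) := by
        intro c d
        simp only [G, LinearMap.comp_apply, LinearEquiv.coe_coe, LinearEquiv.symm_apply_apply,
          TensorProduct.map_tmul, mul_antipode_lTensor_comul_apply, LinearMap.mulRight_apply,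
          LinearMap.mulLeft_apply]
        rw [← Algebra.smul_def, TensorProduct.smul_tmul, mul_smul_comm]
      simp only [this, ← TensorProduct.tmul_sum, ← Finset.mul_sum]
      rw [sum_counit_smul]
      simp [P]
  rw [← claim]
  simp only [← Bialgebra.comul_mul, ht, map_smul]
  simp only [mul_smul_comm, ← smul_mul_assoc, ← Finset.sum_mul, TensorProduct.smul_tmul',
    ← TensorProduct.sum_tmul]
  rw [sum_counit_smul_left]

/-- A Hopf algebra with a normalized integral is finite-dimensional. -/
theorem finite_of_integral (h1 : counit (R := k) t = 1) : Module.Finite k H := by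
  classical
  let b := Module.Basis.ofVectorSpace k H
  let e := TensorProduct.equivFinsuppOfBasisRight (M := H) b
  -- The span of the finitely many left legs of `Δ(t)`. Since `Δ(t)(h ⊗ 1) = Δ(t)(1 ⊗ S(h))`, it is
  -- a right ideal.
  let L := Submodule.span k (Set.range (e (comul t)))
  have hL : L.FG := Submodule.fg_span (Finsupp.finite_range _)
  have hleft : ∀ (x : H ⊗[k] H) (h : H) i, e (x * (h ⊗ₜ 1)) i = e x i * h := by
    intro x h i
    induction x with
    | zero => simp
    | add x y hx hy => simp only [add_mul, map_add, Finsupp.add_apply, hx, hy]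
    | tmul x y => simp [e]
  have hsum : ∀ x : H ⊗[k] H, x = (e x).sum fun i m => m ⊗ₜ b i := by
    intro x
    exact (e.symm_apply_apply x).symm.trans
      (TensorProduct.equivFinsuppOfBasisRight_symm_apply b (e x))
  have hright : ∀ (g : H) (i), e (comul t * ((1 : H) ⊗ₜ g)) i ∈ L := by
    intro g i
    rw [hsum (comul t), Finsupp.sum, Finset.sum_mul, map_sum, Finsupp.finsetSum_apply]
    refine Submodule.sum_mem _ fun j _ => ?_
    rw [Algebra.TensorProduct.tmul_mul_tmul, mul_one,
      TensorProduct.equivFinsuppOfBasisRight_apply_tmul_apply]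
    exact L.smul_mem _ (Submodule.subset_span ⟨j, rfl⟩)
  have hLmul : ∀ i (h : H), e (comul t) i * h ∈ L := by
    intro i h
    rw [← hleft, comul_integral_mul_left ht]
    exact hright _ _
  have htop : L = ⊤ := by
    rw [eq_top_iff]
    intro h _
    -- The identity `t₁ S(t₂) = ε(t) = 1` places `1` in this right ideal, so the finite-dimensional
    -- `L` is all of `H`.
    have h2 := mul_antipode_lTensor_comul_apply (R := k) t
    rw [h1, map_one, hsum (comul t), Finsupp.sum, map_sum, map_sum] at h2
    rw [← one_mul h, ← h2, Finset.sum_mul]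
    refine Submodule.sum_mem _ fun i _ => ?_
    rw [LinearMap.lTensor_tmul, LinearMap.mul'_apply, mul_assoc]
    exact hLmul _ _
  exact ⟨htop ▸ hL⟩

end Integral

/-! ### Averaging over an integral in a smash product. -/

section SmashSeparable

open TensorProduct Coalgebra HopfAlgebra

variable {k H A : Type u} [Field k] [Ring H] [HopfAlgebra k H] [Ring A] [Algebra k A]

namespace Smash

variable (α : ModuleAlgebra k H A)

/-- The embedding of `A` into `A # H`. -/
noncomputable def inclLeft : A →ₐ[k] Smash α :=
  AlgHom.ofLinearMap ((ofTensor α).toLinearMap ∘ₗ (TensorProduct.mk k A H).flip 1) rfl (by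
    intro a b
    change tmul α (a * b) 1 = tmul α a 1 * tmul α b 1
    change _ = mulMap α (a ⊗ₜ 1) (b ⊗ₜ 1)
    rw [mulMap_tmul, map_one, mul_one, leftMul_tmul]
    rfl)

theorem inclLeft_apply (a : A) : inclLeft α a = tmul α a 1 := rfl

theorem tmul_one_mul_tmul (a b : A) (h : H) : tmul α a 1 * tmul α b h = tmul α (a * b) h := by
  change mulMap α (a ⊗ₜ 1) (b ⊗ₜ h) = _
  rw [mulMap_tmul, map_one, mul_one, leftMul_tmul]
  rfl

/-- The embedding of `H` into `A # H`. -/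
noncomputable def inclRight : H →ₐ[k] Smash α :=
  AlgHom.ofLinearMap ((ofTensor α).toLinearMap ∘ₗ TensorProduct.mk k A H 1) rfl (by
    intro g h
    change tmul α 1 (g * h) = mulMap α (1 ⊗ₜ g) (1 ⊗ₜ h)
    rw [mulMap_tmul, map_one, one_mul, diag_tmul]
    simp only [α.act_one, Algebra.algebraMap_eq_smul_one, TensorProduct.smul_tmul,
      ← TensorProduct.tmul_sum, ← smul_mul_assoc, ← Finset.sum_mul]
    rw [Coalgebra.sum_counit_smul]
    rfl)

theorem inclRight_apply (h : H) : inclRight α h = tmul α 1 h := rfl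

theorem inclLeft_mul_inclRight (a : A) (h : H) :
    inclLeft α a * inclRight α h = tmul α a h := by
  rw [inclLeft_apply, inclRight_apply, tmul_one_mul_tmul, mul_one]

theorem inclRight_mul_inclLeft (a : A) (h : H) : inclRight α h * inclLeft α a =
    ∑ i ∈ (ℛ k h).index, inclLeft α (α.act ((ℛ k h).left i) a) * inclRight α ((ℛ k h).right i) := by
  rw [inclLeft_apply, inclRight_apply, tmul_mul_tmul]
  simp only [inclLeft_mul_inclRight, one_mul, mul_one]

theorem induction_on {P : Smash α → Prop} (hl : ∀ a, P (inclLeft α a))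
    (hr : ∀ h, P (inclRight α h)) (hm : ∀ x y, P x → P y → P (x * y))
    (ha : ∀ x y, P x → P y → P (x + y)) (x : Smash α) : P x := by
  obtain ⟨x, rfl⟩ := (ofTensor α).surjective x
  induction x with
  | zero => rw [map_zero, ← map_zero (inclLeft α)]; exact hl 0
  | add x y hx hy => rw [map_add]; exact ha _ _ hx hy
  | tmul a h => rw [ofTensor_tmul, ← inclLeft_mul_inclRight]; exact hm _ _ (hl a) (hr h)

/-- In `A # H`, the action of `H` on `A` is the adjoint action. -/
theorem inclLeft_act (h : H) (a : A) : inclLeft α (α.act h a) = ∑ i ∈ (ℛ k h).index,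
    inclRight α ((ℛ k h).left i) * inclLeft α a * inclRight α (antipode k ((ℛ k h).right i)) := by
  simp only [inclRight_mul_inclLeft, Finset.sum_mul]
  let F : H ⊗[k] (H ⊗[k] H) →ₗ[k] Smash α :=
    LinearMap.mul' k (Smash α) ∘ₗ TensorProduct.map
      ((inclLeft α).toLinearMap ∘ₗ α.act.toLinearMap.flip a)
      ((inclRight α).toLinearMap ∘ₗ LinearMap.mul' k H ∘ₗ (antipode k).lTensor H)
  have key := congrArg F (Coalgebra.sum_tmul_tmul_eq (ℛ k h) (fun i => ℛ k ((ℛ k h).left i))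
    (fun i => ℛ k ((ℛ k h).right i)))
  simp only [F, map_sum, LinearMap.comp_apply, TensorProduct.map_tmul, LinearMap.lTensor_tmul,
    LinearMap.mul'_apply, AlgHom.toLinearMap_apply, LinearMap.flip_apply, map_mul,
    ← mul_assoc] at key
  rw [key]
  simp only [mul_assoc, ← map_mul, ← Finset.mul_sum, ← map_sum]
  simp only [sum_mul_antipode_eq_algebraMap_counit, AlgHom.commutes, ← Algebra.commutes,
    ← Algebra.smul_def]
  have e : α.act h a = ∑ i ∈ (ℛ k h).index,
      counit (R := k) ((ℛ k h).right i) • α.act ((ℛ k h).left i) a := by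
    conv_lhs => rw [← sum_counit_smul_left (k := k) h, map_sum, LinearMap.sum_apply]
    simp only [map_smul, LinearMap.smul_apply]
  rw [e, map_sum]
  simp only [map_smul]

/-- Expand the action as an adjoint action: `S(h₁) h₂ a S(h₃)` collapses to `a S(h)`. -/
theorem sum_inclRight_antipode_mul_inclLeft_act (h : H) (a : A) :
    ∑ i ∈ (ℛ k h).index, inclRight α (antipode k ((ℛ k h).left i)) *
      inclLeft α (α.act ((ℛ k h).right i) a) = inclLeft α a * inclRight α (antipode k h) := by
  simp only [inclLeft_act, Finset.mul_sum]
  let F : H ⊗[k] (H ⊗[k] H) →ₗ[k] Smash α :=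
    LinearMap.mul' k (Smash α) ∘ₗ TensorProduct.map
      ((inclRight α).toLinearMap ∘ₗ LinearMap.mul' k H ∘ₗ (antipode k).rTensor H)
      (LinearMap.mulLeft k (inclLeft α a) ∘ₗ (inclRight α).toLinearMap ∘ₗ antipode k) ∘ₗ
      (TensorProduct.assoc k H H H).symm.toLinearMap
  have key := congrArg F (Coalgebra.sum_tmul_tmul_eq (ℛ k h) (fun i => ℛ k ((ℛ k h).left i))
    (fun i => ℛ k ((ℛ k h).right i)))
  simp only [F, map_sum, LinearMap.comp_apply, TensorProduct.map_tmul, LinearMap.rTensor_tmul,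
    LinearEquiv.coe_coe, TensorProduct.assoc_symm_tmul,
    LinearMap.mul'_apply, AlgHom.toLinearMap_apply, LinearMap.mulLeft_apply, map_mul] at key
  simp only [← mul_assoc] at key ⊢
  rw [← key]
  simp only [mul_assoc _ (inclLeft α a), ← map_mul, ← Finset.sum_mul, ← map_sum]
  simp only [sum_antipode_mul_eq_algebraMap_counit, AlgHom.commutes,
    ← Algebra.smul_def, ← mul_smul_comm, ← map_smul, ← Finset.mul_sum, ← map_sum]
  rw [sum_counit_smul]

section Casimir

variable {α} {M : Type u} [AddCommGroup M] [Module k M] [Module (Smash α) M]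
  [IsScalarTower k (Smash α) M]

/-- For `t ∈ H`, the operator `g ↦ S(t₁) g(t₂)` on the maps `A # H → M`. -/
noncomputable def average (t : H) (g : Smash α →ₗ[k] M) : M :=
  ∑ i ∈ (ℛ k t).index, inclRight α (antipode k ((ℛ k t).left i)) • g (inclRight α ((ℛ k t).right i))

/-- On the coinduced module `Hom_A(A # H, M)` the element `s` acts by precomposition with right
multiplication, so this is the `A # H`-linearity of the averaging map. The statement is
multiplicative in `s` once `g` varies over all `A`-linear maps, so `s` may be taken in `A` or in
`H`. -/
theorem average_comp_mulRight {t : H} (ht : ∀ h, t * h = counit (R := k) h • t)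
    (g : Smash α →ₗ[k] M) (hg : ∀ a x, g (inclLeft α a * x) = inclLeft α a • g x) (s : Smash α) :
    average t (g ∘ₗ LinearMap.mulRight k s) = s • average t g := by
  induction s using induction_on generalizing g with
  | ha x y hx hy =>
    rw [add_smul, ← hx g hg, ← hy g hg, average, average, average, ← Finset.sum_add_distrib]
    exact Finset.sum_congr rfl fun i _ => by simp [mul_add]
  | hm x y hx hy =>
    have e : g ∘ₗ LinearMap.mulRight k (x * y) =
        (g ∘ₗ LinearMap.mulRight k y) ∘ₗ LinearMap.mulRight k x := by
      ext z; simp [mul_assoc]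
    rw [e, hx _ fun a z => by simp [mul_assoc, hg], hy g hg, mul_smul]
  -- For `s` in `H` this is the Casimir identity `S(t₁) ⊗ t₂ h = h S(t₁) ⊗ t₂`.
  | hr h =>
    let F : H ⊗[k] H →ₗ[k] M := TensorProduct.lift
      (((Algebra.lsmul k k M).toLinearMap ∘ₗ (inclRight α).toLinearMap).compl₂
        (g ∘ₗ (inclRight α).toLinearMap))
    have hF : ∀ a b, F (a ⊗ₜ b) = inclRight α a • g (inclRight α b) := fun a b => rfl
    have key := congrArg F (comul_integral_mul_right ht h)
    rw [← (ℛ k t).eq] at key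
    simp only [map_sum, LinearMap.rTensor_tmul, Finset.sum_mul, Finset.mul_sum,
      Algebra.TensorProduct.tmul_mul_tmul, mul_one, one_mul, hF, map_mul, mul_smul,
      ← Finset.smul_sum] at key
    exact key
  -- For `s = a` in `A`: `S(t₁) g(t₂ a) = S(t₁) (t₂ ⬝ a) g(t₃) = a S(t₁) g(t₂)`.
  | hl a =>
    let F : H ⊗[k] (H ⊗[k] H) →ₗ[k] M := TensorProduct.lift
      ((Algebra.lsmul k k M).toLinearMap.compl₁₂ (LinearMap.mul' k (Smash α) ∘ₗ
        TensorProduct.map ((inclRight α).toLinearMap ∘ₗ antipode k)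
          ((inclLeft α).toLinearMap ∘ₗ α.act.toLinearMap.flip a))
        (g ∘ₗ (inclRight α).toLinearMap)) ∘ₗ
      (TensorProduct.assoc k H H H).symm.toLinearMap
    have hF : ∀ b c d, F (b ⊗ₜ (c ⊗ₜ d)) = (inclRight α (antipode k b) *
      inclLeft α (α.act c a)) • g (inclRight α d) := fun b c d => rfl
    have key := congrArg F (Coalgebra.sum_tmul_tmul_eq (ℛ k t) (fun i => ℛ k ((ℛ k t).left i))
      (fun i => ℛ k ((ℛ k t).right i)))
    simp only [map_sum, hF, ← Finset.sum_smul, sum_inclRight_antipode_mul_inclLeft_act] at key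
    rw [average, average, Finset.smul_sum]
    simp only [mul_smul] at key
    rw [key]
    refine Finset.sum_congr rfl fun i _ => ?_
    rw [LinearMap.comp_apply, LinearMap.mulRight_apply, inclRight_mul_inclLeft, map_sum,
      Finset.smul_sum]
    exact Finset.sum_congr rfl fun j _ => by rw [hg]

/-- Since `S(t₁) t₂ = ε(t) = 1`, averaging inverts the unit `m ↦ (s ↦ s m)` on one side. -/
theorem average_orbit {t : H} (ht : counit (R := k) t = 1) (m : M) :
    average t ((Algebra.lsmul k k M).toLinearMap.flip m : Smash α →ₗ[k] M) = m := by
  change ∑ i ∈ (ℛ k t).index, inclRight α (antipode k ((ℛ k t).left i)) •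
    inclRight α ((ℛ k t).right i) • m = m
  simp only [← mul_smul, ← map_mul, ← Finset.sum_smul, ← map_sum]
  rw [sum_antipode_mul_eq_algebraMap_counit, ht, map_one, map_one, one_smul]

end Casimir

end Smash

end SmashSeparable

/-! ### From noetherian cohomology of `A` to finitely generated cohomology of `A # H`. -/

section SmashFGC

open TensorProduct Coalgebra HopfAlgebra CategoryTheory CategoryTheory.Abelian DirectSum

variable {k H A : Type u} [Field k] [Ring H] [HopfAlgebra k H] [Ring A] [Algebra k A]

namespace Smash

variable (α : ModuleAlgebra k H A)

/-- As a left `A`-module, `A # H` is `A ⊗ H`, with `A` acting on the first factor only. Projectivity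
makes coinduction exact. -/
theorem projective_restrictScalars : Module.Projective A
    ((ModuleCat.restrictScalars (inclLeft α).toRingHom).obj (ModuleCat.of (Smash α) (Smash α))) := by
  have h : Module.Projective A (A ⊗[k] H) := inferInstance
  let e : A ⊗[k] H ≃+ (ModuleCat.restrictScalars (inclLeft α).toRingHom).obj
      (ModuleCat.of (Smash α) (Smash α)) := (ofTensor α).toAddEquiv
  let M : ModuleCat A := (ModuleCat.restrictScalars (inclLeft α).toRingHom).obj
    (ModuleCat.of (Smash α) (Smash α))
  suffices he : ∀ (a : A) x, e (a • x) = a • (e x : M) from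
    Module.Projective.of_equiv ({ e with map_smul' := he } : A ⊗[k] H ≃ₗ[A] M)
  intro a x
  change (ofTensor α (a • x) : Smash α) = inclLeft α a * ofTensor α x
  induction x with
  | zero => simp
  | add x y hx hy => rw [smul_add, map_add, hx, hy, map_add, mul_add]
  | tmul b h =>
    rw [TensorProduct.smul_tmul', ofTensor_tmul, ofTensor_tmul, inclLeft_apply, tmul_one_mul_tmul,
      smul_eq_mul]

theorem coextendScalars_apply_mul (N : ModuleCat.{u} A)
    (g : (ModuleCat.coextendScalars.{u, u, u} (inclLeft α).toRingHom).obj N) (a : A)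
    (s : Smash α) : (ModuleCat.CoextendScalars.equiv _ _ g) (inclLeft α a * s : Smash α) =
      a • (ModuleCat.CoextendScalars.equiv _ _ g) s :=
  (ModuleCat.CoextendScalars.equiv _ _ g).map_smul a
    (show (ModuleCat.restrictScalars (inclLeft α).toRingHom).obj
      (ModuleCat.of (Smash α) (Smash α)) from s)

open scoped ModuleCat in
/-- The natural retraction `g ↦ S(t₁) g(t₂)` of the coinduced module `Hom_A (A # H, M)` onto `M`,
for a right integral `t`. -/
noncomputable def averageNatTrans {t : H} (ht : ∀ h, t * h = counit (R := k) h • t) :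
    ModuleCat.restrictScalars.{u} (inclLeft α).toRingHom ⋙
      ModuleCat.coextendScalars.{u, u, u} (inclLeft α).toRingHom ⟶ 𝟭 _ where
  app M :=
    let toLin : ((ModuleCat.restrictScalars.{u} (inclLeft α).toRingHom ⋙
      ModuleCat.coextendScalars.{u, u, u} (inclLeft α).toRingHom).obj M) → (Smash α →ₗ[k] M) :=
      fun g =>
      { toFun := fun s => (ModuleCat.CoextendScalars.equiv _ _ g) s
        map_add' := fun x y => map_add (ModuleCat.CoextendScalars.equiv _ _ g) x y
        map_smul' := fun r x => by
          have := coextendScalars_apply_mul α _ g (algebraMap k A r) x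
          rw [AlgHom.commutes, ← Algebra.smul_def] at this
          refine this.trans ?_
          change inclLeft α (algebraMap k A r) • (_ : M) = _
          rw [AlgHom.commutes]
          rfl }
    ModuleCat.ofHom (X := (ModuleCat.restrictScalars.{u} (inclLeft α).toRingHom ⋙
      ModuleCat.coextendScalars.{u, u, u} (inclLeft α).toRingHom).obj M)
    { toFun := fun g => average t (toLin g)
      map_add' := fun g g' => by
        simp only [average, ← Finset.sum_add_distrib, ← smul_add]
        rfl
      map_smul' := fun s g =>
        average_comp_mulRight ht (toLin g) 
          (coextendScalars_apply_mul α _ g) s }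
  naturality M N f := by
    ext g
    change _ = f (Finset.sum _ _)
    rw [map_sum]
    refine Finset.sum_congr rfl fun i _ => ?_
    exact (map_smul f.hom _ _).symm

end Smash

section Connected

variable {B : Type u} [Ring B] [Algebra k B]

theorem trivialModule_comp (f : A →ₐ[k] B) (ε : B →ₐ[k] k) :
    trivialModule (ε.comp f) = (ModuleCat.restrictScalars f.toRingHom).obj (trivialModule ε) := rfl

theorem trivialModule_smul (ε : B →ₐ[k] k) (b : B) (x : trivialModule ε) :
    b • x = (show trivialModule ε from (ε b * (show k from x) : k)) := rfl

/-- `Ext⁰` is `Hom_B(k, k)`, whose elements are multiplications by the image of `1`: the cohomology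
ring is connected. -/
theorem exists_algebraMap_eq_of_zero (ε : B →ₐ[k] k)
    (x : Ext (trivialModule ε) (trivialModule ε) 0) :
    ∃ r : k, of (fun n => Ext (trivialModule ε) (trivialModule ε) n) 0 x =
      algebraMap k (CohomologyRing ε) r := by
  obtain ⟨f, rfl⟩ := (Ext.mk₀_bijective _ _).2 x
  let r : k := f (show trivialModule ε from (1 : k))
  refine ⟨r, ?_⟩
  refine congrArg (of (fun n => Ext (trivialModule ε) (trivialModule ε) n) 0) ?_
  change _ = r • Ext.mk₀ (𝟙 (trivialModule ε))
  rw [← Ext.mk₀_smul]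
  congr 1
  ext y
  have h1 : y = algebraMap k B (show k from y) • (show trivialModule ε from (1 : k)) := by
    rw [trivialModule_smul, AlgHom.commutes]
    exact (mul_one (show k from y)).symm
  change f y = algebraMap k B _ • y
  rw [trivialModule_smul, AlgHom.commutes]
  conv_lhs => rw [h1, map_smul, trivialModule_smul, AlgHom.commutes]
  exact mul_comm (show k from y) _

/-- Finiteness passes through `k`: `M` is finite-dimensional because `B` is. -/
theorem finite_restrictScalars (f : A →ₐ[k] B) [Module.Finite k B] (M : ModuleCat.{u} B)
    [Module.Finite B M] : Module.Finite A ((ModuleCat.restrictScalars f.toRingHom).obj M) := by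
  let _ : Module k M := Module.compHom M (algebraMap k B)
  have : IsScalarTower k B M := ⟨fun r s m => by
    rw [Algebra.smul_def, mul_smul]; rfl⟩
  have h1 : Module.Finite k M := Module.Finite.trans B M
  let M' := (ModuleCat.restrictScalars f.toRingHom).obj M
  let _ : Module k M' := Module.compHom M (algebraMap k B)
  have : IsScalarTower k A M' := ⟨fun r s m => by
    rw [Algebra.smul_def, mul_smul]
    change (f (algebraMap k A r) : B) • (s • m : M') = (algebraMap k B r : B) • (s • m : M')
    rw [AlgHom.commutes]⟩
  have h2 : Module.Finite k M' := h1
  exact Module.Finite.of_restrictScalars_finite k A M'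

end Connected

instance (ε : A →ₐ[k] k) : Module.Finite A (trivialModule ε) := by
  refine ⟨{(show trivialModule ε from (1 : k))}, ?_⟩
  rw [Finset.coe_singleton, eq_top_iff]
  intro y _
  refine Submodule.mem_span_singleton.2 ⟨algebraMap k A (show k from y), ?_⟩
  rw [trivialModule_smul, AlgHom.commutes]
  exact mul_one (show k from y)

/-- If `A` is finite-dimensional and its cohomology with coefficients in finitely generated modules
is noetherian, then `A # H` has finitely generated cohomology for each semisimple `H`. -/
theorem Smash.hasFGC_aug [IsSemisimpleRing H] [FiniteDimensional k A] (α : ModuleAlgebra k H A)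
    (ε : A →ₐ[k] k) (hε : ∀ (h : H) (a : A), ε (α.act h a) = counit h * ε a)
    (hA : ∀ M : ModuleCat.{u} A, Module.Finite A M →
      IsNoetherian (CohomologyRing ε) (Cohomology ε M)) : HasFGC (Smash.aug ε hε) := by
  obtain ⟨t, ht, ht1⟩ := exists_integral (k := k) (H := H)
  have hH : Module.Finite k H := finite_of_integral ht ht1
  have hε' : (Smash.aug ε hε).comp (Smash.inclLeft α) = ε := by
    ext a
    rw [AlgHom.comp_apply, Smash.inclLeft_apply, Smash.aug_tmul, Bialgebra.counit_one, mul_one]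
  have hsmash : Module.Finite k (Smash α) := Module.Finite.equiv (Smash.ofTensor α)
  have noeth : ∀ M : ModuleCat.{u} (Smash α), Module.Finite (Smash α) M →
      IsNoetherian (CohomologyRing (Smash.aug ε hε)) (Cohomology (Smash.aug ε hε) M) := by
    intro M hM
    have hMA : Module.Finite A
        ((ModuleCat.restrictScalars (Smash.inclLeft α).toRingHom).obj M) := by
      exact finite_restrictScalars (k := k) (Smash.inclLeft α) M
    refine isNoetherian_ext_of_restrictScalars (Smash.inclLeft α).toRingHom
      (Smash.projective_restrictScalars α) (Smash.averageNatTrans α ht) ?_ _ M ?_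
    · intro N m
      let _ : Module k N := Module.compHom N (algebraMap k (Smash α))
      have : IsScalarTower k (Smash α) N := ⟨fun r s m => by
        rw [Algebra.smul_def, mul_smul]; rfl⟩
      exact Smash.average_orbit ht1 m
    · rw [← trivialModule_comp, hε']
      exact hA _ hMA
  refine ⟨?_, fun M hM => ?_⟩
  -- The trivial module is a finite module, so the case `M = k` of `noeth` says that the cohomology
  -- ring is noetherian over itself.
  · have : IsNoetherianRing (CohomologyRing (Smash.aug ε hε)) := noeth _ inferInstance
    exact finiteType_of_isNoetherianRing _ (exists_algebraMap_eq_of_zero _)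
  · have := noeth M hM
    infer_instance

end SmashFGC

/-! ### The grading of a Nichols algebra and invariants in its modules. -/

section NicholsNilpotent

open Polynomial

variable {k : Type u} [Field k] {V : Type u} [AddCommGroup V] [Module k V] (c : Braiding k V)

namespace NicholsAlgebra

/-- The linear inclusion of `V` into `𝔅(V)`. -/
noncomputable def ι : V →ₗ[k] NicholsAlgebra c := (mk c).toLinearMap ∘ₗ TensorAlgebra.ι k

/-- Scaling generators by `X` multiplies degree `n` by `X ^ n`. As the relations are homogeneous,
they are respected, which yields the grading map `grade`. -/
theorem lift_toTensorAlgebra_scale {B : Type u} [Ring B] [Algebra k B] (f : V →ₗ[k] B) (n : ℕ)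
    (x : TPow k V n) : TensorAlgebra.lift k
      ((Polynomial.monomial 1).restrictScalars k ∘ₗ f) (TPow.toTensorAlgebra k V n x) =
      Polynomial.monomial n (TensorAlgebra.lift k f (TPow.toTensorAlgebra k V n x)) := by
  induction n with
  | zero =>
    change k at x
    change TensorAlgebra.lift k _ (algebraMap k _ x) = Polynomial.monomial 0
      (TensorAlgebra.lift k _ (algebraMap k _ x))
    rw [AlgHom.commutes, AlgHom.commutes, Polynomial.algebraMap_apply]
    rfl
  | succ n ih =>
    change TensorAlgebra.lift k _ (LinearMap.mul' k (TensorAlgebra k V)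
      (TensorProduct.map (TensorAlgebra.ι k) (TPow.toTensorAlgebra k V n) x)) =
      Polynomial.monomial (n + 1) (TensorAlgebra.lift k _ (LinearMap.mul' k (TensorAlgebra k V)
      (TensorProduct.map (TensorAlgebra.ι k) (TPow.toTensorAlgebra k V n) x)))
    induction x using TensorProduct.induction_on with
    | zero => simp
    | add x y hx hy => simp only [map_add, hx, hy]
    | tmul v x =>
      simp only [TensorProduct.map_tmul, LinearMap.mul'_apply, map_mul, ih,
        TensorAlgebra.lift_ι_apply, LinearMap.comp_apply, LinearMap.coe_restrictScalars,
        Polynomial.monomial_mul_monomial, add_comm]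

/-- The grading of `𝔅(V)`, as an algebra map `𝔅(V) → 𝔅(V)[X]`, `v ↦ v X`. -/
noncomputable def grade : NicholsAlgebra c →ₐ[k] (NicholsAlgebra c)[X] :=
  lift c (TensorAlgebra.lift k ((Polynomial.monomial 1).restrictScalars k ∘ₗ ι c))
    fun n x hx => by
      rw [lift_toTensorAlgebra_scale]
      have : TensorAlgebra.lift k (ι c) = mk c := by ext v; simp [ι]
      rw [this, mk_eq_zero c n x hx, map_zero]

theorem grade_ι (v : V) : grade c (ι c v) = Polynomial.monomial 1 (ι c v) := by
  change grade c (mk c _) = _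
  rw [grade, lift_mk, TensorAlgebra.lift_ι_apply]
  rfl

theorem induction' {P : NicholsAlgebra c → Prop}
    (h1 : ∀ r, P (algebraMap k _ r)) (h2 : ∀ v, P (ι c v))
    (h3 : ∀ a b, P a → P b → P (a * b)) (h4 : ∀ a b, P a → P b → P (a + b))
    (a : NicholsAlgebra c) : P a := NicholsAlgebra.induction h1 h2 h3 h4 a

theorem aug_ι (v : V) : aug c (ι c v) = 0 := by
  change aug c (mk c _) = _
  rw [aug_mk]
  simp [TensorAlgebra.algebraMapInv]

/-- Nonzero elements chosen in every degree would be linearly independent, as the coefficients of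
`grade` separate them. -/
theorem exists_homogeneous_eq_zero [FiniteDimensional k (NicholsAlgebra c)] :
    ∃ n : ℕ, ∀ x : NicholsAlgebra c, grade c x = Polynomial.monomial n x → x = 0 := by
  by_contra! h
  choose x hx hx0 using h
  have hli : LinearIndependent k x := by
    rw [linearIndependent_iff']
    intro s g hg i hi
    have h1 := congrArg (fun y => (grade c y).coeff i) hg
    simp only [map_sum, map_smul, hx, map_zero, Polynomial.finsetSum_coeff,
      Polynomial.coeff_smul, Polynomial.coeff_monomial, Polynomial.coeff_zero] at h1
    simp only [smul_ite, smul_zero, Finset.sum_ite_eq', hi, if_true] at h1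
    exact (smul_eq_zero.1 h1).resolve_right (hx0 i)
  have := hli.finite
  exact not_finite ℕ

/-- A non-zero module over a finite-dimensional Nichols algebra has non-zero invariants. -/
theorem exists_invariant [FiniteDimensional k (NicholsAlgebra c)] (M : Type*) [AddCommGroup M]
    [Module (NicholsAlgebra c) M] [Nontrivial M] :
    ∃ m : M, m ≠ 0 ∧ ∀ r : NicholsAlgebra c, r • m = algebraMap k (NicholsAlgebra c) (aug c r) • m := by
  classical
  have h : ∃ n : ℕ, ∀ x : NicholsAlgebra c, grade c x = Polynomial.monomial n x →
      ∀ m : M, x • m = 0 := by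
    obtain ⟨n, hn⟩ := exists_homogeneous_eq_zero c
    exact ⟨n, fun x hx m => by rw [hn x hx, zero_smul]⟩
  obtain ⟨m₀, hm₀⟩ := exists_ne (0 : M)
  -- `Nat.find h` is the least degree in which everything annihilates `M`; degree `0` does not,
  -- because of `1`. One degree lower some `x • m` survives, and it is killed by all of `V`.
  have hpos : Nat.find h ≠ 0 := by
    intro h0
    have := Nat.find_spec h 1 (by rw [h0, map_one]; rfl) m₀
    rw [one_smul] at this
    exact hm₀ this
  have hlt := Nat.find_min h (Nat.sub_one_lt hpos)
  push Not at hlt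
  obtain ⟨x, hx, m, hm⟩ := hlt
  refine ⟨x • m, hm, fun r => ?_⟩
  induction r using induction' with
  | h1 r => rw [AlgHom.commutes]; rfl
  | h2 v =>
    rw [aug_ι, map_zero, zero_smul, ← mul_smul]
    refine Nat.find_spec h _ ?_ m
    rw [map_mul, grade_ι, hx, Polynomial.monomial_mul_monomial,
      Nat.add_sub_of_le (Nat.one_le_iff_ne_zero.2 hpos)]
  | h3 a b ha hb => rw [mul_smul, hb, ← mul_smul, ← Algebra.commutes, mul_smul, ha, ← mul_smul,
      map_mul, map_mul, ← map_mul, mul_comm, map_mul]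
  | h4 a b ha hb => rw [add_smul, ha, hb, map_add, map_add, add_smul]

end NicholsAlgebra

end NicholsNilpotent

/-! ### Ext-modules in short exact sequences. -/

section Filtration

open CategoryTheory CategoryTheory.Abelian DirectSum

universe w' v' u'

variable {C : Type u'} [Category.{v'} C] [Abelian C] [HasExt.{w'} C]

/-- The map on `⨁ₙ Extⁿ(X, Y)` given by a morphism from `Y`. -/
noncomputable def extMapLinear (X : C) {Y Z : C} (f : Y ⟶ Z) :
    (⨁ n, Ext X Y n) →ₗ[⨁ n, Ext X X n] (⨁ n, Ext X Z n) where
  toFun := DirectSum.map fun n => (Ext.mk₀ f).postcomp X (add_zero n)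
  map_add' := map_add _
  map_smul' a y := by
    rw [RingHom.id_apply]
    induction a using DirectSum.induction_on with
    | zero => simp only [zero_smul, map_zero]
    | add a b ha hb => simp only [add_smul, map_add, ha, hb]
    | of i a =>
      induction y using DirectSum.induction_on with
      | zero => simp only [smul_zero, map_zero]
      | add a b ha hb => simp only [smul_add, map_add, ha, hb]
      | of j y =>
        rw [DirectSum.map_of, DirectSum.Gmodule.of_smul_of, DirectSum.map_of,
          DirectSum.Gmodule.of_smul_of]
        exact congrArg _ (Ext.comp_assoc a y (Ext.mk₀ f) rfl (add_zero j) rfl)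

theorem extMapLinear_of (X : C) {Y Z : C} (f : Y ⟶ Z) (n : ℕ) (y : Ext X Y n) :
    extMapLinear X f (of (fun n => Ext X Y n) n y) =
      of (fun n => Ext X Z n) n (y.comp (Ext.mk₀ f) (add_zero n)) :=
  DirectSum.map_of _ _ _

theorem extMapLinear_apply (X : C) {Y Z : C} (f : Y ⟶ Z) (n : ℕ) (y : ⨁ n, Ext X Y n) :
    extMapLinear X f y n = (y n).comp (Ext.mk₀ f) (add_zero n) :=
  DirectSum.map_apply _ _ _

/-- The long exact sequence is exact at the middle term in each degree, and its maps are linear over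
the Yoneda ring acting on the other side. -/
theorem isNoetherian_ext_of_shortExact (X : C) {S : ShortComplex C} (hS : S.ShortExact)
    [IsNoetherian (⨁ n, Ext X X n) (⨁ n, Ext X S.X₁ n)]
    [IsNoetherian (⨁ n, Ext X X n) (⨁ n, Ext X S.X₃ n)] :
    IsNoetherian (⨁ n, Ext X X n) (⨁ n, Ext X S.X₂ n) := by
  classical
  refine isNoetherian_of_range_eq_ker (extMapLinear X S.f) (extMapLinear X S.g) ?_
  ext y
  constructor
  · rintro ⟨y, rfl⟩
    induction y using DirectSum.induction_on with
    | zero => simp only [map_zero]; exact zero_mem _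
    | add a b ha hb => rw [map_add]; exact add_mem ha hb
    | of j y =>
      rw [LinearMap.mem_ker, extMapLinear_of, extMapLinear_of,
        Ext.comp_assoc _ _ _ _ (zero_add 0) (by omega), Ext.mk₀_comp_mk₀, S.zero, Ext.mk₀_zero,
        Ext.comp_zero, map_zero]
  · intro hy
    have h1 : ∀ n, (y n).comp (Ext.mk₀ S.g) (add_zero n) = 0 := fun n => by
      rw [← extMapLinear_apply, LinearMap.mem_ker.1 hy]; rfl
    rw [← DirectSum.sum_support_of y]
    refine Submodule.sum_mem _ fun n _ => ?_
    obtain ⟨z, hz⟩ := Ext.covariant_sequence_exact₂ X hS (y n) (h1 n)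
    exact ⟨of _ n z, by rw [extMapLinear_of, hz]⟩

end Filtration

/-! ### Noetherian cohomology with finite coefficients over a Nichols algebra. -/

section FiltrationNichols

open CategoryTheory CategoryTheory.Abelian DirectSum

variable {k : Type u} [Field k] {V : Type u} [AddCommGroup V] [Module k V] (c : Braiding k V)

theorem isNoetherian_ext_of_subsingleton {B : Type u} [Ring B] (X M : ModuleCat.{u} B)
    [Subsingleton M] : IsNoetherian (⨁ n, Ext X X n) (⨁ n, Ext X M n) := by
  have h0 : 𝟙 M = 0 := by ext x; exact Subsingleton.elim _ _
  have : ∀ n, Subsingleton (Ext X M n) := fun n => subsingleton_of_forall_eq 0 fun y => by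
    rw [← Ext.comp_mk₀_id y, h0, Ext.mk₀_zero, Ext.comp_zero]
  have : Subsingleton (⨁ n, Ext X M n) := ⟨fun a b => by ext n; exact Subsingleton.elim _ _⟩
  infer_instance

/-- If the cohomology ring of a finite-dimensional Nichols algebra is noetherian, so is its
cohomology with coefficients in a finitely generated module. -/
theorem NicholsAlgebra.isNoetherian_cohomology [FiniteDimensional k (NicholsAlgebra c)]
    [IsNoetherianRing (CohomologyRing (aug c))] (M : ModuleCat.{u} (NicholsAlgebra c))
    (hM : Module.Finite (NicholsAlgebra c) M) :
    IsNoetherian (CohomologyRing (aug c)) (Cohomology (aug c) M) := by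
  have key : ∀ (d : ℕ) (M : ModuleCat.{u} (NicholsAlgebra c)) [Module k M]
      [IsScalarTower k (NicholsAlgebra c) M] [Module.Finite k M], Module.finrank k M = d →
      IsNoetherian (CohomologyRing (aug c)) (Cohomology (aug c) M) := by
    intro d
    induction d with
    | zero =>
      intro M _ _ _ hd
      have := Module.finrank_zero_iff.1 hd
      exact isNoetherian_ext_of_subsingleton _ M
    | succ d ih =>
      intro M _ _ _ hd
      have : Nontrivial M := Module.nontrivial_of_finrank_pos (R := k) (by omega)
      -- The invariant spans a trivial submodule, whose cohomology is the ring itself; the quotient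
      -- has dimension `d`.
      obtain ⟨m, hm, hm'⟩ := exists_invariant c M
      let _ : Module (NicholsAlgebra c) k := Module.compHom k (aug c).toRingHom
      let j : k →ₗ[NicholsAlgebra c] M :=
        { toFun := fun a => algebraMap k (NicholsAlgebra c) a • m
          map_add' := fun a b => by
            rw [← add_smul, ← map_add]
          map_smul' := fun r a => by
            change algebraMap k (NicholsAlgebra c) (aug c r * a) • m =
              r • algebraMap k (NicholsAlgebra c) a • m
            rw [← mul_smul, ← Algebra.commutes, mul_smul, hm' r, ← mul_smul, ← map_mul, mul_comm] }
      have hj : Function.Injective j := by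
        refine (injective_iff_map_eq_zero j).2 fun a ha => ?_
        have ha' : a • m = 0 := by
          rw [← algebraMap_smul (NicholsAlgebra c)]; exact ha
        exact (smul_eq_zero.1 ha').resolve_right hm
      let N := LinearMap.range j
      let S : ShortComplex (ModuleCat.{u} (NicholsAlgebra c)) := ShortComplex.mk
        (X₁ := trivialModule (aug c)) (X₂ := M) (X₃ := ModuleCat.of _ (M ⧸ N))
        (ModuleCat.ofHom j) (ModuleCat.ofHom N.mkQ) (by
          ext a
          exact (Submodule.Quotient.mk_eq_zero N).2 ⟨a, rfl⟩)
      have hS : S.ShortExact := by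
        refine (ModuleCat.shortExact_iff _).2 ⟨hj, N.mkQ_surjective, fun x hx => ?_⟩
        exact (Submodule.Quotient.mk_eq_zero N).1 hx
      have hN : Module.finrank k (M ⧸ N) = d := by
        have h1 := Submodule.finrank_quotient_add_finrank (N.restrictScalars k)
        have e : k ≃ₗ[k] N.restrictScalars k := LinearEquiv.ofBijective
          { toFun := fun a => (⟨j a, a, rfl⟩ : N.restrictScalars k)
            map_add' := fun a b => Subtype.ext (map_add j a b)
            map_smul' := fun r a => Subtype.ext (by
              change algebraMap k (NicholsAlgebra c) (r * a) • m =
                r • algebraMap k (NicholsAlgebra c) a • m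
              rw [map_mul, mul_smul, algebraMap_smul]) }
          ⟨fun a b h => hj (congrArg Subtype.val h), by rintro ⟨_, a, rfl⟩; exact ⟨a, rfl⟩⟩
        rw [← e.finrank_eq, Module.finrank_self, hd] at h1
        exact Nat.succ_injective h1
      have h3 : IsNoetherian (CohomologyRing (aug c)) (Cohomology (aug c) S.X₃) := ih _ hN
      have h1 : IsNoetherianRing (CohomologyRing (aug c)) := ‹_›
      exact @isNoetherian_ext_of_shortExact _ _ _ _ (trivialModule (aug c)) S hS h1 h3
  let _ : Module k M := Module.compHom M (algebraMap k (NicholsAlgebra c))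
  have : IsScalarTower k (NicholsAlgebra c) M := ⟨fun r s m => by
    rw [Algebra.smul_def, mul_smul]; rfl⟩
  have : Module.Finite k M := Module.Finite.trans (NicholsAlgebra c) M
  exact key _ M rfl

end FiltrationNichols

/-! ### Skew derivations of the tensor algebra. -/

section SkewDerivation

open TensorProduct

variable {k : Type u} [Field k] {V : Type u} [AddCommGroup V] [Module k V]

theorem TensorAlgebra.submodule_eq_top (S : Submodule k (TensorAlgebra k V)) (h1 : 1 ∈ S)
    (h2 : ∀ v, ∀ t ∈ S, TensorAlgebra.ι k v * t ∈ S) : S = ⊤ := by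
  rw [eq_top_iff]
  rintro t -
  suffices ∀ s ∈ S, t * s ∈ S by simpa using this 1 h1
  induction t using TensorAlgebra.induction with
  | algebraMap r => intro s hs; rw [← Algebra.smul_def]; exact S.smul_mem r hs
  | ι v => exact fun s hs => h2 v s hs
  | mul a b ha hb => exact fun s hs => by rw [mul_assoc]; exact ha _ (hb s hs)
  | add a b ha hb => exact fun s hs => by rw [add_mul]; exact S.add_mem (ha s hs) (hb s hs)

/-- Two linear maps on the tensor algebra agree if they agree on `1` and their agreement on `t`
implies that on `v t`. -/
theorem TensorAlgebra.linearMap_ext_left {M : Type*} [AddCommGroup M] [Module k M]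
    {f g : TensorAlgebra k V →ₗ[k] M} (h1 : f 1 = g 1)
    (h2 : ∀ v t, f t = g t → f (TensorAlgebra.ι k v * t) = g (TensorAlgebra.ι k v * t)) : f = g := by
  have := TensorAlgebra.submodule_eq_top (LinearMap.eqLocus f g) h1 h2
  ext t
  exact (this ▸ Submodule.mem_top : t ∈ LinearMap.eqLocus f g)

/-- The map `V ⊗ V^{⊗ n} → T(V)`. -/
noncomputable def TPow.mulToTensorAlgebra (n : ℕ) : V ⊗[k] TPow k V n →ₗ[k] TensorAlgebra k V :=
  LinearMap.mul' k (TensorAlgebra k V) ∘ₗ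
    TensorProduct.map (TensorAlgebra.ι k) (TPow.toTensorAlgebra k V n)

theorem TPow.mulToTensorAlgebra_tmul (n : ℕ) (v : V) (y : TPow k V n) :
    TPow.mulToTensorAlgebra n (v ⊗ₜ y) =
      TensorAlgebra.ι k v * TPow.toTensorAlgebra k V n y := rfl

theorem TPow.iSup_range_toTensorAlgebra :
    ⨆ n, LinearMap.range (TPow.toTensorAlgebra k V n) = ⊤ := by
  apply TensorAlgebra.submodule_eq_top
  · exact Submodule.mem_iSup_of_mem 0 ⟨(1 : k), map_one (algebraMap k (TensorAlgebra k V))⟩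
  · intro v t ht
    induction ht using Submodule.iSup_induction' with
    | mem n t ht =>
      obtain ⟨y, rfl⟩ := ht
      exact Submodule.mem_iSup_of_mem (n + 1)
        ⟨(v ⊗ₜ[k] y : V ⊗[k] TPow k V n), rfl⟩
    | zero => rw [mul_zero]; exact zero_mem _
    | add s t _ _ hs ht => rw [mul_add]; exact add_mem hs ht

theorem TPow.exists_sum_toTensorAlgebra (t : TensorAlgebra k V) : ∃ (s : Finset ℕ)
    (z : (n : ℕ) → TPow k V n), t = ∑ n ∈ s, TPow.toTensorAlgebra k V n (z n) := by
  have ht : t ∈ ⨆ n, LinearMap.range (TPow.toTensorAlgebra k V n) := by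
    rw [TPow.iSup_range_toTensorAlgebra]; trivial
  classical
  obtain ⟨f, hf⟩ := (Submodule.mem_iSup_iff_exists_dfinsupp' _ _).1 ht
  choose z hz using fun n => (f n).2
  exact ⟨f.support, z, by rw [← hf]; simp only [hz]; rfl⟩

section Maps

variable (ξ : V →ₗ[k] k) (g : V →ₗ[k] V)

/-- The operator `(s, t) ↦ (g(v) s + ξ(v) t, v t)` on pairs of elements of the tensor algebra. -/
noncomputable def skewOp : V →ₗ[k] Module.End k (TensorAlgebra k V × TensorAlgebra k V) where
  toFun v := LinearMap.prod
    (LinearMap.mulLeft k (TensorAlgebra.ι k (g v)) ∘ₗ LinearMap.fst k _ _ +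
      ξ v • LinearMap.snd k _ _)
    (LinearMap.mulLeft k (TensorAlgebra.ι k v) ∘ₗ LinearMap.snd k _ _)
  map_add' v w := by
    refine LinearMap.ext fun p => Prod.ext ?_ ?_
    · simp [add_mul, add_smul]; abel
    · simp [add_mul]
  map_smul' r v := by
    refine LinearMap.ext fun p => Prod.ext ?_ ?_
    · simp [mul_smul]
    · simp

theorem skewOp_apply (v : V) (p : TensorAlgebra k V × TensorAlgebra k V) :
    skewOp ξ g v p = (TensorAlgebra.ι k (g v) * p.1 + ξ v • p.2, TensorAlgebra.ι k v * p.2) := rfl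

/-- The skew derivation `∂` of the tensor algebra with `∂(v t) = ξ(v) t + g(v) ∂(t)`. -/
noncomputable def skewDer : TensorAlgebra k V →ₗ[k] TensorAlgebra k V :=
  LinearMap.fst k _ _ ∘ₗ LinearMap.applyₗ (0, 1) ∘ₗ
    (TensorAlgebra.lift k (skewOp ξ g)).toLinearMap

/-- Starting from `(0, 1)`, the second coordinate merely records `t`; this is what gives the first
coordinate its twisted Leibniz rule. -/
theorem lift_skewOp_snd (t : TensorAlgebra k V) :
    (TensorAlgebra.lift k (skewOp ξ g) t (0, 1)).2 = t := by
  refine LinearMap.congr_fun (f := LinearMap.snd k _ _ ∘ₗ LinearMap.applyₗ (0, 1) ∘ₗ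
    (TensorAlgebra.lift k (skewOp ξ g)).toLinearMap) (g := LinearMap.id)
    (TensorAlgebra.linearMap_ext_left ?_ fun v t ht => ?_) t
  · simp
  · simp only [LinearMap.comp_apply, LinearMap.applyₗ_apply_apply, AlgHom.toLinearMap_apply,
      LinearMap.snd_apply, LinearMap.id_apply] at ht ⊢
    rw [map_mul, TensorAlgebra.lift_ι_apply, Module.End.mul_apply, skewOp_apply, ht]

theorem skewDer_one : skewDer ξ g 1 = 0 := by simp [skewDer]

theorem skewDer_algebraMap (r : k) : skewDer ξ g (algebraMap k _ r) = 0 := by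
  rw [Algebra.algebraMap_eq_smul_one, map_smul, skewDer_one, smul_zero]

theorem skewDer_ι_mul (v : V) (t : TensorAlgebra k V) :
    skewDer ξ g (TensorAlgebra.ι k v * t) = ξ v • t + TensorAlgebra.ι k (g v) * skewDer ξ g t := by
  have h := lift_skewOp_snd ξ g t
  simp only [skewDer, LinearMap.comp_apply, LinearMap.applyₗ_apply_apply, AlgHom.toLinearMap_apply,
      LinearMap.fst_apply, map_mul, TensorAlgebra.lift_ι_apply, Module.End.mul_apply, skewOp_apply]
  rw [h, add_comm]

/-- The algebra endomorphism of the tensor algebra induced by an endomorphism of `V`. -/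
noncomputable def TensorAlgebra.mapEnd : TensorAlgebra k V →ₐ[k] TensorAlgebra k V :=
  TensorAlgebra.lift k (TensorAlgebra.ι k ∘ₗ g)

theorem TensorAlgebra.mapEnd_ι (v : V) :
    TensorAlgebra.mapEnd g (TensorAlgebra.ι k v) = TensorAlgebra.ι k (g v) := by
  simp [TensorAlgebra.mapEnd]

/-- The map `TPow (n + 1) → TPow n` corresponding to `skewDer`. -/
noncomputable def TPow.skewDer : (n : ℕ) → V ⊗[k] TPow k V n →ₗ[k] TPow k V n
  | 0 => (TensorProduct.lid k (TPow k V 0)).toLinearMap ∘ₗ ξ.rTensor _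
  | n + 1 => ((TensorProduct.lid k (V ⊗[k] TPow k V n)).toLinearMap ∘ₗ ξ.rTensor _ +
      TensorProduct.map g (TPow.skewDer n) :
        V ⊗[k] (V ⊗[k] TPow k V n) →ₗ[k] V ⊗[k] TPow k V n)

theorem TPow.skewDer_zero_tmul (v : V) (r : TPow k V 0) :
    TPow.skewDer ξ g 0 (v ⊗ₜ r) = ξ v • r := rfl

/-- Links the skew derivation of the algebra with its form on tensor powers, where the symmetrizers
are defined. -/
theorem TPow.toTensorAlgebra_skewDer (n : ℕ) (z : V ⊗[k] TPow k V n) :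
    TPow.toTensorAlgebra k V n (TPow.skewDer ξ g n z) =
      _root_.skewDer ξ g (TPow.mulToTensorAlgebra n z) := by
  suffices TPow.toTensorAlgebra k V n ∘ₗ TPow.skewDer ξ g n =
      _root_.skewDer ξ g ∘ₗ TPow.mulToTensorAlgebra n from LinearMap.congr_fun this z
  induction n with
  | zero =>
    refine TensorProduct.ext' fun v r => ?_
    rw [LinearMap.comp_apply, LinearMap.comp_apply, TPow.mulToTensorAlgebra_tmul, skewDer_ι_mul,
      TPow.skewDer_zero_tmul, map_smul]
    have : _root_.skewDer ξ g (TPow.toTensorAlgebra k V 0 r) = 0 := skewDer_algebraMap ξ g r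
    rw [this, mul_zero, add_zero]
  | succ n ih =>
    refine TensorProduct.ext' fun v (y : V ⊗[k] TPow k V n) => ?_
    have h : TPow.toTensorAlgebra k V n (TPow.skewDer ξ g n y) =
      _root_.skewDer ξ g (TPow.mulToTensorAlgebra n y) := LinearMap.congr_fun (ih y) y
    change TPow.mulToTensorAlgebra n (ξ v • y + g v ⊗ₜ[k] TPow.skewDer ξ g n y) =
      _root_.skewDer ξ g (TensorAlgebra.ι k v * TPow.mulToTensorAlgebra n y)
    rw [skewDer_ι_mul, map_add, map_smul, TPow.mulToTensorAlgebra_tmul, h]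

end Maps

end SkewDerivation

/-! ### Quantum symmetrizers of diagonal braidings via skew derivations. -/

section Diagonal

open TensorProduct

variable {k : Type u} [Field k] {V : Type u} [AddCommGroup V] [Module k V]

/-- The operator `id ⊗ 𝔖ₙ` followed by the shuffle, on `V ⊗ V^{⊗ n}`. -/
noncomputable def Braiding.symmetrizerSucc (c : Braiding k V) (n : ℕ) :
    V ⊗[k] TPow k V n →ₗ[k] V ⊗[k] TPow k V n := c.shuffle n ∘ₗ (c.symmetrizer n).lTensor V

variable {θ : ℕ} (x : Module.Basis (Fin θ) k V)

/-- The diagonal endomorphism `x_i ↦ d_i x_i`. -/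
noncomputable def diagMap (d : Fin θ → kˣ) : V →ₗ[k] V := x.constr k fun i => (d i : k) • x i

theorem diagMap_basis (d : Fin θ → kˣ) (i : Fin θ) : diagMap x d (x i) = (d i : k) • x i :=
  x.constr_basis _ _ _

/-- Contraction of the first tensor factor with the `j`-th coordinate. -/
noncomputable def strip (j : Fin θ) (W : Type*) [AddCommGroup W] [Module k W] :
    V ⊗[k] W →ₗ[k] W := (TensorProduct.lid k W).toLinearMap ∘ₗ (x.coord j).rTensor W

theorem strip_tmul (j : Fin θ) {W : Type*} [AddCommGroup W] [Module k W] (v : V) (w : W) :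
    strip x j W (v ⊗ₜ w) = x.coord j v • w := rfl

/-- The contractions recover the tensor: `z = ∑ j, x j ⊗ strip_j z`. -/
theorem eq_zero_of_strip {W : Type*} [AddCommGroup W] [Module k W] (z : V ⊗[k] W)
    (h : ∀ j, strip x j W z = 0) : z = 0 := by
  have : z = ∑ j, x j ⊗ₜ strip x j W z := by
    clear h
    induction z using TensorProduct.induction_on with
    | zero => simp
    | add y z hy hz =>
      conv_lhs => rw [hy, hz]
      simp only [map_add, TensorProduct.tmul_add, Finset.sum_add_distrib]
    | tmul v w =>
      conv_lhs => rw [← x.sum_repr v, TensorProduct.sum_tmul]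
      simp [strip_tmul, TensorProduct.smul_tmul]
  rw [this]
  simp [h]

variable (q : Fin θ → Fin θ → kˣ)

/-- The `j`-th skew derivation of `T(V)`. -/
noncomputable def partialDer (j : Fin θ) : TensorAlgebra k V →ₗ[k] TensorAlgebra k V :=
  skewDer (x.coord j) (diagMap x fun i => q i j)

variable (c : Braiding k V) (hc : ∀ i j, c.c (x i ⊗ₜ x j) = (q i j : k) • (x j ⊗ₜ[k] x i))

include hc

theorem strip_braiding (j : Fin θ) (v w : V) : strip x j V (c.c (v ⊗ₜ w)) =
    x.coord j w • diagMap x (fun i => q i j) v := by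
  suffices TensorProduct.curry (strip x j V ∘ₗ c.c.toLinearMap) =
      (LinearMap.lsmul k V ∘ₗ x.coord j).flip ∘ₗ diagMap x (fun i => q i j) from
    LinearMap.congr_fun₂ this v w
  refine x.ext fun i => x.ext fun l => ?_
  simp only [TensorProduct.curry_apply, LinearMap.comp_apply, LinearEquiv.coe_coe, hc, map_smul,
    strip_tmul, diagMap_basis, LinearMap.flip_apply, LinearMap.lsmul_apply, LinearMap.smul_apply]
  by_cases h : l = j
  · subst h; simp
  · simp [h]

theorem strip_onFirstTwo (j : Fin θ) {W : Type u} [AddCommGroup W] [Module k W] (v : V)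
    (u : V ⊗[k] W) : strip x j (V ⊗[k] W) (onFirstTwo c.c.toLinearMap W (v ⊗ₜ u)) =
      diagMap x (fun i => q i j) v ⊗ₜ strip x j W u := by
  induction u using TensorProduct.induction_on with
  | zero => simp
  | add y z hy hz => simp only [TensorProduct.tmul_add, map_add, hy, hz]
  | tmul w y =>
    have h1 : ∀ t : V ⊗[k] V, strip x j (V ⊗[k] W) (TensorProduct.assoc k V V W (t ⊗ₜ y)) =
        strip x j V t ⊗ₜ y := by
      intro t
      induction t using TensorProduct.induction_on with
      | zero => simp
      | add y z hy hz => simp only [TensorProduct.add_tmul, map_add, hy, hz]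
      | tmul a b => simp [strip_tmul, TensorProduct.smul_tmul']
    simp only [onFirstTwo, LinearMap.comp_apply, LinearEquiv.coe_coe,
      TensorProduct.assoc_symm_tmul, LinearMap.rTensor_tmul, h1]
    rw [strip_braiding x q c hc, strip_tmul, TensorProduct.smul_tmul]

/-- The identity summand of the shuffle contributes the contraction of `v`; in the others the
braiding has moved `v` past the next factor, at the cost of the scaling by column `j` of `q`, before
the contraction takes place. -/
theorem strip_shuffle_succ (j : Fin θ) (n : ℕ) (v : V) (u : V ⊗[k] TPow k V n) :
    strip x j (V ⊗[k] TPow k V n) (c.shuffle (n + 1) (v ⊗ₜ[k] u : V ⊗[k] (V ⊗[k] TPow k V n))) =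
      x.coord j v • u +
        c.shuffle n (diagMap x (fun i => q i j) v ⊗ₜ strip x j (TPow k V n) u) := by
  have h1 : ∀ t : V ⊗[k] (V ⊗[k] TPow k V n), strip x j (V ⊗[k] TPow k V n)
      ((c.shuffle n).lTensor V t) = c.shuffle n (strip x j (V ⊗[k] TPow k V n) t) := by
    intro t
    induction t using TensorProduct.induction_on with
    | zero => simp
    | add y z hy hz => simp only [map_add, hy, hz]
    | tmul a b => simp [strip_tmul]
  change strip x j (V ⊗[k] TPow k V n) (v ⊗ₜ u + (c.shuffle n).lTensor V
    (onFirstTwo c.c.toLinearMap (TPow k V n) (v ⊗ₜ u))) = _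
  rw [map_add, strip_tmul, h1, strip_onFirstTwo x q c hc]

/-- The bridge from symmetrizers to derivations: `𝔖_{n + 1} z` vanishes exactly when `𝔖_n` kills
every `∂_j z`. The recursion of the shuffle reproduces the Leibniz rule. -/
theorem strip_symmetrizerSucc (j : Fin θ) (n : ℕ) (z : V ⊗[k] TPow k V n) :
    strip x j (TPow k V n) (c.symmetrizerSucc n z) =
      c.symmetrizer n (TPow.skewDer (x.coord j) (diagMap x fun i => q i j) n z) := by
  suffices strip x j (TPow k V n) ∘ₗ c.symmetrizerSucc n = c.symmetrizer n ∘ₗ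
    TPow.skewDer (x.coord j) (diagMap x fun i => q i j) n from LinearMap.congr_fun this z
  induction n with
  | zero => exact TensorProduct.ext' fun v r => rfl
  | succ n ih =>
    refine TensorProduct.ext' fun v (u : V ⊗[k] TPow k V n) => ?_
    have h : strip x j (TPow k V n) (c.symmetrizerSucc n u) =
      c.symmetrizer n (TPow.skewDer (x.coord j) (diagMap x fun i => q i j) n u) :=
      LinearMap.congr_fun (ih u) u
    change strip x j (V ⊗[k] TPow k V n) (c.shuffle (n + 1)
      (v ⊗ₜ[k] c.symmetrizerSucc n u : V ⊗[k] (V ⊗[k] TPow k V n))) =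
      c.symmetrizerSucc n (x.coord j v • u + diagMap x (fun i => q i j) v ⊗ₜ[k]
        TPow.skewDer (x.coord j) (diagMap x fun i => q i j) n u)
    rw [strip_shuffle_succ x q c hc, h, map_add, map_smul]
    rfl

end Diagonal

/-! ### The braided coproduct and its descent to the Nichols algebra. -/

section NicholsCoproduct

open TensorProduct

variable {k : Type u} [Field k] {V : Type u} [AddCommGroup V] [Module k V]
variable {θ : ℕ} (x : Module.Basis (Fin θ) k V) (q : Fin θ → Fin θ → kˣ)

/-- The linear form `ε ∂_{j_r} ⋯ ∂_{j_1}` on `T(V)`. -/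
noncomputable def skewEval : List (Fin θ) → (TensorAlgebra k V →ₗ[k] k)
  | [] => TensorAlgebra.algebraMapInv.toLinearMap
  | j :: w => skewEval w ∘ₗ partialDer x q j

theorem skewEval_of_length_ne (w : List (Fin θ)) (n : ℕ) (z : TPow k V n) (h : w.length ≠ n) :
    skewEval x q w (TPow.toTensorAlgebra k V n z) = 0 := by
  induction n generalizing w with
  | zero =>
    change k at z
    change skewEval x q w (algebraMap k _ z) = 0
    cases w with
    | nil => exact absurd rfl h
    | cons j w => rw [skewEval, LinearMap.comp_apply, partialDer, skewDer_algebraMap, map_zero]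
  | succ n ih =>
    cases w with
    | nil => exact NicholsAlgebra.algebraMapInv_toTensorAlgebra_succ n z
    | cons j w =>
      have e := TPow.toTensorAlgebra_skewDer (x.coord j) (diagMap x fun i => q i j) n z
      change skewEval x q w (skewDer _ _ (TPow.mulToTensorAlgebra n z)) = 0
      rw [← e]
      exact ih w _ (fun h' => h (by rw [List.length_cons, h']))

section
variable (c : Braiding k V) (hc : ∀ i j, c.c (x i ⊗ₜ x j) = (q i j : k) • (x j ⊗ₜ[k] x i))
include hc

/-- Iterating the bridge down to degree `0`, a tensor lies in the kernel when all its `n`-fold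
derivatives, which are scalars, vanish. -/
theorem symmetrizer_eq_zero_iff (n : ℕ) (z : TPow k V n) : c.symmetrizer n z = 0 ↔
    ∀ w : List (Fin θ), w.length = n → skewEval x q w (TPow.toTensorAlgebra k V n z) = 0 := by
  induction n with
  | zero =>
    change k at z
    have h0 : c.symmetrizer 0 z = z := rfl
    have h1 : TensorAlgebra.algebraMapInv (algebraMap k (TensorAlgebra k V) z) = z := by simp
    rw [h0]
    constructor
    · intro hz w hw
      rw [List.length_eq_zero_iff.1 hw]
      exact h1.trans hz
    · intro h
      exact h1.symm.trans (h [] rfl)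
  | succ n ih =>
    have key : c.symmetrizer (n + 1) z = 0 ↔ ∀ j, c.symmetrizer n
        (TPow.skewDer (x.coord j) (diagMap x fun i => q i j) n z) = 0 := by
      have e := fun j => strip_symmetrizerSucc x q c hc j n z
      constructor
      · intro h j
        exact (e j).symm.trans ((congrArg _ h).trans (map_zero _))
      · intro h
        exact eq_zero_of_strip x _ fun j => (e j).trans (h j)
    rw [key]
    have e := fun j => TPow.toTensorAlgebra_skewDer (x.coord j) (diagMap x fun i => q i j) n z
    constructor
    · intro h w hw
      cases w with
      | nil => exact absurd hw (by simp)
      | cons j w =>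
        have := (ih _).1 (h j) w (by simpa using hw)
        rw [e] at this
        exact this
    · intro h j
      refine (ih _).2 fun w hw => ?_
      rw [e]
      exact h (j :: w) (by rw [List.length_cons, hw])

theorem skewEval_of_symmetrizer_eq_zero (n : ℕ) (z : TPow k V n) (hz : c.symmetrizer n z = 0)
    (w : List (Fin θ)) : skewEval x q w (TPow.toTensorAlgebra k V n z) = 0 := by
  by_cases h : w.length = n
  · exact (symmetrizer_eq_zero_iff x q c hc n z).1 hz w h
  · exact skewEval_of_length_ne x q w n z h

/-- A linear map on `T(V)` that vanishes on the kernels of the quantum symmetrizers vanishes on the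
common kernel of the forms `skewEval`. -/
theorem eq_zero_of_skewEval {M : Type*} [AddCommGroup M] [Module k M]
    (f : TensorAlgebra k V →ₗ[k] M)
    (hf : ∀ (n : ℕ) (z : TPow k V n), c.symmetrizer n z = 0 →
      f (TPow.toTensorAlgebra k V n z) = 0) (t : TensorAlgebra k V)
    (ht : ∀ w, skewEval x q w t = 0) : f t = 0 := by
  -- A word of length `n` sees only the component of degree `n`, so the hypothesis holds for each
  -- homogeneous component separately.
  obtain ⟨s, z, rfl⟩ := TPow.exists_sum_toTensorAlgebra t
  rw [map_sum]
  refine Finset.sum_eq_zero fun n hn => hf n _ ?_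
  refine (symmetrizer_eq_zero_iff x q c hc n _).2 fun w hw => ?_
  have := ht w
  rw [map_sum, Finset.sum_eq_single n] at this
  · exact this
  · intro m _ hm
    exact skewEval_of_length_ne x q w m _ (fun h => hm (h.symm.trans hw))
  · exact fun h => absurd hn h

end

/-- Multiplication by `v` in the braided tensor product `T(V) ⊗ T(V)`, for the element
`v ⊗ 1 + 1 ⊗ v`. -/
noncomputable def coprodOp :
    V →ₗ[k] Module.End k (TensorAlgebra k V ⊗[k] TensorAlgebra k V) where
  toFun v := (LinearMap.mulLeft k (TensorAlgebra.ι k v)).rTensor _ +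
    ∑ i, x.coord i v • TensorProduct.map (TensorAlgebra.mapEnd (diagMap x (q i))).toLinearMap
      (LinearMap.mulLeft k (TensorAlgebra.ι k (x i)))
  map_add' v w := by
    have : LinearMap.mulLeft k (TensorAlgebra.ι k (v + w)) =
        LinearMap.mulLeft k (TensorAlgebra.ι k v) + LinearMap.mulLeft k (TensorAlgebra.ι k w) := by
      ext; simp [add_mul]
    rw [this, LinearMap.rTensor_add]
    simp only [map_add, add_smul, Finset.sum_add_distrib]
    abel
  map_smul' r v := by
    have : LinearMap.mulLeft k (TensorAlgebra.ι k (r • v)) =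
        r • LinearMap.mulLeft k (TensorAlgebra.ι k v) := by
      ext; simp
    rw [this, LinearMap.rTensor_smul]
    simp only [map_smul, smul_add, Finset.smul_sum, smul_smul, smul_eq_mul, RingHom.id_apply]

theorem coprodOp_tmul (v : V) (s t : TensorAlgebra k V) :
    coprodOp x q v (s ⊗ₜ t) = (TensorAlgebra.ι k v * s) ⊗ₜ t +
      ∑ i, x.coord i v • (TensorAlgebra.mapEnd (diagMap x (q i)) s ⊗ₜ[k]
        (TensorAlgebra.ι k (x i) * t)) := by
  simp [coprodOp]

theorem coprodOp_basis_tmul (i : Fin θ) (s t : TensorAlgebra k V) :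
    coprodOp x q (x i) (s ⊗ₜ t) = (TensorAlgebra.ι k (x i) * s) ⊗ₜ t +
      TensorAlgebra.mapEnd (diagMap x (q i)) s ⊗ₜ[k] (TensorAlgebra.ι k (x i) * t) := by
  rw [coprodOp_tmul, Finset.sum_eq_single i]
  · simp
  · intro j _ hj; simp [hj.symm]
  · simp

/-- The braided coproduct of `T(V)`. -/
noncomputable def coprod : TensorAlgebra k V →ₗ[k] TensorAlgebra k V ⊗[k] TensorAlgebra k V :=
  LinearMap.applyₗ (1 ⊗ₜ 1) ∘ₗ (TensorAlgebra.lift k (coprodOp x q)).toLinearMap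

theorem coprod_one : coprod x q 1 = 1 ⊗ₜ 1 := by simp [coprod]

theorem coprod_ι_mul (v : V) (t : TensorAlgebra k V) :
    coprod x q (TensorAlgebra.ι k v * t) = coprodOp x q v (coprod x q t) := by
  simp [coprod]

/-- Two linear maps on the tensor algebra agree if they agree on `1` and their agreement on `t`
implies that on `x_i t`. -/
theorem TensorAlgebra.linearMap_ext_basis {M : Type*} [AddCommGroup M] [Module k M]
    {f g : TensorAlgebra k V →ₗ[k] M} (h1 : f 1 = g 1)
    (h2 : ∀ i t, f t = g t → f (TensorAlgebra.ι k (x i) * t) = g (TensorAlgebra.ι k (x i) * t)) :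
    f = g := by
  refine TensorAlgebra.linearMap_ext_left h1 fun v t ht => ?_
  have := x.ext (f₁ := f ∘ₗ (LinearMap.mul k _).flip t ∘ₗ TensorAlgebra.ι k)
    (f₂ := g ∘ₗ (LinearMap.mul k _).flip t ∘ₗ TensorAlgebra.ι k) fun i => by
      simpa using h2 i t ht
  simpa using LinearMap.congr_fun this v

theorem partialDer_ι_mul (j i : Fin θ) (t : TensorAlgebra k V) :
    partialDer x q j (TensorAlgebra.ι k (x i) * t) =
      (if i = j then t else 0) + (q i j : k) • (TensorAlgebra.ι k (x i) * partialDer x q j t) := by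
  rw [partialDer, skewDer_ι_mul, diagMap_basis, map_smul, smul_mul_assoc]
  congr 1
  by_cases h : i = j <;> simp [h]

theorem partialDer_mapEnd (j : Fin θ) (d : Fin θ → kˣ) (t : TensorAlgebra k V) :
    partialDer x q j (TensorAlgebra.mapEnd (diagMap x d) t) =
      (d j : k) • TensorAlgebra.mapEnd (diagMap x d) (partialDer x q j t) := by
  suffices partialDer x q j ∘ₗ (TensorAlgebra.mapEnd (diagMap x d)).toLinearMap =
    (d j : k) • ((TensorAlgebra.mapEnd (diagMap x d)).toLinearMap ∘ₗ partialDer x q j) from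
    LinearMap.congr_fun this t
  refine TensorAlgebra.linearMap_ext_basis x ?_ fun i t ht => ?_
  · simp [partialDer, skewDer_one]
  · simp only [LinearMap.comp_apply, AlgHom.toLinearMap_apply, LinearMap.smul_apply, map_mul,
      TensorAlgebra.mapEnd_ι, diagMap_basis, map_smul, smul_mul_assoc, partialDer_ι_mul, map_add]
      at ht ⊢
    rw [ht]
    by_cases h : i = j
    · subst h
      simp only [if_true, smul_add, mul_smul_comm, smul_smul]
    · simp only [h, if_false, map_zero, zero_add, mul_smul_comm, smul_smul]
      congr 1; ring

/-- Both sides obey the same recursion on `x_i t`: in the summand where `x_i` enters the second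
factor, the factor `q_ij` arises from commuting `∂_j` past the scaling by row `i`. -/
theorem partialDer_rTensor_coprod (j : Fin θ) (t : TensorAlgebra k V) :
    (partialDer x q j).rTensor _ (coprod x q t) = coprod x q (partialDer x q j t) := by
  suffices (partialDer x q j).rTensor _ ∘ₗ coprod x q = coprod x q ∘ₗ partialDer x q j from
    LinearMap.congr_fun this t
  refine TensorAlgebra.linearMap_ext_basis x ?_ fun i t ht => ?_
  · simp [coprod_one, partialDer, skewDer_one]
  · simp only [LinearMap.comp_apply, coprod_ι_mul, partialDer_ι_mul, map_add, map_smul] at ht ⊢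
    rw [← ht]
    have h0 : coprod x q (if i = j then t else 0) = if i = j then coprod x q t else 0 := by
      split_ifs <;> simp
    rw [h0]
    generalize coprod x q t = u
    have : (partialDer x q j).rTensor (TensorAlgebra k V) (coprodOp x q (x i) u) =
        (if i = j then u else 0) +
          (q i j : k) • coprodOp x q (x i) ((partialDer x q j).rTensor _ u) := by
      induction u using TensorProduct.induction_on with
      | zero => simp
      | add y z hy hz =>
        simp only [map_add, hy, hz, smul_add]
        split_ifs <;> abel
      | tmul s s' =>
        simp only [coprodOp_basis_tmul, map_add, LinearMap.rTensor_tmul, partialDer_ι_mul,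
          partialDer_mapEnd, TensorProduct.add_tmul, TensorProduct.smul_tmul', smul_add]
        split_ifs <;> simp [add_assoc]
    rw [this]

theorem counit_rTensor_coprod (t : TensorAlgebra k V) :
    TensorProduct.lid k _ ((TensorAlgebra.algebraMapInv.toLinearMap).rTensor _ (coprod x q t)) =
      t := by
  suffices (TensorProduct.lid k _).toLinearMap ∘ₗ
      (TensorAlgebra.algebraMapInv.toLinearMap).rTensor _ ∘ₗ coprod x q = LinearMap.id from
    LinearMap.congr_fun this t
  have h0 : ∀ d (s : TensorAlgebra k V), TensorAlgebra.algebraMapInv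
      (TensorAlgebra.mapEnd (diagMap x d) s) = TensorAlgebra.algebraMapInv s := by
    intro d s
    suffices TensorAlgebra.algebraMapInv.comp (TensorAlgebra.mapEnd (diagMap x d)) =
      TensorAlgebra.algebraMapInv from AlgHom.congr_fun this s
    ext v
    simp [TensorAlgebra.algebraMapInv, TensorAlgebra.mapEnd]
  refine TensorAlgebra.linearMap_ext_basis x ?_ fun i t ht => ?_
  · simp [coprod_one]
  · simp only [LinearMap.comp_apply, coprod_ι_mul, LinearEquiv.coe_coe, LinearMap.id_apply] at ht ⊢
    conv_rhs => rw [← ht]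
    generalize coprod x q t = u
    induction u using TensorProduct.induction_on with
    | zero => simp
    | add y z hy hz => simp only [map_add, hy, hz, mul_add]
    | tmul s s' =>
      have h1 : TensorAlgebra.algebraMapInv (TensorAlgebra.ι k (x i)) = (0 : k) := by
        simp [TensorAlgebra.algebraMapInv]
      simp only [coprodOp_basis_tmul, map_add, LinearMap.rTensor_tmul, AlgHom.toLinearMap_apply,
        map_mul, h1, h0, zero_mul, TensorProduct.zero_tmul, zero_add,
        TensorProduct.lid_tmul, mul_smul_comm]

/-- Applying the form of `w` to the first leg of the coproduct is differentiating `t` along `w`.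
Hence the common kernel of these forms is a coideal. -/
theorem skewEval_rTensor_coprod (w : List (Fin θ)) (t : TensorAlgebra k V)
    (ht : ∀ w, skewEval x q w t = 0) (w' : List (Fin θ)) :
    skewEval x q w' (TensorProduct.lid k _ ((skewEval x q w).rTensor _ (coprod x q t))) = 0 := by
  induction w generalizing t with
  | nil => rw [skewEval, counit_rTensor_coprod]; exact ht w'
  | cons j w ih =>
    rw [skewEval, LinearMap.rTensor_comp, LinearMap.comp_apply, partialDer_rTensor_coprod]
    exact ih _ fun w => ht (j :: w)

/-- An element of `Q ⊗ Q` is zero if it is killed by the tensor products of the elements of a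
family of linear forms that separates points. -/
theorem TensorProduct.eq_zero_of_separating {Q : Type*} [AddCommGroup Q] [Module k Q] {I : Type*}
    (f : I → Q →ₗ[k] k) (hf : ∀ a, (∀ i, f i a = 0) → a = 0) (y : Q ⊗[k] Q)
    (hy : ∀ i j, f j (TensorProduct.lid k Q ((f i).rTensor Q y)) = 0) : y = 0 := by
  classical
  let b := Module.Basis.ofVectorSpace k Q
  have h1 : ∀ i, (f i).rTensor Q y = 0 := fun i =>
    (TensorProduct.lid k Q).map_eq_zero_iff.1 (hf _ (hy i))
  refine (TensorProduct.equivFinsuppOfBasisRight (M := Q) b).map_eq_zero_iff.1 ?_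
  ext l
  refine hf _ fun i => ?_
  have h2 : ∀ y : Q ⊗[k] Q, TensorProduct.equivFinsuppOfBasisRight b ((f i).rTensor Q y) l =
      f i (TensorProduct.equivFinsuppOfBasisRight b y l) := by
    intro y
    induction y using TensorProduct.induction_on with
    | zero => simp
    | add y z hy hz => simp only [map_add, Finsupp.add_apply, hy, hz]
    | tmul s s' => simp
  rw [← h2, h1]
  simp

variable {E : Type*} [Ring E] [Algebra k E] (a b : V →ₗ[k] E)

theorem lift_mapEnd_mul (i : Fin θ)
    (hab : ∀ j, b (x i) * a (x j) = (q i j : k) • (a (x j) * b (x i))) (s : TensorAlgebra k V) :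
    TensorAlgebra.lift k a (TensorAlgebra.mapEnd (diagMap x (q i)) s) * b (x i) =
      b (x i) * TensorAlgebra.lift k a s := by
  suffices LinearMap.mulRight k (b (x i)) ∘ₗ (TensorAlgebra.lift k a).toLinearMap ∘ₗ
      (TensorAlgebra.mapEnd (diagMap x (q i))).toLinearMap =
      LinearMap.mulLeft k (b (x i)) ∘ₗ (TensorAlgebra.lift k a).toLinearMap from
    LinearMap.congr_fun this s
  refine TensorAlgebra.linearMap_ext_basis x ?_ fun j t ht => ?_
  · simp
  · simp only [LinearMap.comp_apply, AlgHom.toLinearMap_apply, LinearMap.mulRight_apply,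
      LinearMap.mulLeft_apply, map_mul, TensorAlgebra.mapEnd_ι, diagMap_basis, map_smul,
      TensorAlgebra.lift_ι_apply] at ht ⊢
    rw [mul_assoc, ht, ← mul_assoc, ← mul_assoc, hab, smul_mul_assoc]

/-- The commutation hypothesis says that `s ⊗ t ↦ a(s) b(t)` is multiplicative for the braided
product on `T(V) ⊗ T(V)`, in which the coproduct is generated by `v ⊗ 1 + 1 ⊗ v`. -/
theorem lift_add_eq (hab : ∀ i j, b (x i) * a (x j) = (q i j : k) • (a (x j) * b (x i)))
    (t : TensorAlgebra k V) : TensorAlgebra.lift k (a + b) t =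
      LinearMap.mul' k E (TensorProduct.map (TensorAlgebra.lift k a).toLinearMap
        (TensorAlgebra.lift k b).toLinearMap (coprod x q t)) := by
  suffices (TensorAlgebra.lift k (a + b)).toLinearMap = LinearMap.mul' k E ∘ₗ
      TensorProduct.map (TensorAlgebra.lift k a).toLinearMap
        (TensorAlgebra.lift k b).toLinearMap ∘ₗ coprod x q from LinearMap.congr_fun this t
  refine TensorAlgebra.linearMap_ext_basis x ?_ fun j t ht => ?_
  · simp [coprod_one]
  · simp only [LinearMap.comp_apply, AlgHom.toLinearMap_apply, map_mul, coprod_ι_mul,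
      TensorAlgebra.lift_ι_apply] at ht ⊢
    rw [ht]
    generalize coprod x q t = u
    induction u using TensorProduct.induction_on with
    | zero => simp
    | add y z hy hz => simp only [map_add, mul_add, hy, hz]
    | tmul s s' =>
      simp only [coprodOp_basis_tmul, map_add, TensorProduct.map_tmul, AlgHom.toLinearMap_apply,
        map_mul, LinearMap.mul'_apply, TensorAlgebra.lift_ι_apply, LinearMap.add_apply]
      rw [← mul_assoc _ (b (x j)), lift_mapEnd_mul x q a b j (hab j), add_mul]
      simp only [mul_assoc]

/-- If the algebra maps on `T(V)` induced by `a` and `b` factor over the Nichols algebra and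
`b(x_i) a(x_j) = q_{ij} a(x_j) b(x_i)`, then so does the one induced by `a + b`. -/
theorem lift_add_toTensorAlgebra_eq_zero (c : Braiding k V)
    (hc : ∀ i j, c.c (x i ⊗ₜ x j) = (q i j : k) • (x j ⊗ₜ[k] x i))
    (ha : ∀ (n : ℕ) (z : TPow k V n), c.symmetrizer n z = 0 →
      TensorAlgebra.lift k a (TPow.toTensorAlgebra k V n z) = 0)
    (hb : ∀ (n : ℕ) (z : TPow k V n), c.symmetrizer n z = 0 →
      TensorAlgebra.lift k b (TPow.toTensorAlgebra k V n z) = 0)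
    (hab : ∀ i j, b (x i) * a (x j) = (q i j : k) • (a (x j) * b (x i)))
    (n : ℕ) (z : TPow k V n) (hz : c.symmetrizer n z = 0) :
    TensorAlgebra.lift k (a + b) (TPow.toTensorAlgebra k V n z) = 0 := by
  rw [lift_add_eq x q a b hab]
  have ht := skewEval_of_symmetrizer_eq_zero x q c hc n z hz
  generalize TPow.toTensorAlgebra k V n z = t at ht
  let J : Submodule k (TensorAlgebra k V) := ⨅ w, LinearMap.ker (skewEval x q w)
  have hJ : ∀ {s}, s ∈ J ↔ ∀ w, skewEval x q w s = 0 := by simp [J]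
  have hle : ∀ f : V →ₗ[k] E, (∀ (n : ℕ) (z : TPow k V n), c.symmetrizer n z = 0 →
      TensorAlgebra.lift k f (TPow.toTensorAlgebra k V n z) = 0) →
      J ≤ LinearMap.ker (TensorAlgebra.lift k f).toLinearMap := fun f hf s hs =>
    eq_zero_of_skewEval x q c hc _ hf s (hJ.1 hs)
  -- The forms `skewEval` separate the points of `T(V) / J`, so the coideal property can be tested
  -- by pairs of words.
  have h0 : TensorProduct.map J.mkQ J.mkQ (coprod x q t) = 0 := by
    refine TensorProduct.eq_zero_of_separating
      (fun w => J.liftQ (skewEval x q w) (iInf_le _ w)) (fun s hs => ?_) _ (fun w w' => ?_)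
    · obtain ⟨s, rfl⟩ := J.mkQ_surjective s
      exact (Submodule.Quotient.mk_eq_zero J).2 (hJ.2 fun w => hs w)
    · rw [← skewEval_rTensor_coprod x q w t ht w']
      generalize coprod x q t = u
      induction u using TensorProduct.induction_on with
      | zero => simp
      | add y z hy hz => simp only [map_add, hy, hz]
      | tmul s s' => simp
  have h1 : TensorProduct.map (TensorAlgebra.lift k a).toLinearMap
      (TensorAlgebra.lift k b).toLinearMap = TensorProduct.map (J.liftQ _ (hle a ha))
        (J.liftQ _ (hle b hb)) ∘ₗ TensorProduct.map J.mkQ J.mkQ := by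
    rw [← TensorProduct.map_comp]; rfl
  rw [h1, LinearMap.comp_apply, h0, map_zero, map_zero]

end NicholsCoproduct

/-! ### Eigenvector decomposition for finite commutative groups. -/

section Eigenvectors

theorem sum_characters_eq_zero {k D : Type*} [Field k] [IsAlgClosed k] [CharZero k] [CommGroup D]
    [Finite D] [Fintype (D →* kˣ)] {d : D} (hd : d ≠ 1) :
    ∑ χ : D →* kˣ, (χ d : k) = 0 := by
  have : NeZero (Monoid.exponent D) := ⟨Monoid.exponent_ne_zero_of_finite⟩
  obtain ⟨φ, hφ⟩ := CommGroup.exists_apply_ne_one_of_hasEnoughRootsOfUnity D k hd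
  have h : (φ d : k) * ∑ χ : D →* kˣ, (χ d : k) = ∑ χ : D →* kˣ, (χ d : k) := by
    rw [Finset.mul_sum]
    exact Fintype.sum_equiv (Equiv.mulLeft φ) _ _ fun χ => by simp
  have h' : ((φ d : k) - 1) * ∑ χ : D →* kˣ, (χ d : k) = 0 := by rw [sub_mul, h, one_mul, sub_self]
  refine (mul_eq_zero.1 h').resolve_left fun h0 => hφ ?_
  ext
  exact sub_eq_zero.1 h0

/-- In a representation of a finite commutative group over an algebraically closed field of
characteristic zero, each vector is a sum of common eigenvectors. -/
theorem mem_closure_eigenvectors {k D W : Type*} [Field k] [IsAlgClosed k] [CharZero k]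
    [CommGroup D] [Finite D] [AddCommGroup W] [Module k W] (σ : D →* Module.End k W) (v : W) :
    v ∈ AddSubmonoid.closure {w : W | ∃ χ : D →* kˣ, ∀ d, σ d w = (χ d : k) • w} := by
  have : NeZero (Monoid.exponent D) := ⟨Monoid.exponent_ne_zero_of_finite⟩
  have : Finite (D →* kˣ) := Nat.finite_of_card_ne_zero (by
    rw [CommGroup.card_monoidHom_of_hasEnoughRootsOfUnity]; exact Nat.card_pos.ne')
  have := Fintype.ofFinite (D →* kˣ)
  have := Fintype.ofFinite D
  classical
  have hcard : (Fintype.card (D →* kˣ) : k) ≠ 0 := Nat.cast_ne_zero.2 Fintype.card_ne_zero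
  -- The summand at `χ` is the projection to its eigenspace, normalized by the number of characters;
  -- orthogonality leaves only `d = 1`.
  have hv : v = ∑ χ : D →* kˣ, (Fintype.card (D →* kˣ) : k)⁻¹ • ∑ d, ((χ d)⁻¹ : kˣ) • σ d v := by
    rw [← Finset.smul_sum, Finset.sum_comm]
    have : ∀ d, ∑ χ : D →* kˣ, ((χ d)⁻¹ : kˣ) • σ d v =
        if d = 1 then (Fintype.card (D →* kˣ) : k) • v else 0 := by
      intro d
      have e : ∀ χ : D →* kˣ, ((χ d)⁻¹ : kˣ) • σ d v = (χ d⁻¹ : k) • σ d v := fun χ => by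
        rw [map_inv]; rfl
      simp only [e]
      rw [← Finset.sum_smul]
      split_ifs with h
      · subst h; simp
      · rw [sum_characters_eq_zero (inv_ne_one.2 h), zero_smul]
    rw [Finset.sum_congr rfl fun d _ => this d]
    simp [hcard]
  rw [hv]
  refine sum_mem fun χ _ => AddSubmonoid.subset_closure ⟨χ, fun d => ?_⟩
  rw [map_smul, smul_comm]
  congr 1
  rw [map_sum, Finset.smul_sum]
  refine Fintype.sum_equiv (Equiv.mulLeft d) _ _ fun d' => ?_
  rw [Equiv.coe_mulLeft, map_mul σ, Module.End.mul_apply, Units.smul_def, Units.smul_def, map_smul,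
    smul_smul, map_mul χ, mul_inv, Units.val_mul, Units.mul_inv_cancel_left]

end Eigenvectors

/-! ### Scalings of the basis as automorphisms of the Nichols algebra. -/

section DiagonalAutomorphisms

open TensorProduct

variable {k : Type u} [Field k] {V : Type u} [AddCommGroup V] [Module k V]
variable {θ : ℕ} (x : Module.Basis (Fin θ) k V) (q : Fin θ → Fin θ → kˣ)
  (c : Braiding k V) (hc : ∀ i j, c.c (x i ⊗ₜ x j) = (q i j : k) • (x j ⊗ₜ[k] x i))

/-- Scalings commute with each `∂_j` up to a scalar and preserve the augmentation, so they preserve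
the common kernel. -/
theorem skewEval_mapEnd (d : Fin θ → kˣ) (w : List (Fin θ)) (t : TensorAlgebra k V)
    (ht : ∀ w, skewEval x q w t = 0) :
    skewEval x q w (TensorAlgebra.mapEnd (diagMap x d) t) = 0 := by
  induction w generalizing t with
  | nil =>
    have : TensorAlgebra.algebraMapInv.comp (TensorAlgebra.mapEnd (diagMap x d)) =
      (TensorAlgebra.algebraMapInv : TensorAlgebra k V →ₐ[k] k) := by
      ext v
      simp [TensorAlgebra.algebraMapInv, TensorAlgebra.mapEnd]
    exact (AlgHom.congr_fun this t).trans (ht [])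
  | cons j w ih =>
    rw [skewEval, LinearMap.comp_apply, partialDer_mapEnd, map_smul,
      ih _ fun w => ht (j :: w), smul_zero]

/-- Two linear maps on the Nichols algebra agree if they agree on `1` and their agreement on `r`
implies that on `x_i r`. -/
theorem NicholsAlgebra.linearMap_ext_basis {M : Type*} [AddCommGroup M] [Module k M]
    {f g : NicholsAlgebra c →ₗ[k] M} (h1 : f 1 = g 1)
    (h2 : ∀ i r, f r = g r → f (ι c (x i) * r) = g (ι c (x i) * r)) : f = g := by
  have : f ∘ₗ (mk c).toLinearMap = g ∘ₗ (mk c).toLinearMap :=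
    TensorAlgebra.linearMap_ext_basis x (by simpa using h1) fun i t ht => by
      have := h2 i (mk c t) (by simpa using ht)
      simpa [ι] using this
  ext r
  obtain ⟨t, rfl⟩ := mk_surjective c r
  exact LinearMap.congr_fun this t

theorem NicholsAlgebra.algHom_ext_basis {B : Type*} [Ring B] [Algebra k B]
    {f g : NicholsAlgebra c →ₐ[k] B} (h : ∀ i, f (ι c (x i)) = g (ι c (x i))) : f = g := by
  have : f.toLinearMap = g.toLinearMap := linearMap_ext_basis x c (by simp) fun i r hr => by
    simp only [AlgHom.toLinearMap_apply, map_mul, h] at hr ⊢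
    rw [hr]
  ext r
  exact LinearMap.congr_fun this r

/-- The diagonal automorphism `x_i ↦ d_i x_i` of the Nichols algebra. -/
noncomputable def NicholsAlgebra.diag (d : Fin θ → kˣ) : NicholsAlgebra c →ₐ[k] NicholsAlgebra c :=
  lift c ((mk c).comp (TensorAlgebra.mapEnd (diagMap x d))) fun n z hz =>
    eq_zero_of_skewEval x q c hc (mk c).toLinearMap (fun n z hz => mk_eq_zero c n z hz) _
      fun w => skewEval_mapEnd x q d w _ (skewEval_of_symmetrizer_eq_zero x q c hc n z hz)

theorem NicholsAlgebra.diag_ι (d : Fin θ → kˣ) (i : Fin θ) :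
    diag x q c hc d (ι c (x i)) = (d i : k) • ι c (x i) := by
  refine (lift_mk c _ _ _).trans ?_
  rw [AlgHom.comp_apply, TensorAlgebra.mapEnd_ι, diagMap_basis, map_smul, map_smul]
  rfl

theorem NicholsAlgebra.diag_one : diag x q c hc 1 = AlgHom.id k _ :=
  algHom_ext_basis x c fun i => by rw [diag_ι]; simp

theorem NicholsAlgebra.diag_mul (d d' : Fin θ → kˣ) :
    diag x q c hc (d * d') = (diag x q c hc d).comp (diag x q c hc d') :=
  algHom_ext_basis x c fun i => by
    rw [diag_ι, AlgHom.comp_apply, diag_ι, map_smul, diag_ι, smul_smul, Pi.mul_apply, mul_comm,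
      Units.val_mul]

theorem NicholsAlgebra.aug_comp_diag (d : Fin θ → kˣ) : (aug c).comp (diag x q c hc d) = aug c :=
  algHom_ext_basis x c fun i => by
    rw [AlgHom.comp_apply, diag_ι, map_smul, aug_ι, smul_zero]

end DiagonalAutomorphisms

/-! ### Equivariant modules and the exact functor `X ⊗ -`. -/

section Equivariant

open TensorProduct CategoryTheory
open scoped ModuleCat

variable {k : Type u} [Field k] {V : Type u} [AddCommGroup V] [Module k V]

/-- A basis diagonalizing a braiding, with a group `D` of scalings of the basis vectors that contains
those by the rows of the braiding matrix. -/
structure Braiding.DiagonalDatum (c : Braiding k V) where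
  /-- the rank -/
  θ : ℕ
  /-- the basis -/
  x : Module.Basis (Fin θ) k V
  /-- the braiding matrix -/
  q : Fin θ → Fin θ → kˣ
  braiding_eq : ∀ i j, c.c (x i ⊗ₜ x j) = (q i j : k) • (x j ⊗ₜ[k] x i)
  /-- the group of scalings -/
  D : Subgroup (Fin θ → kˣ)
  mem : ∀ i, q i ∈ D

namespace Braiding.DiagonalDatum

variable {c : Braiding k V} (B : c.DiagonalDatum)

/-- The generators of the Nichols algebra. -/
noncomputable def gen (i : Fin B.θ) : NicholsAlgebra c := NicholsAlgebra.ι c (B.x i)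

/-- The diagonal automorphisms of the Nichols algebra. -/
noncomputable def diag (d : Fin B.θ → kˣ) : NicholsAlgebra c →ₐ[k] NicholsAlgebra c :=
  NicholsAlgebra.diag B.x B.q c B.braiding_eq d

theorem diag_gen (d : Fin B.θ → kˣ) (i : Fin B.θ) : B.diag d (B.gen i) = (d i : k) • B.gen i :=
  NicholsAlgebra.diag_ι B.x B.q c B.braiding_eq d i

theorem diag_one : B.diag 1 = AlgHom.id k _ := NicholsAlgebra.diag_one B.x B.q c B.braiding_eq

theorem diag_mul (d d' : Fin B.θ → kˣ) : B.diag (d * d') = (B.diag d).comp (B.diag d') :=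
  NicholsAlgebra.diag_mul B.x B.q c B.braiding_eq d d'

theorem aug_diag (d : Fin B.θ → kˣ) (r : NicholsAlgebra c) :
    NicholsAlgebra.aug c (B.diag d r) = NicholsAlgebra.aug c r :=
  AlgHom.congr_fun (NicholsAlgebra.aug_comp_diag B.x B.q c B.braiding_eq d) r

theorem aug_gen (i : Fin B.θ) : NicholsAlgebra.aug c (B.gen i) = 0 := NicholsAlgebra.aug_ι c _

/-- The row of the braiding matrix, as an element of `D`. -/
def row (i : Fin B.θ) : B.D := ⟨B.q i, B.mem i⟩

/-- A `D`-action on an `R`-module, semilinear for the diagonal automorphisms of `R`. -/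
structure Equivariant (X : ModuleCat.{u} (NicholsAlgebra c)) where
  /-- the action -/
  act : B.D →* AddMonoid.End X
  act_smul : ∀ (d : B.D) (r : NicholsAlgebra c) (x : X), act d (r • x) = B.diag d r • act d x

theorem _root_.ModuleCat.smul_eq_algebraMap_smul {A : Type u} [Ring A] [Algebra k A]
    (X : ModuleCat.{u} A) (r : k) (x : X) : r • x = algebraMap k A r • x := rfl

/-- An additive map that commutes with the scalars and the generators `x_i` is a morphism. -/
noncomputable def homOfGen {X Y : ModuleCat.{u} (NicholsAlgebra c)} (f : X →+ Y)
    (h1 : ∀ (r : k) (x : X), f (algebraMap k (NicholsAlgebra c) r • x) =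
      algebraMap k (NicholsAlgebra c) r • f x)
    (h2 : ∀ i (x : X), f (B.gen i • x) = B.gen i • f x) : X ⟶ Y :=
  ModuleCat.ofHom
    { f with
      map_smul' := fun r x => by
        let f' : X →ₗ[k] Y := { f with map_smul' := h1 }
        let F : NicholsAlgebra c →ₗ[k] X →ₗ[k] Y :=
          (LinearMap.llcomp k X X Y f') ∘ₗ (Algebra.lsmul k k X).toLinearMap
        let G : NicholsAlgebra c →ₗ[k] X →ₗ[k] Y :=
          (LinearMap.llcomp k X Y Y).flip f' ∘ₗ (Algebra.lsmul k k Y).toLinearMap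
        have h : F = G := NicholsAlgebra.linearMap_ext_basis B.x c
          (LinearMap.ext fun x => by
            change f ((1 : NicholsAlgebra c) • x) = (1 : NicholsAlgebra c) • f x
            rw [one_smul, one_smul]) fun i r h => LinearMap.ext fun x => by
            have h' : f (r • x) = r • f x := LinearMap.congr_fun h x
            change f ((B.gen i * r) • x) = (B.gen i * r) • f x
            rw [mul_smul, mul_smul, h2, h']
        exact LinearMap.congr_fun₂ h r x }

variable {B}

namespace Equivariant

section
variable {X : ModuleCat.{u} (NicholsAlgebra c)} (E : B.Equivariant X)

/-- The action of an element of `D`, as a `k`-linear map. -/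
noncomputable def lin : B.D →* Module.End k X where
  toFun d := { E.act d with
    map_smul' := fun r x => by
      change E.act d (r • x) = r • E.act d x
      rw [ModuleCat.smul_eq_algebraMap_smul, E.act_smul, AlgHom.commutes]
      rfl }
  map_one' := by ext x; change E.act 1 x = x; rw [map_one]; rfl
  map_mul' d d' := by ext x; change E.act (d * d') x = _; rw [map_mul]; rfl

variable (Y : ModuleCat.{u} (NicholsAlgebra c))

/-- The operators `x_i ⊗ 1` on `X ⊗ Y`. -/
noncomputable def opLeft : V →ₗ[k] Module.End k (X ⊗[k] Y) :=
  ((Module.End.rTensorAlgHom k X Y).comp (Algebra.lsmul k k X)).toLinearMap ∘ₗ NicholsAlgebra.ι c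

/-- The operators `g_i ⊗ x_i` on `X ⊗ Y`. -/
noncomputable def opRight : V →ₗ[k] Module.End k (X ⊗[k] Y) :=
  B.x.constr k fun i => TensorProduct.map (E.lin (B.row i)) (Algebra.lsmul k k Y (B.gen i))

theorem opLeft_tmul (i : Fin B.θ) (x : X) (y : Y) :
    opLeft Y (B.x i) (x ⊗ₜ y) = (B.gen i • x) ⊗ₜ[k] y := rfl

theorem opRight_tmul (i : Fin B.θ) (x : X) (y : Y) :
    E.opRight Y (B.x i) (x ⊗ₜ y) = E.act (B.row i) x ⊗ₜ[k] (B.gen i • y) := by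
  rw [opRight, Module.Basis.constr_basis]
  rfl

theorem lift_opLeft (n : ℕ) (z : TPow k V n) (hz : c.symmetrizer n z = 0) :
    TensorAlgebra.lift k (opLeft (X := X) Y) (TPow.toTensorAlgebra k V n z) = 0 := by
  have : TensorAlgebra.lift k (opLeft (X := X) Y) = ((Module.End.rTensorAlgHom k X Y).comp
      (Algebra.lsmul k k X)).comp (NicholsAlgebra.mk c) := by
    refine TensorAlgebra.hom_ext (LinearMap.ext fun v => ?_)
    simp only [LinearMap.comp_apply, AlgHom.toLinearMap_apply, TensorAlgebra.lift_ι_apply]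
    rfl
  rw [this, AlgHom.comp_apply, NicholsAlgebra.mk_eq_zero c n z hz, map_zero]

variable [IsAlgClosed k] [CharZero k] [Finite B.D]

theorem mem_closure_eigenvectors (x : X) : x ∈ AddSubmonoid.closure
    {x : X | ∃ χ : B.D →* kˣ, ∀ d, E.act d x = (χ d : k) • x} :=
  _root_.mem_closure_eigenvectors E.lin x

-- On an eigenvector `x` the operators `g_i ⊗ x_i` act only on `y`, through the algebra automorphism
-- scaling `x_i` by `χ(g_i)`; this factors over the Nichols algebra.
omit [IsAlgClosed k] [CharZero k] [Finite B.D] in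
theorem lift_opRight_eigenvector (χ : B.D →* kˣ) (x : X) (hx : ∀ d, E.act d x = (χ d : k) • x)
    (t : TensorAlgebra k V) (y : Y) : TensorAlgebra.lift k (E.opRight Y) t (x ⊗ₜ y) =
      x ⊗ₜ[k] (B.diag (fun i => χ (B.row i)) (NicholsAlgebra.mk c t) • y) := by
  let F : TensorAlgebra k V →ₗ[k] Y →ₗ[k] X ⊗[k] Y :=
    (LinearMap.llcomp k Y (X ⊗[k] Y) (X ⊗[k] Y)).flip (TensorProduct.mk k X Y x) ∘ₗ
      (TensorAlgebra.lift k (E.opRight Y)).toLinearMap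
  let G : TensorAlgebra k V →ₗ[k] Y →ₗ[k] X ⊗[k] Y :=
    (LinearMap.llcomp k Y Y (X ⊗[k] Y)) (TensorProduct.mk k X Y x) ∘ₗ
      (Algebra.lsmul k k Y).toLinearMap ∘ₗ (B.diag (fun i => χ (B.row i))).toLinearMap ∘ₗ
        (NicholsAlgebra.mk c).toLinearMap
  suffices h : F = G from LinearMap.congr_fun₂ h t y
  refine TensorAlgebra.linearMap_ext_basis B.x (LinearMap.ext fun y => ?_)
    fun i t h => LinearMap.ext fun y => ?_
  · change TensorAlgebra.lift k (E.opRight Y) 1 (x ⊗ₜ y) =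
      x ⊗ₜ[k] (B.diag (fun i => χ (B.row i)) (NicholsAlgebra.mk c 1) • y)
    simp
  · have h' : TensorAlgebra.lift k (E.opRight Y) t (x ⊗ₜ y) =
      x ⊗ₜ[k] (B.diag (fun i => χ (B.row i)) (NicholsAlgebra.mk c t) • y) :=
      LinearMap.congr_fun h y
    have e : NicholsAlgebra.mk c (TensorAlgebra.ι k (B.x i)) = B.gen i := rfl
    change TensorAlgebra.lift k (E.opRight Y) (TensorAlgebra.ι k (B.x i) * t) (x ⊗ₜ y) =
      x ⊗ₜ[k] (B.diag (fun i => χ (B.row i))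
        (NicholsAlgebra.mk c (TensorAlgebra.ι k (B.x i) * t)) • y)
    rw [map_mul, Module.End.mul_apply, h', TensorAlgebra.lift_ι_apply, opRight_tmul, hx, map_mul,
      e, map_mul, B.diag_gen, mul_smul, smul_assoc]
    exact TensorProduct.smul_tmul (R := k) (χ (B.row i) : k) x _

/-- Eigenvectors of `D` span `X` additively, which reduces to the preceding case. -/
theorem lift_opRight (n : ℕ) (z : TPow k V n) (hz : c.symmetrizer n z = 0) :
    TensorAlgebra.lift k (E.opRight Y) (TPow.toTensorAlgebra k V n z) = 0 := by
  refine TensorProduct.ext' fun x y => ?_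
  rw [LinearMap.zero_apply]
  induction E.mem_closure_eigenvectors x using AddSubmonoid.closure_induction with
  | mem x hx =>
    obtain ⟨χ, hx⟩ := hx
    rw [E.lift_opRight_eigenvector Y χ x hx, NicholsAlgebra.mk_eq_zero c n z hz, map_zero,
      zero_smul, TensorProduct.tmul_zero]
  | zero => rw [TensorProduct.zero_tmul, map_zero]
  | add a b _ _ ha hb => rw [TensorProduct.add_tmul, map_add, ha, hb, add_zero]

-- Semilinearity of the action gives `g_i (x_j x) = q_ij x_j (g_i x)`, the relation required for
-- adding the two families of operators.
omit [IsAlgClosed k] [CharZero k] [Finite B.D] in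
theorem opRight_mul_opLeft (i j : Fin B.θ) : E.opRight Y (B.x i) * opLeft Y (B.x j) =
    (B.q i j : k) • (opLeft Y (B.x j) * E.opRight Y (B.x i)) := by
  refine TensorProduct.ext' fun x y => ?_
  have e : B.diag (B.row i) (B.gen j) = (B.q i j : k) • B.gen j := B.diag_gen _ j
  rw [Module.End.mul_apply, LinearMap.smul_apply, Module.End.mul_apply, opLeft_tmul,
    opRight_tmul, opRight_tmul, opLeft_tmul, E.act_smul, e, smul_assoc]
  rfl

theorem lift_opLeft_add_opRight (n : ℕ) (z : TPow k V n) (hz : c.symmetrizer n z = 0) :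
    TensorAlgebra.lift k (opLeft Y + E.opRight Y) (TPow.toTensorAlgebra k V n z) = 0 := by
  have h1 := E.opRight_mul_opLeft Y
  have h2 := E.lift_opRight Y
  have h3 := lift_opLeft (X := X) (c := c) Y
  generalize opLeft (X := X) (c := c) Y = a at *
  generalize E.opRight Y = b at *
  exact lift_add_toTensorAlgebra_eq_zero B.x B.q a b c B.braiding_eq h3 h2 h1 n z hz

/-- The action of `R` on `X ⊗ Y`, with `x_i ⬝ (x ⊗ y) = x_i x ⊗ y + g_i x ⊗ x_i y`. -/
noncomputable def tensorHom : NicholsAlgebra c →ₐ[k] Module.End k (X ⊗[k] Y) :=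
  NicholsAlgebra.lift c (TensorAlgebra.lift k (opLeft Y + E.opRight Y))
    (E.lift_opLeft_add_opRight Y)

theorem tensorHom_gen (i : Fin B.θ) (x : X) (y : Y) : E.tensorHom Y (B.gen i) (x ⊗ₜ y) =
    (B.gen i • x) ⊗ₜ[k] y + E.act (B.row i) x ⊗ₜ[k] (B.gen i • y) := by
  have : E.tensorHom Y (B.gen i) = opLeft Y (B.x i) + E.opRight Y (B.x i) := by
    refine (NicholsAlgebra.lift_mk c _ _ _).trans ?_
    rw [TensorAlgebra.lift_ι_apply]
    rfl
  rw [this, LinearMap.add_apply, opLeft_tmul, opRight_tmul]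

/-- The `R`-module `X ⊗ Y`. -/
noncomputable def tensorObj : ModuleCat.{u} (NicholsAlgebra c) :=
  @ModuleCat.of _ _ (X ⊗[k] Y) _ (Module.compHom _ (E.tensorHom Y).toRingHom)

/-- The identification of `X ⊗ Y` with the module `tensorObj`. -/
noncomputable def toObj : X ⊗[k] Y ≃+ E.tensorObj Y := AddEquiv.refl (X ⊗[k] Y)

theorem gen_smul_toObj (i : Fin B.θ) (x : X) (y : Y) : B.gen i • E.toObj Y (x ⊗ₜ y) =
    E.toObj Y ((B.gen i • x) ⊗ₜ[k] y + E.act (B.row i) x ⊗ₜ[k] (B.gen i • y)) :=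
  E.tensorHom_gen Y i x y

theorem algebraMap_smul_toObj (r : k) (t : X ⊗[k] Y) :
    algebraMap k (NicholsAlgebra c) r • E.toObj Y t = E.toObj Y (r • t) := by
  change E.tensorHom Y (algebraMap k _ r) t = r • t
  rw [AlgHom.commutes]
  rfl

variable {Y}

/-- A morphism from `tensorObj`. -/
noncomputable def homOfTensor {Z : ModuleCat.{u} (NicholsAlgebra c)} (f : X ⊗[k] Y →+ Z)
    (h1 : ∀ (r : k) (t : X ⊗[k] Y), f (r • t) = algebraMap k (NicholsAlgebra c) r • f t)
    (h2 : ∀ i (x : X) (y : Y), f ((B.gen i • x) ⊗ₜ[k] y + E.act (B.row i) x ⊗ₜ[k] (B.gen i • y)) =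
      B.gen i • f (x ⊗ₜ y)) : E.tensorObj Y ⟶ Z :=
  B.homOfGen (f.comp (E.toObj Y).symm.toAddMonoidHom)
    (fun r t => by
      obtain ⟨t, rfl⟩ := (E.toObj Y).surjective t
      rw [algebraMap_smul_toObj]
      exact h1 r t)
    (fun i t => by
      obtain ⟨t, rfl⟩ := (E.toObj Y).surjective t
      induction t using TensorProduct.induction_on with
      | zero => simp only [map_zero, smul_zero]
      | add s t hs ht => simp only [map_add, smul_add, hs, ht]
      | tmul x y =>
        rw [gen_smul_toObj]
        exact h2 i x y)

theorem hom_ext_tensorObj {Z : ModuleCat.{u} (NicholsAlgebra c)} {f g : E.tensorObj Y ⟶ Z}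
    (h : ∀ (x : X) (y : Y), f.hom (E.toObj Y (x ⊗ₜ y)) = g.hom (E.toObj Y (x ⊗ₜ y))) : f = g := by
  ext t
  obtain ⟨t, rfl⟩ := (E.toObj Y).surjective t
  induction t using TensorProduct.induction_on with
  | zero => simp only [map_zero]
  | add s t hs ht => simp only [map_add, hs, ht]
  | tmul x y => exact h x y

/-- The functor `X ⊗ -`. -/
noncomputable def tensorFunctor : ModuleCat.{u} (NicholsAlgebra c) ⥤ ModuleCat.{u} (NicholsAlgebra c)
    where
  obj Y := E.tensorObj Y
  map {Y Z} f := E.homOfTensor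
    ((E.toObj Z).toAddMonoidHom.comp ((f.hom.restrictScalars k).lTensor X).toAddMonoidHom)
    (fun r t => by
      change E.toObj Z ((f.hom.restrictScalars k).lTensor X (r • t)) = _
      rw [map_smul, ← algebraMap_smul_toObj]
      rfl)
    (fun i x y => by
      change E.toObj Z (((B.gen i • x) ⊗ₜ[k] f.hom y + E.act (B.row i) x ⊗ₜ[k]
        f.hom (B.gen i • y))) = B.gen i • E.toObj Z (x ⊗ₜ[k] f.hom y)
      rw [map_smul, ← gen_smul_toObj])
  map_id Y := E.hom_ext_tensorObj fun x y => rfl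
  map_comp f g := E.hom_ext_tensorObj fun x y => rfl

instance : E.tensorFunctor.Additive where
  map_add {Y Z f g} := E.hom_ext_tensorObj fun x y => by
    change E.toObj Z (x ⊗ₜ (f.hom y + g.hom y)) =
      E.toObj Z (x ⊗ₜ f.hom y) + E.toObj Z (x ⊗ₜ g.hom y)
    rw [TensorProduct.tmul_add, map_add]

theorem tensorFunctor_exact : Limits.PreservesFiniteLimits E.tensorFunctor ∧
    Limits.PreservesFiniteColimits E.tensorFunctor := by
  refine exact_of_map_shortExact _ fun T hT => ?_
  rw [ModuleCat.shortExact_iff] at hT ⊢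
  obtain ⟨h1, h2, h3⟩ := hT
  refine ⟨Module.Flat.lTensor_preserves_injective_linearMap (T.f.hom.restrictScalars k) h1,
    LinearMap.lTensor_surjective X (g := T.g.hom.restrictScalars k) h2, fun t ht => ?_⟩
  have hex : Function.Exact (T.f.hom.restrictScalars k) (T.g.hom.restrictScalars k) := fun y =>
    ⟨h3 y, by
      rintro ⟨z, rfl⟩
      exact congrArg (fun f => f.hom z) T.zero⟩
  exact ((lTensor_exact X hex h2) t).1 ht

instance : Limits.PreservesFiniteLimits E.tensorFunctor := E.tensorFunctor_exact.1
instance : Limits.PreservesFiniteColimits E.tensorFunctor := E.tensorFunctor_exact.2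

end

end Equivariant

end Braiding.DiagonalDatum

end Equivariant

/-! ### Natural transformations between tensor functors, units and twists. -/

section EquivariantMaps

open TensorProduct CategoryTheory
open scoped ModuleCat

variable {k : Type u} [Field k] {V : Type u} [AddCommGroup V] [Module k V]

namespace Braiding.DiagonalDatum

variable {c : Braiding k V} (B : c.DiagonalDatum)

/-- Restriction of scalars along a diagonal automorphism. -/
noncomputable abbrev twist (d : Fin B.θ → kˣ) :
    ModuleCat.{u} (NicholsAlgebra c) ⥤ ModuleCat.{u} (NicholsAlgebra c) :=
  ModuleCat.restrictScalars (B.diag d).toRingHom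

instance (d : Fin B.θ → kˣ) : Limits.PreservesFiniteLimits (B.twist d) :=
  (restrictScalars_exact _).1
instance (d : Fin B.θ → kˣ) : Limits.PreservesFiniteColimits (B.twist d) :=
  (restrictScalars_exact _).2

/-- The identification of the trivial module with the field. -/
noncomputable def _root_.trivialModuleVal {A : Type u} [Ring A] [Algebra k A] (ε : A →ₐ[k] k) :
    trivialModule ε ≃ₗ[k] k where
  toFun a := a
  invFun a := a
  map_add' _ _ := rfl
  map_smul' r a := by
    change ε (algebraMap k _ r) * (show k from a) = r * (show k from a)
    rw [AlgHom.commutes]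
    rfl
  left_inv _ := rfl
  right_inv _ := rfl

theorem _root_.trivialModuleVal_smul {A : Type u} [Ring A] [Algebra k A] (ε : A →ₐ[k] k) (r : A)
    (a : trivialModule ε) : trivialModuleVal ε (r • a) = ε r * trivialModuleVal ε a := rfl

/-- The coordinate on the trivial module of the Nichols algebra. -/
noncomputable abbrev _root_.NicholsAlgebra.val (c : Braiding k V) :
    trivialModule (NicholsAlgebra.aug c) ≃ₗ[k] k := trivialModuleVal _

theorem gen_smul_trivialModule (i : Fin B.θ) (a : trivialModule (NicholsAlgebra.aug c)) :
    B.gen i • a = 0 := (NicholsAlgebra.val c).injective (by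
  rw [trivialModuleVal_smul, aug_gen, zero_mul, map_zero])

/-- The trivial module is isomorphic to its twists. -/
noncomputable def twistIso (d : Fin B.θ → kˣ) : trivialModule (NicholsAlgebra.aug c) ≅
    (B.twist d).obj (trivialModule (NicholsAlgebra.aug c)) where
  hom := ModuleCat.ofHom (X := trivialModule (NicholsAlgebra.aug c))
    (Y := (B.twist d).obj (trivialModule (NicholsAlgebra.aug c)))
    { toFun := fun a => a
      map_add' := fun _ _ => rfl
      map_smul' := fun r a => (NicholsAlgebra.val c).injective (by
        change NicholsAlgebra.aug c r * _ = NicholsAlgebra.aug c (B.diag d r) * _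
        rw [aug_diag]) }
  inv := ModuleCat.ofHom (X := (B.twist d).obj (trivialModule (NicholsAlgebra.aug c)))
    (Y := trivialModule (NicholsAlgebra.aug c))
    { toFun := fun a => a
      map_add' := fun _ _ => rfl
      map_smul' := fun r a => (NicholsAlgebra.val c).injective (by
        change NicholsAlgebra.aug c (B.diag d r) * _ = NicholsAlgebra.aug c r * _
        rw [aug_diag]) }

/-- The trivial module, with the trivial action of `D`. -/
noncomputable def trivial : B.Equivariant (trivialModule (NicholsAlgebra.aug c)) where
  act := 1
  act_smul d r a := (NicholsAlgebra.val c).injective (by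
    rw [trivialModuleVal_smul]
    change _ = NicholsAlgebra.val c (B.diag d r • a)
    rw [trivialModuleVal_smul, aug_diag]
    rfl)

variable {B}

/-- The scaling by the values of a character on the rows of the braiding matrix. -/
def rowChar (χ : B.D →* kˣ) : Fin B.θ → kˣ := fun i => χ (B.row i)

namespace Equivariant

section
variable {X : ModuleCat.{u} (NicholsAlgebra c)} (E : B.Equivariant X)

/-- The action of `d`, as a morphism to the twist of `X`. -/
noncomputable def actHom (d : B.D) : X ⟶ (B.twist d).obj X :=
  ModuleCat.ofHom (X := X) (Y := (B.twist d).obj X)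
    { E.act d with map_smul' := fun r x => E.act_smul d r x }

variable {X' : ModuleCat.{u} (NicholsAlgebra c)} (E' : B.Equivariant X')
variable {X'' : ModuleCat.{u} (NicholsAlgebra c)} (E'' : B.Equivariant X'')

theorem actHom_naturality (φ : X ⟶ X') (hφ : ∀ d x, φ.hom (E.act d x) = E'.act d (φ.hom x))
    (d : B.D) : E.actHom d ≫ (B.twist d).map φ = φ ≫ E'.actHom d := by
  ext x
  exact hφ d x

/-- The action of `D` on the kernel of an equivariant morphism. -/
noncomputable def kernel (φ : X ⟶ X') (hφ : ∀ d x, φ.hom (E.act d x) = E'.act d (φ.hom x)) :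
    B.Equivariant (ModuleCat.of _ (LinearMap.ker φ.hom)) where
  act :=
    { toFun := fun d => ((E.act d).comp (LinearMap.ker φ.hom).toAddSubgroup.subtype).codRestrict
        (LinearMap.ker φ.hom).toAddSubgroup fun x => by
          change φ.hom (E.act d x) = 0
          rw [hφ, LinearMap.mem_ker.1 x.2, map_zero]
      map_one' := by
        ext x
        change E.act 1 x = x
        rw [map_one]; rfl
      map_mul' := fun d d' => by
        ext x
        change E.act (d * d') x = E.act d (E.act d' x)
        rw [map_mul]; rfl }
  act_smul d r x := Subtype.ext (E.act_smul d r x)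

/-- The action of `D` on the free module `R ⊗ X`. -/
noncomputable def free : B.Equivariant (ModuleCat.of _ (NicholsAlgebra c ⊗[k] X)) where
  act :=
    { toFun := fun d => (TensorProduct.map (B.diag d).toLinearMap (E.lin d)).toAddMonoidHom
      map_one' := by
        ext t
        change TensorProduct.map (B.diag 1).toLinearMap (E.lin 1) t = t
        rw [diag_one, map_one]
        exact LinearMap.congr_fun TensorProduct.map_id t
      map_mul' := fun d d' => by
        ext t
        change TensorProduct.map (B.diag (d * d')).toLinearMap (E.lin (d * d')) t =
          TensorProduct.map (B.diag d).toLinearMap (E.lin d)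
            (TensorProduct.map (B.diag d').toLinearMap (E.lin d') t)
        rw [diag_mul, map_mul, ← LinearMap.comp_apply, ← TensorProduct.map_comp]
        rfl }
  act_smul d r t := by
    change NicholsAlgebra c ⊗[k] X at t
    change TensorProduct.map (B.diag d).toLinearMap (E.lin d) (r • t) =
      B.diag d r • TensorProduct.map (B.diag d).toLinearMap (E.lin d) t
    induction t using TensorProduct.induction_on with
    | zero => simp only [map_zero, smul_zero]
    | add s t hs ht => simp only [map_add, smul_add, hs, ht]
    | tmul s x =>
      rw [TensorProduct.smul_tmul', TensorProduct.map_tmul, TensorProduct.map_tmul,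
        TensorProduct.smul_tmul']
      congr 1
      exact map_mul (B.diag d) r s

/-- The morphism `r ⊗ x ↦ r x`. -/
noncomputable def freeHom (X : ModuleCat.{u} (NicholsAlgebra c)) :
    ModuleCat.of _ (NicholsAlgebra c ⊗[k] X) ⟶ X :=
  ModuleCat.ofHom (TensorProduct.AlgebraTensorModule.lift
    { toFun := fun r => (Algebra.lsmul k k X r)
      map_add' := map_add _
      map_smul' := fun r s => map_mul (Algebra.lsmul k k X) r s })

theorem freeHom_tmul (r : NicholsAlgebra c) (x : X) :
    (freeHom X).hom (r ⊗ₜ[k] x : NicholsAlgebra c ⊗[k] X) = r • x := rfl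

theorem freeHom_act (d : B.D) (t : NicholsAlgebra c ⊗[k] X) :
    (freeHom X).hom (E.free.act d t) = E.act d ((freeHom X).hom t) := by
  induction t using TensorProduct.induction_on with
  | zero => simp only [map_zero]
  | add s t hs ht => simp only [map_add, hs, ht]
  | tmul s x => exact (E.act_smul d s x).symm

variable [IsAlgClosed k] [CharZero k] [Finite B.D]

/-- The natural transformation induced by an equivariant morphism. -/
noncomputable def tensorMap (φ : X ⟶ X') (hφ : ∀ d x, φ.hom (E.act d x) = E'.act d (φ.hom x)) :
    E.tensorFunctor ⟶ E'.tensorFunctor where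
  app Y := E.homOfTensor
    ((E'.toObj Y).toAddMonoidHom.comp ((φ.hom.restrictScalars k).rTensor Y).toAddMonoidHom)
    (fun r t => by
      change E'.toObj Y ((φ.hom.restrictScalars k).rTensor Y (r • t)) = _
      rw [map_smul, ← algebraMap_smul_toObj]
      rfl)
    (fun i x y => by
      change E'.toObj Y (φ.hom (B.gen i • x) ⊗ₜ[k] y + φ.hom (E.act (B.row i) x) ⊗ₜ[k]
        (B.gen i • y)) = B.gen i • E'.toObj Y (φ.hom x ⊗ₜ[k] y)
      rw [map_smul, hφ, ← gen_smul_toObj])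
  naturality Y Z f := E.hom_ext_tensorObj fun x y => rfl

theorem tensorMap_shortExact (φ : X ⟶ X') (ψ : X' ⟶ X'')
    (hφ : ∀ d x, φ.hom (E.act d x) = E'.act d (φ.hom x))
    (hψ : ∀ d x, ψ.hom (E'.act d x) = E''.act d (ψ.hom x)) (w : φ ≫ ψ = 0)
    (h : (ShortComplex.mk φ ψ w).ShortExact) (Y : ModuleCat.{u} (NicholsAlgebra c))
    (w' : (E.tensorMap E' φ hφ).app Y ≫ (E'.tensorMap E'' ψ hψ).app Y = 0) :
    (ShortComplex.mk _ _ w').ShortExact := by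
  rw [ModuleCat.shortExact_iff] at h ⊢
  obtain ⟨h1, h2, h3⟩ := h
  refine ⟨Module.Flat.rTensor_preserves_injective_linearMap (φ.hom.restrictScalars k) h1,
    LinearMap.rTensor_surjective Y (g := ψ.hom.restrictScalars k) h2, fun t ht => ?_⟩
  have hex : Function.Exact (φ.hom.restrictScalars k) (ψ.hom.restrictScalars k) := fun y =>
    ⟨h3 y, by
      rintro ⟨z, rfl⟩
      exact congrArg (fun f => f.hom z) w⟩
  exact ((rTensor_exact Y hex h2) t).1 ht

theorem tensorMap_comp_eq_zero (φ : X ⟶ X') (ψ : X' ⟶ X'')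
    (hφ : ∀ d x, φ.hom (E.act d x) = E'.act d (φ.hom x))
    (hψ : ∀ d x, ψ.hom (E'.act d x) = E''.act d (ψ.hom x)) (w : φ ≫ ψ = 0)
    (Y : ModuleCat.{u} (NicholsAlgebra c)) :
    (E.tensorMap E' φ hφ).app Y ≫ (E'.tensorMap E'' ψ hψ).app Y = 0 :=
  E.hom_ext_tensorObj fun x y => by
    have e : ψ.hom (φ.hom x) = 0 := congrArg (fun f => f.hom x) w
    change E''.toObj Y (ψ.hom (φ.hom x) ⊗ₜ[k] y) = 0
    rw [e, TensorProduct.zero_tmul, map_zero]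

/-- The morphism `X ⊗ k → X`. -/
noncomputable def unitor : E.tensorFunctor.obj (trivialModule (NicholsAlgebra.aug c)) ⟶ X :=
  let f : X ⊗[k] trivialModule (NicholsAlgebra.aug c) →ₗ[k] X :=
    TensorProduct.lift ((LinearMap.lsmul k X).flip.compl₂ (NicholsAlgebra.val c).toLinearMap)
  E.homOfTensor f.toAddMonoidHom (fun r t => map_smul f r t) (fun i x a => by
    rw [gen_smul_trivialModule, TensorProduct.tmul_zero, add_zero]
    exact smul_comm (NicholsAlgebra.val c a) (B.gen i) x)

theorem unitor_tmul (x : X) (a : trivialModule (NicholsAlgebra.aug c)) :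
    E.unitor.hom (E.toObj _ (x ⊗ₜ a)) = NicholsAlgebra.val c a • x := rfl

instance isIso_unitor : IsIso E.unitor := by
  let f : E.tensorObj (trivialModule (NicholsAlgebra.aug c)) ⟶ X := E.unitor
  have hf : ∀ x a, f.hom (E.toObj _ (x ⊗ₜ a)) = NicholsAlgebra.val c a • x := E.unitor_tmul
  have h : ∀ t, t = E.toObj _ (f.hom t ⊗ₜ[k] (NicholsAlgebra.val c).symm 1) := by
    intro t
    obtain ⟨t, rfl⟩ := (E.toObj _).surjective t
    induction t using TensorProduct.induction_on with
    | zero => simp only [map_zero, TensorProduct.zero_tmul]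
    | add s t hs ht =>
      conv_lhs => rw [map_add, hs, ht]
      rw [← map_add, ← TensorProduct.add_tmul, ← map_add, ← map_add]
    | tmul x a =>
      rw [hf, TensorProduct.smul_tmul, ← map_smul, smul_eq_mul, mul_one,
        LinearEquiv.symm_apply_apply]
  refine (ConcreteCategory.isIso_iff_bijective f).2 ⟨fun s t hst => ?_, fun x => ?_⟩
  · rw [h s, h t]
    exact congrArg (fun x => E.toObj _ (x ⊗ₜ[k] (NicholsAlgebra.val c).symm 1)) hst
  · refine ⟨E.toObj _ (x ⊗ₜ[k] (NicholsAlgebra.val c).symm 1), ?_⟩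
    exact (hf x _).trans (by rw [LinearEquiv.apply_symm_apply, one_smul])

theorem unitor_naturality (φ : X ⟶ X') (hφ : ∀ d x, φ.hom (E.act d x) = E'.act d (φ.hom x)) :
    (E.tensorMap E' φ hφ).app _ ≫ E'.unitor = E.unitor ≫ φ :=
  E.hom_ext_tensorObj fun x a => ((φ.hom.restrictScalars k).map_smul (NicholsAlgebra.val c a) x).symm

/-- The natural transformation `X ⊗ Y → Y`, `x ⊗ y ↦ f(x) y` to a twist, given by an eigenvector `f`
in `Hom(X, k)`. -/
noncomputable def toTwist (f : X ⟶ trivialModule (NicholsAlgebra.aug c)) (χ : B.D →* kˣ)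
    (hf : ∀ d x, f.hom (E.act d x) = (χ d : k) • f.hom x) :
    E.tensorFunctor ⟶ B.twist (rowChar χ) where
  app Y :=
    let F : X ⊗[k] Y →ₗ[k] Y := TensorProduct.lift
      (LinearMap.lsmul k Y ∘ₗ (NicholsAlgebra.val c).toLinearMap ∘ₗ f.hom.restrictScalars k)
    E.homOfTensor (Z := (B.twist (rowChar χ)).obj Y) F.toAddMonoidHom
      (fun r t => by
        refine (map_smul F r t).trans ?_
        change algebraMap k (NicholsAlgebra c) r • F t = B.diag _ (algebraMap k _ r) • F t
        rw [AlgHom.commutes])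
      (fun i x y => by
        change F ((B.gen i • x) ⊗ₜ[k] y + E.act (B.row i) x ⊗ₜ[k] (B.gen i • y)) =
          B.diag _ (B.gen i) • F (x ⊗ₜ[k] y)
        have e2 : ∀ x y, F (x ⊗ₜ[k] y) = NicholsAlgebra.val c (f.hom x) • y := fun _ _ => rfl
        -- The term `x_i x ⊗ y` dies because `x_i` acts by zero on `k`; the term `g_i x ⊗ x_i y`
        -- contributes `χ(g_i)`, which is the scaling defining the twist.
        rw [map_add, e2, e2, e2, map_smul, gen_smul_trivialModule, map_zero, zero_smul, zero_add,
          hf, map_smul, B.diag_gen, smul_assoc, smul_assoc, smul_comm (NicholsAlgebra.val c _)]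
        rfl)
  naturality Y Z g := E.hom_ext_tensorObj fun x y =>
    ((g.hom.restrictScalars k).map_smul (NicholsAlgebra.val c (f.hom x)) y).symm

omit [IsAlgClosed k] [CharZero k] in
theorem val_smul_comm (a b : trivialModule (NicholsAlgebra.aug c)) :
    NicholsAlgebra.val c a • b = NicholsAlgebra.val c b • a :=
  (NicholsAlgebra.val c).injective (by
    rw [map_smul, map_smul, smul_eq_mul, smul_eq_mul, mul_comm])

/-- At `Y = k` the transformation is `f` itself, up to the unit and twist isomorphisms; its
naturality in `Y` therefore becomes a commutation rule for `f`. -/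
theorem toTwist_app_trivial (f : X ⟶ trivialModule (NicholsAlgebra.aug c)) (χ hf) :
    (E.toTwist f χ hf).app (trivialModule (NicholsAlgebra.aug c)) =
      E.unitor ≫ f ≫ (B.twistIso (rowChar χ)).hom :=
  E.hom_ext_tensorObj fun x a =>
    (val_smul_comm (f.hom x) a).trans
      ((f.hom.restrictScalars k).map_smul (NicholsAlgebra.val c a) x).symm

end

section
variable [IsAlgClosed k] [CharZero k] [Finite B.D]

/-- The natural transformation `k ⊗ Y → Y`. -/
noncomputable def _root_.Braiding.DiagonalDatum.trivialTensor :
    B.trivial.tensorFunctor ⟶ 𝟭 (ModuleCat.{u} (NicholsAlgebra c)) where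
  app Y :=
    let F : trivialModule (NicholsAlgebra.aug c) ⊗[k] Y →ₗ[k] Y := TensorProduct.lift
      (LinearMap.lsmul k Y ∘ₗ (NicholsAlgebra.val c).toLinearMap)
    B.trivial.homOfTensor (Z := Y) F.toAddMonoidHom (fun r t => map_smul F r t)
      (fun i a y => by
        rw [gen_smul_trivialModule, TensorProduct.zero_tmul, zero_add]
        exact smul_comm (NicholsAlgebra.val c a) (B.gen i) y)
  naturality Y Z g := B.trivial.hom_ext_tensorObj fun x y =>
    ((g.hom.restrictScalars k).map_smul (NicholsAlgebra.val c x) y).symm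

theorem _root_.Braiding.DiagonalDatum.trivialTensor_app_trivial :
    B.trivialTensor.app (trivialModule (NicholsAlgebra.aug c)) = B.trivial.unitor :=
  B.trivial.hom_ext_tensorObj fun a b => val_smul_comm a b

end

end Equivariant

end Braiding.DiagonalDatum

end EquivariantMaps

/-! ### Formal manipulations of Yoneda products. -/

section ExtComputations

open CategoryTheory CategoryTheory.Abelian

universe w' v' u'

variable {C : Type u'} [Category.{v'} C] [Abelian C] [HasExt.{w'} C]

theorem Ext.comp_mk₀_comp_conj {A X T T' : C} {n : ℕ} (i : A ⟶ X) (f : X ⟶ T) (e : T ≅ T')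
    (β : Ext A A n) (β' : Ext T' T' n)
    (key : β.comp (Ext.mk₀ (i ≫ f ≫ e.hom)) (add_zero n) =
      (Ext.mk₀ (i ≫ f ≫ e.hom)).comp β' (zero_add n)) :
    β.comp ((Ext.mk₀ i).comp (Ext.mk₀ f) (zero_add 0)) (add_zero n) =
      (Ext.mk₀ i).comp ((Ext.mk₀ f).comp ((Ext.mk₀ e.hom).comp
        (β'.comp (Ext.mk₀ e.inv) (add_zero n)) (zero_add n)) (zero_add n)) (zero_add n) := by
  have h : i ≫ f = (i ≫ f ≫ e.hom) ≫ e.inv := by simp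
  rw [Ext.mk₀_comp_mk₀, h, ← Ext.mk₀_comp_mk₀,
    ← Ext.comp_assoc _ _ _ (add_zero n) (zero_add 0) (by omega), key, ← Ext.mk₀_comp_mk₀,
    ← Ext.mk₀_comp_mk₀]
  simp only [Ext.mk₀_comp_mk₀_assoc, Ext.comp_assoc_of_second_deg_zero,
    Ext.comp_assoc_of_third_deg_zero, Category.assoc]

/-- The inductive step for commutation rules: multiplying `α` by a class `δ'` of degree one changes
the sign by `(-1) ^ n`, as `n + n * m = n * (1 + m)`. -/
theorem Ext.comp_comp_of_natural {A A' X X' T : C} (i : A ⟶ X) (i' : A' ⟶ X') (δ : Ext A' A 1)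
    (δ' : Ext X' X 1)
    (nat : δ.comp (Ext.mk₀ i) (add_zero 1) = (Ext.mk₀ i').comp δ' (zero_add 1)) {n m p r : ℕ}
    (β : Ext A A n) (β' : Ext A' A' n)
    (key : β'.comp δ rfl = (-1 : ℤ) ^ n • δ.comp β (add_comm 1 n)) (α : Ext X T m) (γ : Ext T T n)
    (hα : β.comp ((Ext.mk₀ i).comp α (zero_add m)) rfl = (-1 : ℤ) ^ (n * m) •
      (Ext.mk₀ i).comp (α.comp γ (add_comm m n)) (zero_add (n + m)))
    (hp : 1 + m = p) (h : n + p = r) (h' : p + n = r) :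
    β'.comp ((Ext.mk₀ i').comp (δ'.comp α hp) (zero_add p)) h = (-1 : ℤ) ^ (n * p) •
      (Ext.mk₀ i').comp ((δ'.comp α hp).comp γ h') (zero_add r) := by
  have h1 : (Ext.mk₀ i').comp (δ'.comp α hp) (zero_add p) =
      δ.comp ((Ext.mk₀ i).comp α (zero_add m)) hp := by
    rw [← Ext.comp_assoc _ _ _ (zero_add 1) hp (by omega), ← nat,
      Ext.comp_assoc _ _ _ (add_zero 1) (zero_add m) (by omega)]
  rw [h1, ← Ext.comp_assoc _ _ _ (rfl : n + 1 = n + 1) hp (by omega), key]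
  have h2 : ((-1 : ℤ) ^ n • δ.comp β (add_comm 1 n)).comp ((Ext.mk₀ i).comp α (zero_add m))
      (by omega : n + 1 + m = r) = (-1 : ℤ) ^ n • (δ.comp β (add_comm 1 n)).comp
        ((Ext.mk₀ i).comp α (zero_add m)) (by omega : n + 1 + m = r) :=
    map_zsmul ((Ext.bilinearComp A' A T (n + 1) m r (by omega)).flip
      ((Ext.mk₀ i).comp α (zero_add m))) _ _
  rw [h2, Ext.comp_assoc _ _ _ (add_comm 1 n) rfl (by omega), hα, Ext.comp_zsmul,
    smul_smul, ← Ext.comp_assoc _ _ _ (add_zero 1) (zero_add (n + m)) (by omega), nat,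
    Ext.comp_assoc _ _ _ (zero_add 1) (by omega : 1 + (n + m) = r) (by omega),
    Ext.comp_assoc _ _ _ hp (add_comm m n) (by omega)]
  congr 1
  rw [← pow_add, ← hp]
  congr 1
  ring

theorem Ext.comp_eq_of_conj {A T : C} (i : A ⟶ T) [IsIso i] {n m p : ℕ} (h : n + m = p)
    (h' : m + n = p) (β' : Ext A A n) (β γ : Ext T T n) (α : Ext T T m) (z : ℤ)
    (key : β'.comp (Ext.mk₀ i) (add_zero n) = (Ext.mk₀ i).comp β (zero_add n))
    (hα : β'.comp ((Ext.mk₀ i).comp α (zero_add m)) h =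
      z • (Ext.mk₀ i).comp (α.comp γ h') (zero_add p)) : β.comp α h = z • α.comp γ h' := by
  have h4 : ∀ γ : Ext T T p, (Ext.mk₀ (inv i)).comp ((Ext.mk₀ i).comp γ (zero_add p))
        (zero_add p) = γ := fun γ => by
    rw [← Ext.comp_assoc _ _ _ (zero_add 0) (zero_add p) (by omega), Ext.mk₀_comp_mk₀,
      IsIso.inv_hom_id, Ext.mk₀_id_comp]
  rw [← Ext.comp_assoc _ _ _ (add_zero n) (zero_add m) (by omega), key,
    Ext.comp_assoc _ _ _ (zero_add n) h (by omega)] at hα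
  have h3 := congrArg (fun γ => (Ext.mk₀ (inv i)).comp γ (zero_add p)) hα
  simp only [Ext.comp_zsmul] at h3
  rwa [h4, h4] at h3

end ExtComputations

/-! ### Eigenclasses and commutativity up to scalars. -/

section GoodClasses

open TensorProduct CategoryTheory CategoryTheory.Abelian
open scoped ModuleCat

variable {k : Type u} [Field k] {V : Type u} [AddCommGroup V] [Module k V]

namespace Braiding.DiagonalDatum

variable {c : Braiding k V} (B : c.DiagonalDatum)

/-- The action of the diagonal automorphisms on the cohomology of the Nichols algebra. -/
noncomputable def twistExt (d : Fin B.θ → kˣ) {n : ℕ} (β : Ext (trivialModule (NicholsAlgebra.aug c))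
    (trivialModule (NicholsAlgebra.aug c)) n) : Ext (trivialModule (NicholsAlgebra.aug c))
    (trivialModule (NicholsAlgebra.aug c)) n :=
  (Ext.mk₀ (B.twistIso d).hom).comp ((β.mapExactFunctor (B.twist d)).comp
    (Ext.mk₀ (B.twistIso d).inv) (add_zero n)) (zero_add n)

variable {B}

namespace Equivariant

variable [IsAlgClosed k] [CharZero k] [Finite B.D]

/-- A class in `Extᵐ(X, k)` that is an eigenvector of `D` for the character `χ` and commutes with the
cohomology of the Nichols algebra up to sign and twist by `χ`. -/
structure IsGood {X : ModuleCat.{u} (NicholsAlgebra c)} (E : B.Equivariant X) {m : ℕ}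
    (α : Ext X (trivialModule (NicholsAlgebra.aug c)) m) (χ : B.D →* kˣ) : Prop where
  comm : ∀ {n p : ℕ} (h : n + m = p) (h' : m + n = p) (β : Ext
    (trivialModule (NicholsAlgebra.aug c)) (trivialModule (NicholsAlgebra.aug c)) n),
    (β.mapExactFunctor E.tensorFunctor).comp ((Ext.mk₀ E.unitor).comp α (zero_add m)) h =
      (-1 : ℤ) ^ (n * m) • (Ext.mk₀ E.unitor).comp (α.comp (B.twistExt (rowChar χ) β) h')
        (zero_add p)
  act : ∀ d, (Ext.mk₀ (E.actHom d)).comp ((α.mapExactFunctor (B.twist d)).comp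
    (Ext.mk₀ (B.twistIso d).inv) (add_zero m)) (zero_add m) = (χ d : k) • α

section
variable {X : ModuleCat.{u} (NicholsAlgebra c)} (E : B.Equivariant X)

/-- In degree zero the commutation rule is the naturality of `toTwist` with respect to Ext classes.
-/
theorem isGood_mk₀ (f : X ⟶ trivialModule (NicholsAlgebra.aug c)) (χ : B.D →* kˣ)
    (hf : ∀ d x, f.hom (E.act d x) = (χ d : k) • f.hom x) : E.IsGood (Ext.mk₀ f) χ where
  comm {n p} h h' β := by
    obtain rfl : n = p := h
    have key := mapExactFunctor_comp_natTrans _ _ (E.toTwist f χ hf) β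
    rw [E.toTwist_app_trivial f χ hf] at key
    rw [mul_zero, pow_zero, one_smul]
    exact Ext.comp_mk₀_comp_conj E.unitor f (B.twistIso (rowChar χ)) _ _ key
  act d := by
    rw [Ext.mapExactFunctor_mk₀, Ext.mk₀_comp_mk₀, Ext.mk₀_comp_mk₀, ← Ext.mk₀_smul]
    congr 1
    ext x
    exact hf d x

theorem exists_isGood_zero (α : Ext X (trivialModule (NicholsAlgebra.aug c)) 0) :
    α ∈ AddSubmonoid.closure {α | ∃ χ, E.IsGood α χ} := by
  obtain ⟨f, rfl⟩ := (Ext.mk₀_bijective _ _).2 α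
  let σ : B.D →* Module.End k (X ⟶ trivialModule (NicholsAlgebra.aug c)) :=
    { toFun := fun d =>
        { toFun := fun f => E.actHom d ≫ (B.twist d).map f ≫ (B.twistIso d).inv
          map_add' := fun f g => rfl
          map_smul' := fun r f => rfl }
      map_one' := by
        ext f x
        change f.hom (E.act 1 x) = f.hom x
        rw [map_one]
        rfl
      map_mul' := fun d d' => by
        ext f x
        change f.hom (E.act (d * d') x) = f.hom (E.act d' (E.act d x))
        -- Precomposition reverses products; commutativity of `D` makes this a left action.
        rw [mul_comm, map_mul]
        rfl }
  have h := _root_.mem_closure_eigenvectors σ f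
  induction h using AddSubmonoid.closure_induction with
  | mem f hf =>
    obtain ⟨χ, hf⟩ := hf
    exact AddSubmonoid.subset_closure ⟨χ, E.isGood_mk₀ f χ fun d x =>
      congrArg (fun f => f.hom x) (hf d)⟩
  | zero => rw [Ext.mk₀_zero]; exact zero_mem _
  | add a b _ _ ha hb => rw [Ext.mk₀_add]; exact add_mem ha hb

end

section
variable {X : ModuleCat.{u} (NicholsAlgebra c)} (E : B.Equivariant X)
variable {X' : ModuleCat.{u} (NicholsAlgebra c)} (E' : B.Equivariant X')
variable {X'' : ModuleCat.{u} (NicholsAlgebra c)} (E'' : B.Equivariant X'')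

/-- Goodness survives dimension shifting: tensoring the equivariant sequence with `Y` gives an exact
sequence of functors in `Y`, so the sign rule `mapExactFunctor_comp_extClass` applies; invariance of
the sequence under `D` keeps the character. -/
theorem IsGood.extClass_comp (φ : X ⟶ X') (ψ : X' ⟶ X'')
    (hφ : ∀ d x, φ.hom (E.act d x) = E'.act d (φ.hom x))
    (hψ : ∀ d x, ψ.hom (E'.act d x) = E''.act d (ψ.hom x)) (w : φ ≫ ψ = 0)
    (hS : (ShortComplex.mk φ ψ w).ShortExact) {m p : ℕ}
    {α : Ext X (trivialModule (NicholsAlgebra.aug c)) m} {χ : B.D →* kˣ} (hα : E.IsGood α χ)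
    (hp : 1 + m = p) : E''.IsGood (hS.extClass.comp α hp) χ where
  comm {n r} h h' β := by
    have w' := E.tensorMap_comp_eq_zero E' E'' φ ψ hφ hψ w
    have hT := fun Y => E.tensorMap_shortExact E' E'' φ ψ hφ hψ w hS Y (w' Y)
    have key := mapExactFunctor_comp_extClass E.tensorFunctor E'.tensorFunctor E''.tensorFunctor
      (E.tensorMap E' φ hφ) (E'.tensorMap E'' ψ hψ) w' hT (rfl : n + 1 = n + 1) (add_comm 1 n) β
    have nat : (hT (trivialModule (NicholsAlgebra.aug c))).extClass.comp (Ext.mk₀ E.unitor)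
        (add_zero 1) = (Ext.mk₀ E''.unitor).comp hS.extClass (zero_add 1) :=
      ShortComplex.ShortExact.extClass_naturality (hT _) hS
        { τ₁ := E.unitor, τ₂ := E'.unitor, τ₃ := E''.unitor
          comm₁₂ := (E.unitor_naturality E' φ hφ).symm
          comm₂₃ := (E'.unitor_naturality E'' ψ hψ).symm }
    exact Ext.comp_comp_of_natural _ _ _ _ nat _ _ key α _
      (hα.comm rfl (add_comm m n) β) hp h h'
  act d := by
    have nat : (Ext.mk₀ (E''.actHom d)).comp (hS.extClass.mapExactFunctor (B.twist d)) (zero_add 1) =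
        hS.extClass.comp (Ext.mk₀ (E.actHom d)) (add_zero 1) := by
      rw [Ext.mapExactFunctor_extClass]
      exact (ShortComplex.ShortExact.extClass_naturality hS (hS.map_of_exact (B.twist d))
        { τ₁ := E.actHom d, τ₂ := E'.actHom d, τ₃ := E''.actHom d
          comm₁₂ := E.actHom_naturality E' φ hφ d
          comm₂₃ := E'.actHom_naturality E'' ψ hψ d }).symm
    rw [Ext.mapExactFunctor_comp, Ext.comp_assoc _ _ _ hp (add_zero m) (by omega),
      ← Ext.comp_assoc _ _ _ (zero_add 1) hp (by omega), nat,
      Ext.comp_assoc _ _ _ (add_zero 1) (zero_add m) (by omega), hα.act, Ext.comp_smul]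

end

instance projective_free (X : ModuleCat.{u} (NicholsAlgebra c)) :
    Projective (ModuleCat.of (NicholsAlgebra c) (NicholsAlgebra c ⊗[k] X)) := by
  have : Module.Projective (NicholsAlgebra c) (NicholsAlgebra c ⊗[k] X) :=
    Module.Projective.of_basis
      (Algebra.TensorProduct.basis (NicholsAlgebra c) (Module.Basis.ofVectorSpace k X))
  exact (IsProjective.iff_projective _).1 this

/-- Each class in `Ext(X, k)` is a sum of good classes. -/
theorem mem_closure_isGood {m : ℕ} {X : ModuleCat.{u} (NicholsAlgebra c)} (E : B.Equivariant X)
    (α : Ext X (trivialModule (NicholsAlgebra.aug c)) m) :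
    α ∈ AddSubmonoid.closure {α | ∃ χ, E.IsGood α χ} := by
  induction m generalizing X with
  | zero => exact E.exists_isGood_zero α
  | succ m ih =>
    -- The presentation by `R ⊗ X` is projective and equivariant, so its syzygy again carries a
    -- `D`-action and the induction hypothesis applies to it.
    let φ : ModuleCat.of (NicholsAlgebra c) (LinearMap.ker (freeHom X).hom) ⟶
        ModuleCat.of (NicholsAlgebra c) (NicholsAlgebra c ⊗[k] X) :=
      ModuleCat.ofHom (LinearMap.ker (freeHom X).hom).subtype
    have w : φ ≫ freeHom X = 0 := by
      ext x
      exact x.2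
    have hS : (ShortComplex.mk φ (freeHom X) w).ShortExact := by
      refine (ModuleCat.shortExact_iff _).2 ⟨Subtype.val_injective, fun x => ?_, fun x hx =>
        ⟨⟨x, hx⟩, rfl⟩⟩
      exact ⟨((1 : NicholsAlgebra c) ⊗ₜ[k] x : NicholsAlgebra c ⊗[k] X),
        (freeHom_tmul 1 x).trans (one_smul _ x)⟩
    have : Projective (ShortComplex.mk φ (freeHom X) w).X₂ := projective_free X
    obtain ⟨α, rfl⟩ := exists_extClass_comp hS (add_comm 1 m) α
    have h := ih (E.free.kernel E (freeHom X) E.freeHom_act) α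
    induction h using AddSubmonoid.closure_induction with
    | mem α hα =>
      obtain ⟨χ, hα⟩ := hα
      exact AddSubmonoid.subset_closure ⟨χ, IsGood.extClass_comp _ E.free E φ (freeHom X)
        (fun d x => rfl) E.freeHom_act w hS hα (add_comm 1 m)⟩
    | zero => rw [Ext.comp_zero]; exact zero_mem _
    | add a b _ _ ha hb => rw [Ext.comp_add]; exact add_mem ha hb

/-- Good classes in the cohomology ring commute up to scalars. -/
theorem IsGood.comp_eq_smul_comp {n m p : ℕ} {α : Ext (trivialModule (NicholsAlgebra.aug c))
    (trivialModule (NicholsAlgebra.aug c)) m} {β : Ext (trivialModule (NicholsAlgebra.aug c))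
    (trivialModule (NicholsAlgebra.aug c)) n} {χ ψ : B.D →* kˣ} (hα : B.trivial.IsGood α χ)
    (hβ : B.trivial.IsGood β ψ) (hχ : rowChar χ ∈ B.D) (h : n + m = p) (h' : m + n = p) :
    β.comp α h = ((-1) ^ (n * m) * (ψ ⟨rowChar χ, hχ⟩ : k)) • α.comp β h' := by
  -- For `X = k` the functor `k ⊗ -` is identified with the identity by the unit, so goodness of `α`
  -- compares `β α` with `α` times the twist of `β`. As the twist lies in `D`, goodness of `β`
  -- evaluates it.
  have key := mapExactFunctor_comp_natTrans _ _ B.trivialTensor β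
  rw [trivialTensor_app_trivial, mapExactFunctor_id] at key
  have h1 : B.twistExt (rowChar χ) β = (ψ ⟨rowChar χ, hχ⟩ : k) • β := hβ.act ⟨rowChar χ, hχ⟩
  have h2 := Ext.comp_eq_of_conj B.trivial.unitor h h' _ _ _ α _ key (hα.comm h h' β)
  rw [h2, h1, Ext.comp_smul, mul_smul, ← Int.cast_smul_eq_zsmul k]
  push_cast
  rfl

end Equivariant

end Braiding.DiagonalDatum

end GoodClasses

/-! ### The cohomology ring is noetherian. -/

section CohomologyNoetherian

open CategoryTheory CategoryTheory.Abelian DirectSum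

variable {k : Type u} [Field k] {V : Type u} [AddCommGroup V] [Module k V]
  [IsAlgClosed k] [CharZero k] {c : Braiding k V} (B : c.DiagonalDatum) [Finite B.D]

/-- If the cohomology ring of a Nichols algebra of diagonal type is finitely generated and the group
of scalings has finite exponent, the cohomology ring is noetherian. -/
theorem Braiding.DiagonalDatum.isNoetherianRing_cohomologyRing
    (hfg : HasFGCohomologyRing (NicholsAlgebra.aug c)) {N : ℕ} (hN : 0 < N)
    (hD : ∀ d : B.D, d ^ N = 1) (hχ : ∀ χ : B.D →* kˣ, rowChar χ ∈ B.D) :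
    IsNoetherianRing (CohomologyRing (NicholsAlgebra.aug c)) := by
  classical
  let T := trivialModule (NicholsAlgebra.aug c)
  let G : Set (CohomologyRing (NicholsAlgebra.aug c)) :=
    {a | ∃ (n : ℕ) (α : Ext T T n), (∃ χ, B.trivial.IsGood α χ) ∧ of (fun n => Ext T T n) n α = a}
  have hG : ∀ a, a ∈ AddSubmonoid.closure G := by
    intro a
    induction a using DirectSum.induction_on with
    | zero => exact zero_mem _
    | add a b ha hb => exact add_mem ha hb
    | of n α =>
      have h := B.trivial.mem_closure_isGood α
      induction h using AddSubmonoid.closure_induction with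
      | mem α hα => exact AddSubmonoid.subset_closure ⟨n, α, hα, rfl⟩
      | zero => rw [map_zero]; exact zero_mem _
      | add a b _ _ ha hb => rw [map_add]; exact add_mem ha hb
  -- Each of the given algebra generators may be replaced by the finitely many good homogeneous
  -- classes of which it is a sum.
  have hfin : ∀ a, ∃ t : Finset (CohomologyRing (NicholsAlgebra.aug c)), ↑t ⊆ G ∧
      a ∈ Algebra.adjoin k (t : Set (CohomologyRing (NicholsAlgebra.aug c))) := by
    intro a
    induction hG a using AddSubmonoid.closure_induction with
    | mem a ha => exact ⟨{a}, by simpa using ha, Algebra.subset_adjoin (by simp)⟩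
    | zero => exact ⟨∅, by simp, zero_mem _⟩
    | add a b _ _ ha hb =>
      obtain ⟨s, hs, ha⟩ := ha
      obtain ⟨t, ht, hb⟩ := hb
      refine ⟨s ∪ t, by simp [hs, ht], add_mem (Algebra.adjoin_mono ?_ ha)
        (Algebra.adjoin_mono ?_ hb)⟩ <;> simp
  choose t ht ht' using hfin
  obtain ⟨s, hs⟩ := hfg.out
  let gens := s.biUnion t
  have hu : ∀ a ∈ gens, a ∈ G := fun a ha => by
    obtain ⟨b, _, hb⟩ := Finset.mem_biUnion.1 ha
    exact ht b hb
  -- The exponent `2 * N` kills both the Koszul sign and the character values, which are `N`-th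
  -- roots of unity.
  refine isNoetherianRing_of_quasi_commute (k := k) (fun a : gens => (a : CohomologyRing _)) ?_
    (by omega : 0 < 2 * N) fun a b => ?_
  · rw [eq_top_iff, ← hs, Algebra.adjoin_le_iff]
    intro a ha
    have hsub : (t a : Set (CohomologyRing (NicholsAlgebra.aug c))) ⊆
        Set.range (fun a : gens => (a : CohomologyRing (NicholsAlgebra.aug c))) :=
      fun b hb => ⟨⟨b, Finset.mem_biUnion.2 ⟨a, ha, hb⟩⟩, rfl⟩
    exact Algebra.adjoin_mono hsub (ht' a)
  · obtain ⟨n, β, ⟨ψ, hβ⟩, hb⟩ := hu _ a.2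
    obtain ⟨m, α, ⟨χ, hα⟩, ha⟩ := hu _ b.2
    refine ⟨(-1) ^ (n * m) * (ψ ⟨rowChar χ, hχ χ⟩ : k), ?_, ?_⟩
    · have h1 : (ψ ⟨rowChar χ, hχ χ⟩ : k) ^ N = 1 := by
        rw [← Units.val_pow_eq_pow_val, ← map_pow, hD, map_one, Units.val_one]
      rw [mul_pow, mul_comm 2 N, pow_mul (ψ _ : k), h1, one_pow, mul_one, ← pow_mul]
      exact Even.neg_one_pow ⟨n * m * N, by ring⟩
    · rw [← hb, ← ha, DirectSum.of_mul_of, DirectSum.of_mul_of]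
      have key := hα.comp_eq_smul_comp hβ (hχ χ) rfl (add_comm m n)
      have e : of (fun n => Ext T T n) (m + n) (α.comp β rfl) =
          of (fun n => Ext T T n) (n + m) (α.comp β (add_comm m n)) :=
        DirectSum.of_eq_of_gradedMonoid_eq (Ext.mk_comp_eq α β _ _)
      change of (fun n => Ext T T n) (n + m) (β.comp α rfl) = _ • of (fun n => Ext T T n) (m + n)
        (α.comp β rfl)
      rw [e, key]
      exact (DirectSum.lof k ℕ (fun n => Ext T T n) (n + m)).map_smul _ _

end CohomologyNoetherian

/-! ### Braiding matrices realizable over a finite group. -/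

section RootsOfUnity

open TensorProduct Coalgebra

variable {k : Type u} [Field k] {V : Type u} [AddCommGroup V] [Module k V]

section
variable {H : Type u} [Ring H] [HopfAlgebra k H]

variable (k H) in
/-- The map `h ↦ h₁ h₂ ⋯ hₙ`. -/
noncomputable def adamsMap : ℕ → (H →ₗ[k] H)
  | 0 => Algebra.linearMap k H ∘ₗ counit
  | n + 1 => LinearMap.mul' k H ∘ₗ (adamsMap n).lTensor H ∘ₗ comul

/-- The map `v ↦ φ(v₋₁) ⬝ w ⊗ v₀`. -/
noncomputable def YetterDrinfeld.coactBy (ρ : YetterDrinfeld k H V) (φ : H →ₗ[k] H) (w : V) :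
    V →ₗ[k] V ⊗[k] V := (ρ.act.toLinearMap.flip w ∘ₗ φ).rTensor V ∘ₗ ρ.coact

theorem YetterDrinfeld.coactBy_zero (ρ : YetterDrinfeld k H V) (w v : V) :
    ρ.coactBy (adamsMap k H 0) w v = w ⊗ₜ v := by
  have h : (ρ.act.toLinearMap.flip w ∘ₗ adamsMap k H 0).rTensor V = TensorProduct.mk k V V w ∘ₗ
      (TensorProduct.lid k V).toLinearMap ∘ₗ counit.rTensor V := by
    refine TensorProduct.ext' fun h v => ?_
    simp [adamsMap, Algebra.algebraMap_eq_smul_one, TensorProduct.smul_tmul]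
  have h' := LinearMap.congr_fun ρ.coact_counit v
  rw [coactBy, h]
  exact congrArg (w ⊗ₜ[k] ·) h'

/-- Coassociativity splits off one leg of the coaction: the inner legs act through `f` by
hypothesis, and the outer one is the braiding. -/
theorem YetterDrinfeld.coactBy_succ (ρ : YetterDrinfeld k H V) (n : ℕ) (w v : V)
    (f : V →ₗ[k] V) (hf : ∀ u, ρ.coactBy (adamsMap k H n) w u = w ⊗ₜ f u) :
    ρ.coactBy (adamsMap k H (n + 1)) w v = f.lTensor V (ρ.braiding (v ⊗ₜ w)) := by
  let F : H ⊗[k] (H ⊗[k] V) →ₗ[k] V ⊗[k] V := TensorProduct.lift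
    ((LinearMap.llcomp k (H ⊗[k] V) (V ⊗[k] V) (V ⊗[k] V)).flip
      ((ρ.act.toLinearMap.flip w ∘ₗ adamsMap k H n).rTensor V) ∘ₗ
        LinearMap.rTensorHom V ∘ₗ ρ.act.toLinearMap)
  have hF : ∀ h t, F (h ⊗ₜ t) = (ρ.act h).rTensor V
      ((ρ.act.toLinearMap.flip w ∘ₗ adamsMap k H n).rTensor V t) := fun _ _ => rfl
  have h1 : F ∘ₗ (TensorProduct.assoc k H H V).toLinearMap ∘ₗ comul.rTensor V =
      (ρ.act.toLinearMap.flip w ∘ₗ adamsMap k H (n + 1)).rTensor V := by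
    refine TensorProduct.ext' fun h v => ?_
    have : ∀ t : H ⊗[k] H, F (TensorProduct.assoc k H H V (t ⊗ₜ v)) =
        ρ.act (LinearMap.mul' k H ((adamsMap k H n).lTensor H t)) w ⊗ₜ v := by
      intro t
      induction t using TensorProduct.induction_on with
      | zero => simp
      | add y z hy hz => simp only [TensorProduct.add_tmul, map_add, hy, hz, LinearMap.add_apply]
      | tmul a b =>
        rw [TensorProduct.assoc_tmul, hF]
        simp
    exact this _
  have h2 : F ∘ₗ ρ.coact.lTensor H = f.lTensor V ∘ₗ (ρ.act.toLinearMap.flip w).rTensor V := by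
    refine TensorProduct.ext' fun h v => ?_
    have e := hf v
    rw [coactBy, LinearMap.comp_apply] at e
    rw [LinearMap.comp_apply, LinearMap.lTensor_tmul, hF, e]
    simp
  rw [YetterDrinfeld.braiding_tmul, coactBy, ← h1, LinearMap.comp_assoc, LinearMap.comp_assoc,
    ρ.coact_coassoc, ← LinearMap.comp_assoc, h2]
  rfl

/-- Convolution powers of the identity of `H` read off powers of the `q_ij` from the braiding alone;
the realization itself need not be diagonal in the basis `x`. -/
theorem Realization.coactBy_adamsMap {θ : ℕ} (x : Module.Basis (Fin θ) k V)
    (q : Fin θ → Fin θ → kˣ) (c : Braiding k V)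
    (hc : ∀ i j, c.c (x i ⊗ₜ x j) = (q i j : k) • (x j ⊗ₜ[k] x i)) (ρ : Realization H c) (n : ℕ)
    (j : Fin θ) (v : V) : ρ.coactBy (adamsMap k H n) (x j) v =
      x j ⊗ₜ diagMap x (fun i => q i j ^ n) v := by
  induction n generalizing v with
  | zero =>
    rw [ρ.coactBy_zero]
    have : diagMap x (fun i => q i j ^ 0) = LinearMap.id := x.ext fun i => by
      rw [diagMap_basis]; simp
    rw [this]
    rfl
  | succ n ih =>
    rw [ρ.coactBy_succ n _ _ _ ih, ρ.braiding_eq]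
    suffices (diagMap x fun i => q i j ^ n).lTensor V ∘ₗ c.c.toLinearMap ∘ₗ
        (TensorProduct.mk k V V).flip (x j) =
        TensorProduct.mk k V V (x j) ∘ₗ diagMap x fun i => q i j ^ (n + 1) from
      LinearMap.congr_fun this v
    refine x.ext fun i => ?_
    simp only [LinearMap.comp_apply, LinearMap.flip_apply, TensorProduct.mk_apply,
      LinearEquiv.coe_coe, hc, map_smul, LinearMap.lTensor_tmul, diagMap_basis, smul_smul,
      TensorProduct.tmul_smul, pow_succ', Units.val_mul]

end

theorem adamsMap_monoidAlgebra_of {Γ : Type u} [Group Γ] (n : ℕ) (g : Γ) :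
    adamsMap k (MonoidAlgebra k Γ) n (MonoidAlgebra.of k Γ g) = MonoidAlgebra.of k Γ (g ^ n) := by
  induction n with
  | zero =>
    simp [adamsMap]
  | succ n ih =>
    have : comul (R := k) (MonoidAlgebra.of k Γ g) =
        MonoidAlgebra.of k Γ g ⊗ₜ[k] MonoidAlgebra.of k Γ g := by
      simp
    rw [adamsMap, LinearMap.comp_apply, LinearMap.comp_apply, this, LinearMap.lTensor_tmul, ih,
      LinearMap.mul'_apply, ← map_mul, pow_succ']

/-- The entries of the braiding matrix of a braided vector space of diagonal type that is realizable
over a finite group are roots of unity. -/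
theorem Realization.pow_card_eq_one {Γ : Type u} [Group Γ] [Finite Γ] {θ : ℕ}
    (x : Module.Basis (Fin θ) k V) (q : Fin θ → Fin θ → kˣ) (c : Braiding k V)
    (hc : ∀ i j, c.c (x i ⊗ₜ x j) = (q i j : k) • (x j ⊗ₜ[k] x i))
    (ρ : Realization (MonoidAlgebra k Γ) c) (i j : Fin θ) : q i j ^ Nat.card Γ = 1 := by
  -- On group elements the map is `g ↦ g ^ n`, so the exponents `|Γ|` and `0` agree.
  have h : adamsMap k (MonoidAlgebra k Γ) (Nat.card Γ) = adamsMap k (MonoidAlgebra k Γ) 0 := by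
    refine MonoidAlgebra.lhom_ext' fun g => LinearMap.ext_ring ?_
    have e := fun n => adamsMap_monoidAlgebra_of (k := k) n g
    have := (e (Nat.card Γ)).trans ((congrArg _ (by rw [pow_card_eq_one', pow_zero])).trans
      (e 0).symm)
    exact this
  have h1 := ρ.coactBy_adamsMap x q c hc (Nat.card Γ) j (x i)
  rw [h, ρ.coactBy_zero, diagMap_basis] at h1
  have h2 := congrArg (fun t => x.coord i (strip x j V t)) h1
  simp only [strip_tmul, map_smul, Module.Basis.coord_apply, Module.Basis.repr_self,
    Finsupp.single_eq_same, smul_eq_mul, mul_one, one_smul] at h2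
  ext
  exact h2.symm

end RootsOfUnity

/-! ### Assembly. -/

section MainTheorem

open TensorProduct

theorem finite_ker_powMonoidHom {k : Type u} [Field k] (θ : ℕ) {N : ℕ} (hN : 0 < N) :
    Finite (powMonoidHom N : (Fin θ → kˣ) →* (Fin θ → kˣ)).ker := by
  have : NeZero N := ⟨hN.ne'⟩
  have h : ∀ d ∈ (powMonoidHom N : (Fin θ → kˣ) →* (Fin θ → kˣ)).ker, ∀ i,
      d i ∈ rootsOfUnity N k := fun d hd i => congrFun (MonoidHom.mem_ker.1 hd) i
  refine Finite.of_injective (β := Fin θ → rootsOfUnity N k) (fun d i => ⟨d.1 i, h d.1 d.2 i⟩)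
    fun d d' hdd' => Subtype.ext (funext fun i => ?_)
  exact congrArg Subtype.val (congrFun hdd' i)

theorem NicholsAlgebra.isNoetherianRing_cohomologyRing {k : Type u} [Field k] [IsAlgClosed k]
    [CharZero k] {V : Type u} [AddCommGroup V] [Module k V] (c : Braiding k V)
    (hc : c.IsDiagonalType) {Γ : Type u} [Group Γ] [Finite Γ]
    (hΓ : c.IsRealizableOver (MonoidAlgebra k Γ)) (hfg : HasFGCohomologyRing (aug c)) :
    IsNoetherianRing (CohomologyRing (aug c)) := by
  obtain ⟨θ, x, q, hq⟩ := hc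
  obtain ⟨ρ⟩ := hΓ
  let B : c.DiagonalDatum :=
    { θ := θ, x := x, q := q, braiding_eq := hq
      -- All `N`-torsion scalings are taken, rather than the subgroup generated by the rows, so that
      -- `rowChar χ` lies in `D` for each character `χ` of `D`.
      D := (powMonoidHom (Nat.card Γ) : (Fin θ → kˣ) →* (Fin θ → kˣ)).ker
      mem := fun i => funext fun j => ρ.pow_card_eq_one x q c hq i j }
  have hN : 0 < Nat.card Γ := Nat.card_pos
  have hD : ∀ d : B.D, d ^ Nat.card Γ = 1 := fun d => Subtype.ext (MonoidHom.mem_ker.1 d.2)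
  have : Finite B.D := finite_ker_powMonoidHom θ hN
  refine B.isNoetherianRing_cohomologyRing hfg hN hD fun χ => ?_
  refine funext fun i => ?_
  change χ (B.row i) ^ Nat.card Γ = 1
  rw [← map_pow, hD, map_one]

end MainTheorem

theorem mainTheorem8 {k : Type u} [Field k] [IsAlgClosed k] [CharZero k]
    {V : Type u} [AddCommGroup V] [Module k V] (c : Braiding k V) (hc : c.IsDiagonalType)
    (hfin : FiniteDimensional k (NicholsAlgebra c))
    {Γ : Type u} [CommGroup Γ] [Finite Γ] (hΓ : c.IsRealizableOver (MonoidAlgebra k Γ))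
    (hfg : HasFGCohomologyRing (NicholsAlgebra.aug c))
    {K : Type u} [Ring K] [HopfAlgebra k K] [IsSemisimpleRing K] (ρ : Realization K c) :
    HasFGC (Bosonization.aug ρ) := by
  have := NicholsAlgebra.isNoetherianRing_cohomologyRing c hc hΓ hfg
  exact Smash.hasFGC_aug ρ.moduleAlgebra (NicholsAlgebra.aug c) ρ.aug_act
    fun M hM => NicholsAlgebra.isNoetherian_cohomology c M hM
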